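/- Setup. Let $\mathbf F$ be a field of characteristic $0$ and let $\Phi_0\subset E^*$ be an irreducible reduced (crystallographic) root system in the dual of a Euclidean space $E$, with Weyl group $W_0$, co-roots $\alpha^\vee\in E$, co-root lattice $Q^\vee=\mathbb Z\Phi_0^\vee$, simple roots $\alpha_1,\dots,\alpha_r$, positive and negative roots $\Phi_0^{\pm}$, and highest root $\varphi$. Let $\Phi=\Phi_0\times\mathbb Z$ be the affine root system, where $a=(\bar a,m)$ is the affine linear functional $y\mapsto \bar a(y)+m$ and $\Phi_0$ is identified with $\Phi_0\times\{0\}$. Put $s_a(y)=y-a(y)\bar a^\vee$, let $W=\langle s_a \mid a\in\Phi\rangle\cong W_0\ltimes Q^\vee$ be the affine Weyl group, $\alpha_0=(-\varphi,1)$, and $s_j=s_{\alpha_j}$ for $0\le j\le r$. Let $\Phi^{\rm nr}=\Phi\sqcup\{a/2\mid a\in\Phi,\ \bar a(Q^\vee)=2\mathbb Z\}$ and let $\mathbf k:\Phi^{\rm nr}\to\mathbf F^\times$, $a\mapsto\mathbf k_a$, be $W$-invariant; put $\mathbf k_{a/2}:=\mathbf k_a$ for $a\in\Phi$ with $a/2\notin\Phi^{\rm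 nr}$. Write $k_j=\mathbf k_{\alpha_j}$ and $u_j=\mathbf k_{\alpha_j/2}$. Fix $q_\varphi\in\mathbf F^\times$. In the group algebra $\mathbf F[Q^\vee]=\bigoplus_\mu\mathbf Fx^\mu$ put $x^{\alpha_i^\vee}$ as usual for $1\le i\le r$, $x^{\alpha_0^\vee}=q_\varphi x^{-\varphi^\vee}$, $s_i(x^\mu)=x^{s_i\mu}$ for $1\le i\le r$, and $s_0(x^\mu)=q_\varphi^{\varphi(\mu)}x^{s_\varphi\mu}$. The double affine Hecke algebra $\mathbb H=\mathbb H(\mathbf k;q_\varphi)$ is the unital associative $\mathbf F$-algebra generated by $T_0,\dots,T_r$ and $x^\mu$ $(\mu\in Q^\vee)$ with relations: the braid relations of $(W,\{s_0,\dots,s_r\})$ for the $T_j$; $(T_j-k_j)(T_j+k_j^{-1})=0$; $x^\mu x^\nu=x^{\mu+\nu}$ and $x^0=1$; and $$T_jx^\mu-s_j(x^\mu)T_j=\left(\frac{k_j-k_j^{-1}+(u_j-u_j^{-1})x^{\alpha_j^\vee}}{1-x^{2\alpha_j^\vee}}\right)\bigl(x^\mu-s_j(x^\mu)\bigr)\qquad(0\le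 j\le r,\ \mu\in Q^\vee).$$ The affine Hecke algebra $H^X\subset\mathbb H$ is the subalgebra generated by all $x^\mu$ $(\mu\in Q^\vee)$ and $T_1,\dots,T_r$. For $w\in W_0$ put $T_w=T_{i_1}\cdots T_{i_\ell}$ for a reduced expression $w=s_{i_1}\cdots s_{i_\ell}$. Let $\mathbf F[E]=\bigoplus_{y\in E}\mathbf Fx^y$ be the group algebra of $E$ (quasi-polynomials). For $s\in\mathbb R$ let $\lfloor s\rfloor_e$, $\lfloor s\rfloor_o$ be the largest even, respectively odd, integer $\le s$, and let $\chi_e,\chi_o,\chi_{\mathbb Z}:\mathbb R\to\{0,1\}$ be the indicator functions of the even integers, the odd integers and the integers. Define $\nabla_i^e,\nabla_i^o\in{\rm End}(\mathbf F[E])$ by $$\nabla_i^e(x^y)=\left(\frac{1-x^{-\lfloor\alpha_i(y)\rfloor_e\alpha_i^\vee}}{1-x^{2\alpha_i^\vee}}\right)x^y,\qquad \nabla_i^o(x^y)=\left(\frac{x^{\alpha_i^\vee}-x^{-\lfloor\alpha_i(y)\rfloor_o\alpha_i^\vee}}{1-x^{2\alpha_i^\vee}}\right)x^y .$$ Theorem.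 (1) There is a unique representation $\pi:H^X\to{\rm End}(\mathbf F[E])$ such that, for $\mu\in Q^\vee$, $1\le i\le r$ and $y\in E$, $$\pi(x^\mu)x^y=x^{y+\mu},\qquad \pi(T_i)x^y=k_i^{\chi_e(\alpha_i(y))}u_i^{\chi_o(\alpha_i(y))}x^{s_iy}+(k_i-k_i^{-1})\nabla_i^e(x^y)+(u_i-u_i^{-1})\nabla_i^o(x^y).$$ (2) For a $W$-orbit $\mathcal O\subset E$ let $\mathbf F[\mathcal O]=\bigoplus_{y\in\mathcal O}\mathbf Fx^y$. Then $\mathbf F[E]=\bigoplus_{\mathcal O\in E/W}\mathbf F[\mathcal O]$ is a decomposition into $H^X$-submodules. (3) Let $\mathcal O$ be a $W$-orbit and let $c^{\mathcal O}$ be its unique point in the closed fundamental alcove $\{y\in E\mid 0\le\alpha(y)\le 1\ \forall\alpha\in\Phi_0^+\}$. Then for all $\lambda\in Q^\vee$ and $w\in W_0$, $$\pi(x^\lambda T_w)x^{c^{\mathcal O}}=\kappa_w^{\mathcal O}x^{\lambda+wc^{\mathcal O}},\qquad \kappa_w^{\mathcal O}=\prod_{\alpha\in\Phi_0^+\cap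 w^{-1}\Phi_0^-}\mathbf k_\alpha^{\chi_e(\alpha(c^{\mathcal O}))}\,\mathbf k_{\alpha/2}^{-\chi_o(\alpha(c^{\mathcal O}))}.$$ (4) (Type ${\rm C}_r$.) Let $r\ge1$, $k,k_r,u_r\in\mathbf F^\times$, let $\epsilon_1,\dots,\epsilon_r$ be the standard basis of $\mathbb R^r$, and write $x_i=x^{\epsilon_i}$ in $\mathbf F[\mathbb R^r]$. Let $s_i$ $(1\le i<r)$ interchange the coordinates $y_i$ and $y_{i+1}$ of $y\in\mathbb R^r$, and let $s_r$ change the sign of $y_r$. The linear operators on $\mathbf F[\mathbb R^r]$ defined by $$\mathcal T_i(x^y)=k^{\chi_{\mathbb Z}(y_i-y_{i+1})}x^{s_iy}+(k-k^{-1})\left(\frac{1-(x_{i+1}/x_i)^{\lfloor y_i-y_{i+1}\rfloor}}{1-x_i/x_{i+1}}\right)x^y\qquad(1\le i<r),$$ $$\mathcal T_r(x^y)=k_r^{\chi_e(2y_r)}u_r^{\chi_o(2y_r)}x^{s_ry}+(k_r-k_r^{-1})\left(\frac{1-x_r^{-\lfloor2y_r\rfloor_e}}{1-x_r^2}\right)x^y+(u_r-u_r^{-1})\left(\frac{x_r-x_r^{-\lfloor2y_r\rfloor_o}}{1-x_r^2}\right)x^y$$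 satisfy $\mathcal T_i\mathcal T_{i+1}\mathcal T_i=\mathcal T_{i+1}\mathcal T_i\mathcal T_{i+1}$ $(1\le i<r-1)$, $\mathcal T_{r-1}\mathcal T_r\mathcal T_{r-1}\mathcal T_r=\mathcal T_r\mathcal T_{r-1}\mathcal T_r\mathcal T_{r-1}$ (if $r\ge2$), $\mathcal T_i\mathcal T_{i'}=\mathcal T_{i'}\mathcal T_i$ if $|i-i'|>1$, $(\mathcal T_i-k)(\mathcal T_i+k^{-1})=0$ $(1\le i<r)$ and $(\mathcal T_r-k_r)(\mathcal T_r+k_r^{-1})=0$. -/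

import Mathlib

/-!
# Truncated Demazure-Lusztig operators on quasi-polynomials

`F[E]` is `AddMonoidAlgebra F E`.  The ambient Euclidean space of a finite irreducible reduced root
system is `E`; the root system is a Mathlib `RootPairing` whose roots live in a space `V` in perfect
duality with `E`, so that `P.root' i : E → ℝ` is the `i`-th root as a linear functional and
`P.coroot i : E` is its co-root.
-/

namespace QuasiPoly

/-! ### Group algebras -/

section GroupAlgebra

/-- The (quasi-)monomial `x^y` of the group algebra `F[G]`. -/
noncomputable def mono (F : Type*) [Field F] {G : Type*} (y : G) : AddMonoidAlgebra F G :=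
  AddMonoidAlgebra.single y 1

/-- The linear map on `F[G]` with prescribed values on the basis `x^y`. -/
noncomputable def linExt {F G A : Type*} [Field F] [AddCommGroup A] [Module F A] (v : G → A) :
    AddMonoidAlgebra F G →ₗ[F] A where
  toFun p := p.coeff.sum fun y c => c • v y
  map_add' p q := by
    rw [AddMonoidAlgebra.coeff_add]
    exact Finsupp.sum_add_index' (fun _ => zero_smul _ _) (fun _ _ _ => add_smul _ _ _)
  map_smul' c p := by
    rw [AddMonoidAlgebra.coeff_smul, RingHom.id_apply,
      Finsupp.sum_smul_index (fun y => zero_smul F (v y)), Finsupp.smul_sum]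
    simp only [mul_smul]

theorem linExt_mono {F G A : Type*} [Field F] [AddCommGroup A] [Module F A] (v : G → A) (y : G) :
    linExt v (mono F y) = v y := by
  simp [linExt, mono]

open Classical in
/-- The exact quotient `num / den` in a commutative ring: an element `d` with `d * den = num`.
It is only used where `den` is a non-zero-divisor dividing `num`. -/
noncomputable def exactQuot {A : Type*} [CommRing A] (num den : A) : A :=
  if h : ∃ d, d * den = num then h.choose else 0

theorem exactQuot_mul {A : Type*} [CommRing A] {num den : A} (h : den ∣ num) :
    exactQuot num den * den = num := by
  obtain ⟨d, hd⟩ := h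
  have h' : ∃ d, d * den = num := ⟨d, by rw [hd, mul_comm]⟩
  rw [exactQuot, dif_pos h']
  exact h'.choose_spec

theorem exactQuot_eq {A : Type*} [CommRing A] [NoZeroDivisors A] {num den d : A} (h0 : den ≠ 0)
    (h : d * den = num) : exactQuot num den = d :=
  mul_right_cancel₀ h0 ((exactQuot_mul ⟨d, by rw [← h, mul_comm]⟩).trans h.symm)

theorem mono_zero {F : Type*} [Field F] {G : Type*} [AddCommGroup G] :
    mono F (0 : G) = 1 := rfl

theorem mono_mul {F : Type*} [Field F] {G : Type*} [AddCommGroup G] (y z : G) :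
    mono F y * mono F z = mono F (y + z) := by
  simp [mono, AddMonoidAlgebra.single_mul_single]

theorem mono_nsmul {F : Type*} [Field F] {G : Type*} [AddCommGroup G] (y : G) (n : ℕ) :
    mono F (n • y) = mono F y ^ n := by
  simp [mono, AddMonoidAlgebra.single_pow]

/-- `1 - x^y` divides `1 - x^{n y}` for every integer `n`. -/
theorem one_sub_mono_dvd {F : Type*} [Field F] {G : Type*} [AddCommGroup G] (y : G) (n : ℤ) :
    (1 - mono F y) ∣ (1 - mono F (n • y)) := by
  obtain ⟨m, rfl | rfl⟩ := n.eq_nat_or_neg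
  · rw [natCast_zsmul, mono_nsmul]
    exact one_sub_dvd_one_sub_pow _ _
  · have h : 1 - mono F (-(m : ℤ) • y) = -mono F (-(m : ℤ) • y) * (1 - mono F (m • y)) := by
      rw [mul_sub, neg_mul, mul_one, neg_mul, mono_mul, neg_smul, natCast_zsmul, neg_add_cancel,
        mono_zero]
      ring
    rw [h, mono_nsmul]
    exact (one_sub_dvd_one_sub_pow _ _).mul_left _

theorem one_sub_mono_ne_zero {F : Type*} [Field F] {G : Type*} [AddCommGroup G] {y : G}
    (hy : y ≠ 0) : (1 - mono F y) ≠ 0 := by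
  intro h
  have h1 : mono F (0 : G) = mono F y := by rw [mono_zero]; exact sub_eq_zero.mp h
  exact hy ((AddMonoidAlgebra.single_left_injective one_ne_zero h1).symm)

instance noZeroDivisors {F : Type*} [Field F] {E : Type*} [AddCommGroup E] [Module ℝ E] :
    NoZeroDivisors (AddMonoidAlgebra F E) := by
  let _ : Module ℚ E := Module.compHom E (algebraMap ℚ ℝ)
  infer_instance

end GroupAlgebra

/-! ### Even and odd floors and indicator functions -/

/-- The largest even integer `≤ s`. -/
noncomputable def floorE (s : ℝ) : ℤ := 2 * ⌊s / 2⌋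

/-- The largest odd integer `≤ s`. -/
noncomputable def floorO (s : ℝ) : ℤ := floorE (s + 1) - 1

theorem floorE_isGreatest (s : ℝ) : IsGreatest {n : ℤ | Even n ∧ (n : ℝ) ≤ s} (floorE s) := by
  refine ⟨⟨even_two_mul _, ?_⟩, ?_⟩
  · have := Int.floor_le (s / 2)
    rw [floorE]; push_cast; linarith
  · rintro n ⟨⟨m, rfl⟩, hm⟩
    have : m ≤ ⌊s / 2⌋ := Int.le_floor.mpr (by push_cast at hm; linarith)
    rw [floorE]; omega

theorem floorO_isGreatest (s : ℝ) : IsGreatest {n : ℤ | Odd n ∧ (n : ℝ) ≤ s} (floorO s) := by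
  obtain ⟨⟨h1, h2⟩, h3⟩ := floorE_isGreatest (s + 1)
  refine ⟨⟨h1.sub_odd odd_one, ?_⟩, ?_⟩
  · rw [floorO]; push_cast; linarith
  · rintro n ⟨hn, hm⟩
    have := h3 (a := n + 1) ⟨hn.add_odd odd_one, by push_cast; linarith⟩
    rw [floorO]; omega

open Classical in
/-- The indicator function of the even integers inside `ℝ`. -/
noncomputable def chiE (s : ℝ) : ℤ := if ∃ n : ℤ, Even n ∧ (n : ℝ) = s then 1 else 0

open Classical in
/-- The indicator function of the odd integers inside `ℝ`. -/
noncomputable def chiO (s : ℝ) : ℤ := if ∃ n : ℤ, Odd n ∧ (n : ℝ) = s then 1 else 0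

open Classical in
/-- The indicator function of the integers inside `ℝ`. -/
noncomputable def chiZ (s : ℝ) : ℤ := if ∃ n : ℤ, (n : ℝ) = s then 1 else 0

/-! ### The affine root system and the affine Weyl group -/

section RootSystem

variable {ι V E : Type*} [AddCommGroup V] [Module ℝ V] [AddCommGroup E] [Module ℝ E]

/-- The affine root system is `Φ = Φ₀ × ℤ`, indexed by `ι × ℤ`; the pair `(i, n)` stands for the
affine linear functional `y ↦ αᵢ(y) + n` on `E`. -/
noncomputable def affVal (P : RootPairing ι ℝ V E) (a : ι × ℤ) (y : E) : ℝ :=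
  P.root' a.1 y + (a.2 : ℝ)

theorem affRefl_involutive (P : RootPairing ι ℝ V E) (a : ι × ℤ) :
    Function.Involutive fun y : E => y - affVal P a y • P.coroot a.1 := by
  intro y
  have h : P.root' a.1 (P.coroot a.1) = 2 := P.root_coroot_two a.1
  simp only [affVal, map_sub, map_smul, h, smul_eq_mul]
  module

/-- The reflection `s_a(y) = y - a(y) ā^∨` in the hyperplane `a = 0`. -/
noncomputable def affRefl (P : RootPairing ι ℝ V E) (a : ι × ℤ) : Equiv.Perm E :=
  (affRefl_involutive P a).toPerm

/-- The affine Weyl group `W`, generated by all affine reflections. -/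
def affWeyl (P : RootPairing ι ℝ V E) : Subgroup (Equiv.Perm E) :=
  Subgroup.closure (Set.range (affRefl P))

/-- The finite Weyl group `W₀`, generated by the linear reflections. -/
def finWeyl (P : RootPairing ι ℝ V E) : Subgroup (Equiv.Perm E) :=
  Subgroup.closure (Set.range fun i => affRefl P (i, 0))

/-- The contragredient action of reflections on affine roots,
`s_a(b) = b - b̄(ā^∨) a`. -/
noncomputable def affAct (P : RootPairing ι ℝ V E) [P.IsCrystallographic] (a b : ι × ℤ) : ι × ℤ :=
  (P.reflectionPerm a.1 b.1, b.2 - P.pairingIn ℤ b.1 a.1 * a.2)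

theorem affVal_affAct (P : RootPairing ι ℝ V E) [P.IsCrystallographic] (a b : ι × ℤ) (y : E) :
    affVal P (affAct P a b) y = affVal P b (affRefl P a y) := by
  have h : (P.pairingIn ℤ b.1 a.1 : ℝ) = P.root' b.1 (P.coroot a.1) :=
    P.algebraMap_pairingIn ℤ b.1 a.1
  have h2 : affRefl P a y = y - affVal P a y • P.coroot a.1 := rfl
  have h3 : P.root' (P.reflectionPerm a.1 b.1) y
      = P.root' b.1 y - P.root' b.1 (P.coroot a.1) * P.root' a.1 y := by
    rw [RootPairing.root', P.root_reflectionPerm, RootPairing.reflection_apply]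
    simp [RootPairing.root']
  rw [h2, affVal, affVal, affAct, h3]
  push_cast
  rw [h, map_sub, map_smul, smul_eq_mul, affVal]
  ring

/-- `ᾱ(Q^∨) = 2ℤ`, i.e. the root takes only even values on the co-root lattice.  These are the
roots `a` for which `a / 2` is adjoined in the nonreduced extension of `Φ`. -/
def IsEvenRoot (P : RootPairing ι ℝ V E) [P.IsCrystallographic] (i : ι) : Prop :=
  ∀ μ : P.corootSpan ℤ, Even (P.root'In ℤ i μ)

/-- A multiplicity function: a `W`-invariant function on the nonreduced extension
`Φ ⊔ {a / 2 | ā(Q^∨) = 2ℤ}` of `Φ`, extended to `Φ ⊔ Φ / 2` by giving `a / 2` the value at `a` when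
`a / 2` does not belong to the nonreduced extension. -/
structure Multiplicity (F : Type*) [Field F] (P : RootPairing ι ℝ V E) [P.IsCrystallographic] where
  /-- The value at the affine root `a`. -/
  k : ι × ℤ → Fˣ
  /-- The value at `a / 2`. -/
  u : ι × ℤ → Fˣ
  k_invariant : ∀ a c, k (affAct P a c) = k c
  u_invariant : ∀ a c, u (affAct P a c) = u c
  u_eq_k : ∀ a, ¬ IsEvenRoot P a.1 → u a = k a

/-- `φ` is the highest root relative to the base `b`. -/
def IsHighestRoot {P : RootPairing ι ℝ V E} (b : P.Base) (φ : ι) : Prop :=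
  ∀ i, P.root φ - P.root i ∈ AddSubmonoid.closure (P.root '' b.support)

/-- The simple affine roots: `some i` is the simple root `αᵢ` and `none` is `α₀ = (-φ, 1)`. -/
def simpleAff {P : RootPairing ι ℝ V E} (b : P.Base) (φ : ι) : Option b.support → ι × ℤ
  | some i => (i, 0)
  | none => (P.reflectionPerm φ φ, 1)

end RootSystem

/-! ### The double affine Hecke algebra and its subalgebra `H^X` -/

section Hecke

set_option linter.unusedSectionVars false

variable {F ι V E : Type*} [Field F] [AddCommGroup V] [Module ℝ V] [AddCommGroup E] [Module ℝ E]
  {P : RootPairing ι ℝ V E} [P.IsCrystallographic]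

/-- `x^{a^∨} = q_φ^{a(0)} x^{ā^∨}` in `F[Q^∨]`, for a simple affine root `a`. -/
noncomputable def corootMono (q : Fˣ) (a : ι × ℤ) : AddMonoidAlgebra F (P.corootSpan ℤ) :=
  AddMonoidAlgebra.single (P.corootSpanMem ℤ a.1) ((q ^ a.2 : Fˣ) : F)

/-- `s_a(x^μ) = x^{μ - ā(μ) a^∨} = q_φ^{-a(0) ā(μ)} x^{s_ā μ}` in `F[Q^∨]`, for a simple affine
root `a`. -/
noncomputable def reflMono (q : Fˣ) (a : ι × ℤ) (μ : P.corootSpan ℤ) :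
    AddMonoidAlgebra F (P.corootSpan ℤ) :=
  AddMonoidAlgebra.single (μ - P.root'In ℤ a.1 μ • P.corootSpanMem ℤ a.1)
    ((q ^ (-(a.2 * P.root'In ℤ a.1 μ)) : Fˣ) : F)

/-- The right-hand side of the cross relations,
`((k_a - k_a⁻¹ + (k_{a/2} - k_{a/2}⁻¹) x^{a^∨}) / (1 - x^{2 a^∨})) (x^μ - s_a(x^μ))`. -/
noncomputable def crossTerm (k : Multiplicity F P) (q : Fˣ) (a : ι × ℤ) (μ : P.corootSpan ℤ) :
    AddMonoidAlgebra F (P.corootSpan ℤ) :=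
  exactQuot
    ((((k.k a : F) - ((k.k a)⁻¹ : Fˣ)) • (1 : AddMonoidAlgebra F (P.corootSpan ℤ))
        + ((k.u a : F) - ((k.u a)⁻¹ : Fˣ)) • corootMono q a) * (mono F μ - reflMono q a μ))
    (1 - corootMono q a ^ 2)

/-- The integral power `n` of `x^{a^∨}`. -/
noncomputable def corootPow (q : Fˣ) (a : ι × ℤ) (n : ℤ) : AddMonoidAlgebra F (P.corootSpan ℤ) :=
  AddMonoidAlgebra.single (n • P.corootSpanMem ℤ a.1) ((q ^ (a.2 * n) : Fˣ) : F)

theorem corootPow_add (q : Fˣ) (a : ι × ℤ) (m n : ℤ) :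
    corootPow (P := P) q a m * corootPow q a n = corootPow q a (m + n) := by
  rw [corootPow, corootPow, corootPow, AddMonoidAlgebra.single_mul_single, add_smul, mul_add,
    zpow_add, Units.val_mul]

theorem corootPow_zero (q : Fˣ) (a : ι × ℤ) : corootPow (P := P) q a 0 = 1 := by
  rw [corootPow, zero_smul, mul_zero, zpow_zero]; rfl

theorem corootPow_one (q : Fˣ) (a : ι × ℤ) : corootPow (P := P) q a 1 = corootMono q a := by
  rw [corootPow, one_smul, mul_one]; rfl

theorem one_sub_corootPow_dvd (q : Fˣ) (a : ι × ℤ) (m n : ℤ) :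
    (1 - corootPow (P := P) q a m) ∣ (1 - corootPow q a (n * m)) := by
  have key : ∀ l : ℕ, (1 - corootPow (P := P) q a m) ∣ (1 - corootPow q a (l * m)) := by
    intro l
    induction l with
    | zero => simp [corootPow_zero]
    | succ l ih =>
      have h : 1 - corootPow (P := P) q a ((l + 1 : ℕ) * m)
          = (1 - corootPow q a (l * m)) + corootPow q a (l * m) * (1 - corootPow q a m) := by
        rw [mul_sub, mul_one, corootPow_add]
        push_cast
        rw [add_mul, one_mul]; ring
      rw [h]
      exact dvd_add ih (Dvd.intro_left _ rfl)
  obtain ⟨l, rfl | rfl⟩ := n.eq_nat_or_neg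
  · exact key l
  · have h : 1 - corootPow (P := P) q a (-(l : ℤ) * m)
        = -corootPow q a (-(l : ℤ) * m) * (1 - corootPow q a (l * m)) := by
      rw [mul_sub, mul_one, neg_mul _ (corootPow q a (l * m)), corootPow_add, neg_mul,
        neg_add_cancel, corootPow_zero]
      ring
    rw [h]
    exact (key l).mul_left _

/-- The denominator of `crossTerm` divides its numerator. -/
theorem crossTerm_dvd (k : Multiplicity F P) (q : Fˣ) (a : ι × ℤ) (μ : P.corootSpan ℤ) :
    (1 - corootMono (P := P) q a ^ 2) ∣
    ((((k.k a : F) - ((k.k a)⁻¹ : Fˣ)) • (1 : AddMonoidAlgebra F (P.corootSpan ℤ))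
        + ((k.u a : F) - ((k.u a)⁻¹ : Fˣ)) • corootMono q a) *
      (mono F μ - reflMono q a μ)) := by
  have h1 : mono F μ - reflMono (P := P) q a μ
      = mono F μ * (1 - corootPow q a (-P.root'In ℤ a.1 μ * 1)) := by
    rw [mul_sub, mul_one, mul_one, mono, reflMono, corootPow, AddMonoidAlgebra.single_mul_single,
      neg_smul, ← sub_eq_add_neg, one_mul, mul_neg]
  rw [h1]
  by_cases he : IsEvenRoot P a.1
  · obtain ⟨m, hm⟩ := he μ
    have h2 : -P.root'In ℤ a.1 μ * 1 = -m * 2 := by rw [hm]; ring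
    have h3 : corootMono (P := P) q a ^ 2 = corootPow q a 2 := by
      rw [← corootPow_one, sq, corootPow_add]; rfl
    rw [h2, h3]
    exact ((one_sub_corootPow_dvd q a 2 (-m)).mul_left _).mul_left _
  · obtain ⟨d, hd⟩ := one_sub_corootPow_dvd (P := P) q a 1 (-P.root'In ℤ a.1 μ)
    rw [k.u_eq_k a he, hd, corootPow_one]
    refine ⟨((k.k a : F) - ((k.k a)⁻¹ : Fˣ)) • (mono F μ * d), ?_⟩
    simp only [Algebra.smul_def]
    ring

/-- Generators of the double affine Hecke algebra: `x^μ` for `μ ∈ Q^∨` and `T_j` for the simple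
affine roots. -/
inductive Gen (b : P.Base) where
  | X (μ : P.corootSpan ℤ)
  | T (j : Option b.support)

/-- The image of `p ∈ F[Q^∨]` in the free algebra. -/
noncomputable def freeX (b : P.Base) :
    AddMonoidAlgebra F (P.corootSpan ℤ) →ₗ[F] FreeAlgebra F (Gen b) :=
  linExt fun μ => FreeAlgebra.ι F (Gen.X μ)

/-- The generator `T_j` in the free algebra. -/
noncomputable def freeT (F : Type*) [Field F] (b : P.Base) (j : Option b.support) :
    FreeAlgebra F (Gen b) :=
  FreeAlgebra.ι F (Gen.T j)

/-- The defining relations of the double affine Hecke algebra.  In the braid relation, `m_{ij}` is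
the order of `s_i s_j` in `W`; when that order is infinite, `orderOf` is `0` and the relation is
void. -/
inductive DahaRel (b : P.Base) (φ : ι) (k : Multiplicity F P) (q : Fˣ) :
    FreeAlgebra F (Gen b) → FreeAlgebra F (Gen b) → Prop
  | braid (i j : Option b.support) (hij : i ≠ j) : DahaRel b φ k q
      ((CoxeterSystem.alternatingWord i j (orderOf
        (affRefl P (simpleAff b φ i) * affRefl P (simpleAff b φ j)))).map (freeT F b)).prod
      ((CoxeterSystem.alternatingWord j i (orderOf
        (affRefl P (simpleAff b φ i) * affRefl P (simpleAff b φ j)))).map (freeT F b)).prod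
  | quad (j : Option b.support) : DahaRel b φ k q
      ((freeT F b j - (k.k (simpleAff b φ j) : F) • 1)
        * (freeT F b j + (((k.k (simpleAff b φ j))⁻¹ : Fˣ) : F) • 1)) 0
  | mul (μ ν : P.corootSpan ℤ) : DahaRel b φ k q
      (freeX b (mono F μ) * freeX b (mono F ν)) (freeX b (mono F (μ + ν)))
  | one : DahaRel b φ k q (freeX b (mono F 0)) 1
  | cross (j : Option b.support) (μ : P.corootSpan ℤ) : DahaRel b φ k q
      (freeT F b j * freeX b (mono F μ) - freeX b (reflMono q (simpleAff b φ j) μ) * freeT F b j)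
      (freeX b (crossTerm k q (simpleAff b φ j) μ))

/-- The double affine Hecke algebra `ℍ(k; q_φ)`. -/
abbrev Daha (b : P.Base) (φ : ι) (k : Multiplicity F P) (q : Fˣ) : Type _ :=
  RingQuot (DahaRel b φ k q)

/-- The element `x^μ` of `ℍ`. -/
noncomputable def dahaX (b : P.Base) (φ : ι) (k : Multiplicity F P) (q : Fˣ)
    (μ : P.corootSpan ℤ) : Daha b φ k q :=
  RingQuot.mkAlgHom F (DahaRel b φ k q) (freeX b (mono F μ))

/-- The element `T_j` of `ℍ`. -/
noncomputable def dahaT (b : P.Base) (φ : ι) (k : Multiplicity F P) (q : Fˣ)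
    (j : Option b.support) : Daha b φ k q :=
  RingQuot.mkAlgHom F (DahaRel b φ k q) (freeT F b j)

/-- The subalgebra `H^X` of `ℍ` generated by `F[Q^∨]` and the `T_i` attached to the simple roots
`αᵢ` of the finite root system. -/
noncomputable def HX (b : P.Base) (φ : ι) (k : Multiplicity F P) (q : Fˣ) :
    Subalgebra F (Daha b φ k q) :=
  Algebra.adjoin F (Set.range (dahaX b φ k q) ∪
    Set.range fun i : b.support => dahaT b φ k q (some i))

/-- `x^μ` as an element of `H^X`. -/
noncomputable def hxX (b : P.Base) (φ : ι) (k : Multiplicity F P) (q : Fˣ)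
    (μ : P.corootSpan ℤ) : HX b φ k q :=
  ⟨dahaX b φ k q μ, Algebra.subset_adjoin (Or.inl ⟨μ, rfl⟩)⟩

/-- `T_i` as an element of `H^X`, for a simple root `αᵢ` of the finite root system. -/
noncomputable def hxT (b : P.Base) (φ : ι) (k : Multiplicity F P) (q : Fˣ)
    (i : b.support) : HX b φ k q :=
  ⟨dahaT b φ k q (some i), Algebra.subset_adjoin (Or.inr ⟨i, rfl⟩)⟩

end Hecke

/-! ### Truncated operators, normalisation factors, orbits -/

section Operators

variable {ι V E : Type*} [AddCommGroup V] [Module ℝ V] [AddCommGroup E] [Module ℝ E]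

/-- The even truncated divided difference operator,
`∇^e(x^y) = ((1 - x^{-⌊α(y)⌋_e α^∨}) / (1 - x^{2 α^∨})) x^y`. -/
noncomputable def nablaE (F : Type*) [Field F] (P : RootPairing ι ℝ V E) (i : ι) :
    Module.End F (AddMonoidAlgebra F E) :=
  linExt fun y => exactQuot (1 - mono F (-floorE (P.root' i y) • P.coroot i))
    (1 - mono F ((2 : ℤ) • P.coroot i)) * mono F y

/-- The odd truncated divided difference operator,
`∇^o(x^y) = ((x^{α^∨} - x^{-⌊α(y)⌋_o α^∨}) / (1 - x^{2 α^∨})) x^y`. -/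
noncomputable def nablaO (F : Type*) [Field F] (P : RootPairing ι ℝ V E) (i : ι) :
    Module.End F (AddMonoidAlgebra F E) :=
  linExt fun y => exactQuot (mono F (P.coroot i) - mono F (-floorO (P.root' i y) • P.coroot i))
    (1 - mono F ((2 : ℤ) • P.coroot i)) * mono F y

theorem nablaE_dvd (F : Type*) [Field F] (P : RootPairing ι ℝ V E) (i : ι) (y : E) :
    (1 - mono F ((2 : ℤ) • P.coroot i)) ∣ (1 - mono F (-floorE (P.root' i y) • P.coroot i)) := by
  have h : -floorE (P.root' i y) • P.coroot i
      = (-⌊P.root' i y / 2⌋) • ((2 : ℤ) • P.coroot i) := by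
    rw [smul_smul, floorE]; congr 1; ring
  rw [h]
  exact one_sub_mono_dvd _ _

theorem nablaO_dvd (F : Type*) [Field F] (P : RootPairing ι ℝ V E) (i : ι) (y : E) :
    (1 - mono F ((2 : ℤ) • P.coroot i)) ∣
      (mono F (P.coroot i) - mono F (-floorO (P.root' i y) • P.coroot i)) := by
  have h : -floorO (P.root' i y) • P.coroot i
      = P.coroot i + (-⌊(P.root' i y + 1) / 2⌋) • ((2 : ℤ) • P.coroot i) := by
    rw [smul_smul, floorO, floorE]; module
  rw [h, ← mono_mul]
  have h2 := (one_sub_mono_dvd (F := F) ((2 : ℤ) • P.coroot i)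
    (-⌊(P.root' i y + 1) / 2⌋)).mul_left (mono F (P.coroot i))
  rwa [mul_sub, mul_one] at h2

variable {F : Type*} [Field F] {P : RootPairing ι ℝ V E} [P.IsCrystallographic]

/-- The truncated Demazure-Lusztig operator
`x^y ↦ k_i^{χ_e(α_i(y))} u_i^{χ_o(α_i(y))} x^{s_i y}
  + (k_i - k_i⁻¹) ∇_i^e(x^y) + (u_i - u_i⁻¹) ∇_i^o(x^y)`. -/
noncomputable def truncDL (k : Multiplicity F P) (i : ι) : Module.End F (AddMonoidAlgebra F E) :=
  linExt fun y =>
    ((k.k (i, 0) ^ chiE (P.root' i y) * k.u (i, 0) ^ chiO (P.root' i y) : Fˣ) : F)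
        • mono F (affRefl P (i, 0) y)
      + ((k.k (i, 0) : F) - ((k.k (i, 0))⁻¹ : Fˣ)) • nablaE F P i (mono F y)
      + ((k.u (i, 0) : F) - ((k.u (i, 0))⁻¹ : Fˣ)) • nablaO F P i (mono F y)

/-- `F[Z]`, the span of the quasi-monomials with quasi-exponent in `Z`. -/
noncomputable def quasiSpan (F : Type*) [Field F] (Z : Set E) :
    Submodule F (AddMonoidAlgebra F E) :=
  Submodule.span F (mono F '' Z)

/-- The closure of the fundamental alcove `{y | 0 < α(y) < 1 for all positive roots α}`. -/
def closedAlcove (b : P.Base) : Set E :=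
  {y | ∀ i, b.IsPos i → 0 ≤ P.root' i y ∧ P.root' i y ≤ 1}

/-- The element of `W₀` represented by a word in the simple reflections. -/
noncomputable def wordProd (b : P.Base) (l : List b.support) : Equiv.Perm E :=
  (l.map fun i => affRefl P (i, 0)).prod

/-- `l` is a reduced expression of `w`: it represents `w`, with the least number of letters. -/
def IsReducedExpr (b : P.Base) (w : Equiv.Perm E) (l : List b.support) : Prop :=
  wordProd b l = w ∧ ∀ l' : List b.support, wordProd b l' = w → l.length ≤ l'.length

/-- `Π(w) = Φ₀⁺ ∩ w⁻¹ Φ₀⁻`: the positive roots `α` such that `w α = α ∘ w⁻¹` is a negative root. -/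
def inversions (b : P.Base) (w : Equiv.Perm E) : Set ι :=
  {i | b.IsPos i ∧ ∃ j, ¬ b.IsPos j ∧ ∀ y, P.root' j (w y) = P.root' i y}

open Classical in
/-- The normalisation factor
`κ_w = ∏_{α ∈ Π(w)} k_α^{χ_e(α(c))} k_{α/2}^{-χ_o(α(c))}`. -/
noncomputable def kappa [Fintype ι] (b : P.Base) (k : Multiplicity F P) (c : E)
    (w : Equiv.Perm E) : Fˣ :=
  ∏ i ∈ Finset.univ.filter (· ∈ inversions b w),
    k.k (i, 0) ^ chiE (P.root' i c) * k.u (i, 0) ^ (-chiO (P.root' i c))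

end Operators

/-! ### The explicit operators in type `C_r`, with `r = n + 1` and coordinates indexed from `0` -/

section TypeC

variable {F : Type*} [Field F] {n : ℕ}

/-- The basis vector `ε_i` of `ℝ^r`. -/
def eps (i : Fin (n + 1)) : Fin (n + 1) → ℝ := Pi.single i 1

/-- `∇_i(x^y) = ((1 - (x_{i+1}/x_i)^{⌊y_i - y_{i+1}⌋}) / (1 - x_i/x_{i+1})) x^y`. -/
noncomputable def cNabla (F : Type*) [Field F] (i : Fin n) :
    Module.End F (AddMonoidAlgebra F (Fin (n + 1) → ℝ)) :=
  linExt fun y =>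
    exactQuot (1 - mono F (⌊y i.castSucc - y i.succ⌋ • (eps i.succ - eps i.castSucc)))
      (1 - mono F (eps i.castSucc - eps i.succ)) * mono F y

/-- `∇_r^e(x^y) = ((1 - x_r^{-⌊2 y_r⌋_e}) / (1 - x_r²)) x^y`. -/
noncomputable def cNablaE (F : Type*) [Field F] (n : ℕ) :
    Module.End F (AddMonoidAlgebra F (Fin (n + 1) → ℝ)) :=
  linExt fun y =>
    exactQuot (1 - mono F (-floorE (2 * y (Fin.last n)) • eps (Fin.last n)))
      (1 - mono F ((2 : ℤ) • eps (Fin.last n))) * mono F y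

/-- `∇_r^o(x^y) = ((x_r - x_r^{-⌊2 y_r⌋_o}) / (1 - x_r²)) x^y`. -/
noncomputable def cNablaO (F : Type*) [Field F] (n : ℕ) :
    Module.End F (AddMonoidAlgebra F (Fin (n + 1) → ℝ)) :=
  linExt fun y =>
    exactQuot (mono F (eps (Fin.last n)) - mono F (-floorO (2 * y (Fin.last n)) • eps (Fin.last n)))
      (1 - mono F ((2 : ℤ) • eps (Fin.last n))) * mono F y

/-- The operators `𝒯_1, …, 𝒯_{r-1}`:
`𝒯_i(x^y) = k^{χ_ℤ(y_i - y_{i+1})} x^{s_i y} + (k - k⁻¹) ∇_i(x^y)`. -/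
noncomputable def cT (k : Fˣ) (i : Fin n) :
    Module.End F (AddMonoidAlgebra F (Fin (n + 1) → ℝ)) :=
  linExt fun y =>
    ((k ^ chiZ (y i.castSucc - y i.succ) : Fˣ) : F)
        • mono F (fun j => y (Equiv.swap i.castSucc i.succ j))
      + ((k : F) - (k⁻¹ : Fˣ)) • cNabla F i (mono F y)

/-- The operator `𝒯_r`:
`𝒯_r(x^y) = k_r^{χ_e(2 y_r)} u_r^{χ_o(2 y_r)} x^{s_r y} + (k_r - k_r⁻¹) ∇_r^e(x^y)
  + (u_r - u_r⁻¹) ∇_r^o(x^y)`. -/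
noncomputable def cTlast (n : ℕ) (kr ur : Fˣ) :
    Module.End F (AddMonoidAlgebra F (Fin (n + 1) → ℝ)) :=
  linExt fun y =>
    ((kr ^ chiE (2 * y (Fin.last n)) * ur ^ chiO (2 * y (Fin.last n)) : Fˣ) : F)
        • mono F (Function.update y (Fin.last n) (-y (Fin.last n)))
      + ((kr : F) - (kr⁻¹ : Fˣ)) • cNablaE F n (mono F y)
      + ((ur : F) - (ur⁻¹ : Fˣ)) • cNablaO F n (mono F y)

end TypeC

end QuasiPoly

namespace QuasiPoly

/-! ### Rank two: the braid defect in a skew group ring -/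

section Defect

/-! A single operator. For a root α with co-root v and reflection s, put D = 1 - x^{2v} and N = k -
k⁻¹ + (u - u⁻¹) x^v. The truncated operator T is controlled by the intertwiner I = D·T - N
(`inter`). First, I(x^μ m) = x^{sμ} I(m) whenever α(μ) is an integer, which must be even unless k =
u: translation by μ merely shifts the truncating floors. Second, I² is multiplication by D·s(D) +
N·s(N); by semilinearity this need only be checked on x^y with |α(y)| ≤ 1, where T acts on the span
of x^y and x^{sy} through explicit coefficients. The first fact is the cross relation, the second
the quadratic relation.

Braid relations. Over the fraction field of the group algebra of a rank-two co-root lattice, I can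
be normalised to a semilinear involution S, and then T = e + (k - e) S with e = N/D. It is not known
beforehand that the S's braid. But Sᵢ² = 1 and identities between the rational functions e make
every shorter word cancel, so the defect T₁T₂⋯ - T₂T₁⋯ is a scalar times S₁S₂⋯ - S₂S₁⋯
(`SkewPair.defect_A2` and its analogues). Hence the defect is semilinear over the lattice, and by
the quadratic relations defect·Tᵢ = U·defect for some U. Its kernel is therefore stable under the
lattice and both Tᵢ, and with x^y it contains x^{sᵢ y} (`apply_mono_refl_eq_zero`). If y lies in the
closed fundamental alcove, both sides of the braid relation send x^y to the same multiple of x^{w₀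
y}, so the defect kills x^y; since that alcove meets every orbit of the rank-two affine Weyl group,
the defect is zero.

From rank two to H^X. The algebra H^X is defined inside ℍ, and no presentation of it is used: the
action is constructed for all of ℍ, over an algebraic closure L of F. With a character γ of ℝ such
that γ(1) = q, conjugation by x^y ↦ γ(f(y)) x^y turns the operator of a linear root into that of an
affine root, and the result depends on f only through f(v) (`conjTwist_tdl`). For two affine roots
with independent gradients one f serves both, so their braid relation is again the linear one. The
generators of H^X preserve F[E] inside L[E], which gives the representation over F
(`exists_restrict`); uniqueness holds because they generate.

The remaining claims. The truncated quotients are Laurent polynomials in x^v, so T preserves spans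
of orbits. If 0 ≤ αᵢ(y) ≤ 1 then Tᵢ x^y is a single multiple of x^{sᵢ y}. Along a reduced word
αᵢ(wc) is the value at c of the positive root w⁻¹αᵢ, hence lies in [0,1], and these roots run
exactly once through the inversions; this gives the factor κ. The type C relations are the rank-two
relations for explicit roots. -/

/-- Two semilinear involutions on a vector space. -/
structure SkewPair (K M : Type*) [Field K] [AddCommGroup M] [Module K M] where
  σ₁ : K →+* K
  σ₂ : K →+* K
  S₁ : M →+ M
  S₂ : M →+ M
  smul₁ : ∀ (g : K) (m : M), S₁ (g • m) = σ₁ g • S₁ m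
  smul₂ : ∀ (g : K) (m : M), S₂ (g • m) = σ₂ g • S₂ m
  inv₁ : ∀ m, S₁ (S₁ m) = m
  inv₂ : ∀ m, S₂ (S₂ m) = m

variable {K M : Type*} [Field K] [AddCommGroup M] [Module K M] (P : SkewPair K M)

/-- Each coefficient is fixed by the involution of the other factor, so on expansion only the
commutator of the involutions survives. -/
theorem SkewPair.defect_A1A1 {T₁ T₂ : M →+ M} {k l e₁ e₂ : K}
    (hk₂ : P.σ₂ k = k) (hl₁ : P.σ₁ l = l)
    (h₂₁ : P.σ₂ e₁ = e₁) (h₁₂ : P.σ₁ e₂ = e₂)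
    (t₁ : ∀ m, T₁ m = e₁ • m + (k - e₁) • P.S₁ m)
    (t₂ : ∀ m, T₂ m = e₂ • m + (l - e₂) • P.S₂ m) (m : M) :
    T₁ (T₂ m) - T₂ (T₁ m) =
      ((k - e₁) * (l - e₂)) • (P.S₁ (P.S₂ m) - P.S₂ (P.S₁ m)) := by
  simp only [t₁, t₂, map_add, P.smul₁, P.smul₂, smul_add, smul_smul, map_sub, hk₂, hl₁, h₂₁, h₁₂,
    smul_sub]
  module

/-- There is one function e per positive co-root; σ₁ and σ₂ permute them as the simple reflections
permute the co-roots, with a - e standing for the negative co-root. `R` is the addition identity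
f₁f₂ = f₃(f₁ + f₂ - 1) for f = 1/(1 - x^γ) with γ₃ = γ₁ + γ₂, scaled by a². It makes the
coefficients of all words shorter than the longest one cancel. -/
theorem SkewPair.defect_A2 {T₁ T₂ : M →+ M} {k a e₁ e₂ e₃ : K}
    (hk₁ : P.σ₁ k = k) (hk₂ : P.σ₂ k = k)
    (h₁₁ : P.σ₁ e₁ = a - e₁) (h₁₂ : P.σ₁ e₂ = e₃) (h₁₃ : P.σ₁ e₃ = e₂)
    (h₂₁ : P.σ₂ e₁ = e₃) (h₂₂ : P.σ₂ e₂ = a - e₂) (h₂₃ : P.σ₂ e₃ = e₁)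
    (R : e₁ * e₂ + e₃ * (a - e₁) - e₂ * e₃ = 0)
    (t₁ : ∀ m, T₁ m = e₁ • m + (k - e₁) • P.S₁ m)
    (t₂ : ∀ m, T₂ m = e₂ • m + (k - e₂) • P.S₂ m) (m : M) :
    T₁ (T₂ (T₁ m)) - T₂ (T₁ (T₂ m)) =
      ((k - e₁) * (k - e₂) * (k - e₃)) •
        (P.S₁ (P.S₂ (P.S₁ m)) - P.S₂ (P.S₁ (P.S₂ m))) := by
  simp only [t₁, t₂, map_add, P.smul₁, P.smul₂, P.inv₁, P.inv₂, smul_add, smul_smul, map_mul,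
    map_sub, hk₁, hk₂, h₁₁, h₁₂, h₁₃, h₂₁, h₂₂, h₂₃, smul_sub]
  match_scalars
  all_goals grind

/-- The same mechanism with two lengths: e₁, e₃ belong to the long co-roots and e₂, e₄ to the short
ones, and the four-term relation `R` replaces the addition identity. Nothing is assumed on the shape
of e₂ and e₄, which leaves room for a second parameter u. -/
theorem SkewPair.defect_B2 {T₁ T₂ : M →+ M} {k a l b e₁ e₂ e₃ e₄ : K}
    (hk₁ : P.σ₁ k = k) (hk₂ : P.σ₂ k = k) (hl₁ : P.σ₁ l = l) (hl₂ : P.σ₂ l = l)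
    (ha₂ : P.σ₂ a = a) (hb₁ : P.σ₁ b = b) (hka : k ^ 2 = a * k + 1) (hlb : l ^ 2 = b * l + 1)
    (h₁₁ : P.σ₁ e₁ = a - e₁) (h₁₂ : P.σ₁ e₂ = e₄) (h₁₃ : P.σ₁ e₃ = e₃) (h₁₄ : P.σ₁ e₄ = e₂)
    (h₂₁ : P.σ₂ e₁ = e₃) (h₂₂ : P.σ₂ e₂ = b - e₂) (h₂₃ : P.σ₂ e₃ = e₁) (h₂₄ : P.σ₂ e₄ = e₄)
    (R : e₁ * e₂ + e₄ * (a - e₁) + e₃ * (b - e₄) - e₂ * e₃ = 0)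
    (t₁ : ∀ m, T₁ m = e₁ • m + (k - e₁) • P.S₁ m)
    (t₂ : ∀ m, T₂ m = e₂ • m + (l - e₂) • P.S₂ m) (m : M) :
    T₁ (T₂ (T₁ (T₂ m))) - T₂ (T₁ (T₂ (T₁ m))) =
      ((k - e₁) * (l - e₂) * (k - e₃) * (l - e₄)) •
        (P.S₁ (P.S₂ (P.S₁ (P.S₂ m))) - P.S₂ (P.S₁ (P.S₂ (P.S₁ m)))) := by
  simp only [t₁, t₂, map_add, P.smul₁, P.smul₂, P.inv₁, P.inv₂, smul_add, smul_smul, map_mul,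
    map_sub, hk₁, hk₂, hl₁, hl₂, ha₂, hb₁, h₁₁, h₁₂, h₁₃, h₁₄, h₂₁, h₂₂, h₂₃, h₂₄, smul_sub]
  match_scalars
  all_goals clear t₁ t₂ T₁ T₂ h₁₁ h₁₂ h₁₃ h₁₄ h₂₁ h₂₂ h₂₃ h₂₄ hk₁ hk₂ hl₁ hl₂ ha₂ hb₁
  all_goals grind

/-- The relations between the functions `1 / (1 - x^γ)`, for `γ` a positive co-root of a root system
of type `G₂`, that enter the braid relation. -/
structure G2Relations (e1 e2 e3 e4 e5 e6 : K) : Prop where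
  q12 : e1^2*e2^2 - 2*e1^2*e2*e4 + e1^2*e4^2 - e1*e2^2*e3 - e1*e2^2*e5 + e1*e2*e3 + 2*e1*e2*e4
    + e1*e2*e5 + 2*e1*e4^2*e5 - 2*e1*e4^2 - 2*e1*e4*e5 + e2^2*e3*e5 - e2*e3*e5
    + e2*e4*e5^2 - e2*e4*e5 + e2*e5^2*e6 - e2*e5^2 - e2*e5*e6 + e4^2*e5^2 - 2*e4^2*e5
    + e4^2 + e4*e5^2*e6 - 2*e4*e5^2 - e4*e5*e6 + 2*e4*e5 - e5^2*e6 + e5^2 + e5*e6 = 0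
  q21 : - e1^2*e2^2 + e1^2*e2*e4 + e1^2*e2*e6 - e1^2*e4*e6 + 2*e1*e2^2*e3 - 2*e1*e2*e3
    - e1*e2*e4 - e1*e2*e6 - e1*e3*e6^2 + e1*e3*e6 + e1*e4*e6 - e1*e5*e6^2 + e1*e5*e6
    + e1*e6^2 - e2^2*e3^2 - 2*e2*e3^2*e6 + 2*e2*e3^2 + 2*e2*e3*e6 - e3^2*e6^2
    + 2*e3^2*e6 - e3^2 - e3*e5*e6^2 + e3*e5*e6 + 2*e3*e6^2 - 2*e3*e6 + e5*e6^2 - e5*e6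
    - e6^2 = 0
  q2 : e1^3*e2^2 - 2*e1^3*e2*e4 + e1^3*e4^2 - 3*e1^2*e2^2*e3 + 2*e1^2*e2*e3*e4 + 2*e1^2*e2*e3
    + 2*e1^2*e2*e4 - e1^2*e3*e4 + e1^2*e4^2*e5 - 2*e1^2*e4^2 - e1^2*e4*e5
    + 3*e1*e2^2*e3^2 + 2*e1*e2*e3^2*e6 - 4*e1*e2*e3^2 - 2*e1*e2*e3*e4 - 2*e1*e2*e3*e6
    - e1*e3^2*e6 + e1*e3^2 + e1*e3*e4 + e1*e3*e6 - e1*e4^2*e5 + e1*e4^2 + e1*e4*e5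
    - e2^2*e3^3 - 2*e2*e3^3*e6 + 2*e2*e3^3 + 2*e2*e3^2*e6 - e3^3*e6^2 + 2*e3^3*e6 - e3^3
    - e3^2*e5*e6^2 + e3^2*e5*e6 + 2*e3^2*e6^2 - 2*e3^2*e6 + e3*e5*e6^2 - e3*e5*e6
    - e3*e6^2 = 0
  q2' : 2*e1*e2*e4 - 2*e1*e2*e6 - e1*e4^2 + e1*e6 - 2*e2*e3*e4 + 2*e2*e3*e6 + e3*e4 + e3*e6^2
    - 2*e3*e6 - e4^2*e5 + e4^2 + e4*e5 + e5*e6^2 - e5*e6 - e6^2 = 0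
  q1 : - e1^2*e2^3 + 3*e1^2*e2^2*e4 - 3*e1^2*e2*e4^2 + e1^2*e4^3 + 2*e1*e2^3*e3
    - 2*e1*e2^2*e3*e4 - 2*e1*e2^2*e3 - 2*e1*e2^2*e4 + 2*e1*e2*e3*e4 - 2*e1*e2*e4^2*e5
    + 4*e1*e2*e4^2 + 2*e1*e2*e4*e5 + 2*e1*e4^3*e5 - 2*e1*e4^3 - 2*e1*e4^2*e5 - e2^3*e3^2
    - e2^2*e3^2*e6 + 2*e2^2*e3^2 + e2^2*e3*e4 + e2^2*e3*e6 + e2*e3^2*e6 - e2*e3^2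
    - e2*e3*e4 - e2*e3*e6 + e2*e4^2*e5 - e2*e4^2 - e2*e4*e5 + e4^3*e5^2 - 2*e4^3*e5
    + e4^3 + e4^2*e5^2*e6 - 2*e4^2*e5^2 - e4^2*e5*e6 + 2*e4^2*e5 - e4*e5^2*e6 + e4*e5^2
    + e4*e5*e6 = 0
  q1' : - 2*e1*e2*e3 + 2*e1*e2*e5 + 2*e1*e3*e4 - 2*e1*e4*e5 + e2*e3^2 - e2*e5 + e3^2*e6 - e3^2
    - e3*e4 - e3*e6 - e4*e5^2 + 2*e4*e5 - e5^2*e6 + e5^2 + e5*e6 = 0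
  r₁ : e1 * e2 = e4 * (e1 + e2 - 1)
  r₂ : e4 * e2 = e6 * (e4 + e2 - 1)
  r₃ : e6 * e2 = e3 * (e6 + e2 - 1)
  r₄ : e1 * e3 = e5 * (e1 + e3 - 1)
  r₅ : e4 * e6 = e5 * (e4 + e6 - 1)

set_option maxHeartbeats 4000000 in
-- With X = x^v and Y = x^w, the functions e1, …, e6 belong to the co-roots v, w, v + 3w, v + w, 2v
-- + 3w, v + 2w. The fields r₁, …, r₅ are addition identities for pairs of these whose sum is again
-- a co-root; all fields are rational identities in X and Y.
theorem G2Relations.of_inv {X Y : K} (n1 : 1 - X ≠ 0) (n2 : 1 - Y ≠ 0) (n3 : 1 - X * Y ^ 3 ≠ 0)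
    (n4 : 1 - X * Y ≠ 0) (n5 : 1 - X ^ 2 * Y ^ 3 ≠ 0) (n6 : 1 - X * Y ^ 2 ≠ 0) :
    G2Relations (1 - X)⁻¹ (1 - Y)⁻¹ (1 - X * Y ^ 3)⁻¹ (1 - X * Y)⁻¹ (1 - X ^ 2 * Y ^ 3)⁻¹
      (1 - X * Y ^ 2)⁻¹ := by
  constructor <;> field_simp <;> ring

set_option maxHeartbeats 4000000 in
set_option maxRecDepth 20000 in
theorem SkewPair.defect_G2 {T₁ T₂ : M →+ M} {k a l b e1 e2 e3 e4 e5 e6 : K}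
    (hk₁ : P.σ₁ k = k) (hk₂ : P.σ₂ k = k) (hl₁ : P.σ₁ l = l) (hl₂ : P.σ₂ l = l)
    (ha₁ : P.σ₁ a = a) (ha₂ : P.σ₂ a = a) (hb₁ : P.σ₁ b = b) (hb₂ : P.σ₂ b = b)
    (hka : k ^ 2 = a * k + 1) (hlb : l ^ 2 = b * l + 1)
    (h₁₁ : P.σ₁ e1 = 1 - e1) (h₁₂ : P.σ₁ e2 = e4) (h₁₃ : P.σ₁ e3 = e5) (h₁₄ : P.σ₁ e4 = e2)
    (h₁₅ : P.σ₁ e5 = e3) (h₁₆ : P.σ₁ e6 = e6)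
    (h₂₁ : P.σ₂ e1 = e3) (h₂₂ : P.σ₂ e2 = 1 - e2) (h₂₃ : P.σ₂ e3 = e1) (h₂₄ : P.σ₂ e4 = e6)
    (h₂₅ : P.σ₂ e5 = e5) (h₂₆ : P.σ₂ e6 = e4) (R : G2Relations e1 e2 e3 e4 e5 e6)
    (t₁ : ∀ m, T₁ m = (a * e1) • m + (k - a * e1) • P.S₁ m)
    (t₂ : ∀ m, T₂ m = (b * e2) • m + (l - b * e2) • P.S₂ m) (m : M) :
    T₁ (T₂ (T₁ (T₂ (T₁ (T₂ m))))) - T₂ (T₁ (T₂ (T₁ (T₂ (T₁ m))))) =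
      ((k - a * e1) * (l - b * e2) * (k - a * e3) * (l - b * e4) * (k - a * e5) * (l - b * e6)) •
        (P.S₁ (P.S₂ (P.S₁ (P.S₂ (P.S₁ (P.S₂ m))))) -
          P.S₂ (P.S₁ (P.S₂ (P.S₁ (P.S₂ (P.S₁ m)))))) := by
  -- Combinations of the addition identities: z₁ involves only the long co-roots v, v + 3w, 2v + 3w,
  -- and z₂ only the short ones w, v + w, v + 2w.
  have S : e1 * e2 + e4 - e1 * e4 + e5 - e4 * e5 + e6 - e5 * e6 + e3 - e3 * e6 - e2 * e3 = 0 := by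
    linear_combination R.r₁ + R.r₂ + R.r₃ + R.r₅
  have z₁ : e1 * e3 - e1 * e5 - e3 * e5 + e5 = 0 := by linear_combination R.r₄
  have z₂ : e2 * e4 - e2 * e6 - e4 * e6 + e6 = 0 := by linear_combination R.r₂
  -- The four `W` are prepared for the coefficients of the words S₂, S₁, S₁S₂, S₂S₁. The factor in
  -- front is what that word picks up, and the rest is sorted by monomials in a and b, each bracket
  -- being a field of `G2Relations` or a multiple of z₁ or z₂.
  have W₂ : (l - b * e2) * ((a ^ 3 * b ^ 2) * (e1^3*e2^2 - 2*e1^3*e2*e4 + e1^3*e4^2 - 3*e1^2*e2^2*e3 + 2*e1^2*e2*e3*e4 + 2*e1^2*e2*e3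
    + 2*e1^2*e2*e4 - e1^2*e3*e4 + e1^2*e4^2*e5 - 2*e1^2*e4^2 - e1^2*e4*e5
    + 3*e1*e2^2*e3^2 + 2*e1*e2*e3^2*e6 - 4*e1*e2*e3^2 - 2*e1*e2*e3*e4 - 2*e1*e2*e3*e6
    - e1*e3^2*e6 + e1*e3^2 + e1*e3*e4 + e1*e3*e6 - e1*e4^2*e5 + e1*e4^2 + e1*e4*e5
    - e2^2*e3^3 - 2*e2*e3^3*e6 + 2*e2*e3^3 + 2*e2*e3^2*e6 - e3^3*e6^2 + 2*e3^3*e6 - e3^3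
    - e3^2*e5*e6^2 + e3^2*e5*e6 + 2*e3^2*e6^2 - 2*e3^2*e6 + e3*e5*e6^2 - e3*e5*e6
    - e3*e6^2) +
      a ^ 3 * (e1^2*e3 - e1^2*e5 - e1*e3^2 + e1*e5 + e3^2*e5 - e3*e5) +
      (a * b ^ 2) * (2*e1*e2*e4 - 2*e1*e2*e6 - e1*e4^2 + e1*e6 - 2*e2*e3*e4 + 2*e2*e3*e6 + e3*e4 + e3*e6^2
    - 2*e3*e6 - e4^2*e5 + e4^2 + e4*e5 + e5*e6^2 - e5*e6 - e6^2)) = 0 := by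
    linear_combination (l - b * e2) * (a ^ 3 * b ^ 2) * R.q2 +
      (l - b * e2) * a ^ 3 * (e1 - e3) * z₁ +
      (l - b * e2) * (a * b ^ 2) * R.q2'
  have W₁ : (k - a * e1) * ((a ^ 2 * b ^ 3) * (- e1^2*e2^3 + 3*e1^2*e2^2*e4 - 3*e1^2*e2*e4^2 + e1^2*e4^3 + 2*e1*e2^3*e3
    - 2*e1*e2^2*e3*e4 - 2*e1*e2^2*e3 - 2*e1*e2^2*e4 + 2*e1*e2*e3*e4 - 2*e1*e2*e4^2*e5
    + 4*e1*e2*e4^2 + 2*e1*e2*e4*e5 + 2*e1*e4^3*e5 - 2*e1*e4^3 - 2*e1*e4^2*e5 - e2^3*e3^2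
    - e2^2*e3^2*e6 + 2*e2^2*e3^2 + e2^2*e3*e4 + e2^2*e3*e6 + e2*e3^2*e6 - e2*e3^2
    - e2*e3*e4 - e2*e3*e6 + e2*e4^2*e5 - e2*e4^2 - e2*e4*e5 + e4^3*e5^2 - 2*e4^3*e5
    + e4^3 + e4^2*e5^2*e6 - 2*e4^2*e5^2 - e4^2*e5*e6 + 2*e4^2*e5 - e4*e5^2*e6 + e4*e5^2
    + e4*e5*e6) +
      (a ^ 2 * b) * (- 2*e1*e2*e3 + 2*e1*e2*e5 + 2*e1*e3*e4 - 2*e1*e4*e5 + e2*e3^2 - e2*e5 + e3^2*e6 - e3^2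
    - e3*e4 - e3*e6 - e4*e5^2 + 2*e4*e5 - e5^2*e6 + e5^2 + e5*e6) +
      b ^ 3 * (- e2^2*e4 + e2^2*e6 + e2*e4^2 - e2*e6 - e4^2*e6 + e4*e6)) = 0 := by
    linear_combination (k - a * e1) * (a ^ 2 * b ^ 3) * R.q1 +
      (k - a * e1) * (a ^ 2 * b) * R.q1' +
      (k - a * e1) * b ^ 3 * (e4 - e2) * z₂
  have W₁₂ : ((k - a * e1) * (l - b * e4)) * ((a ^ 2 * b ^ 2) * (e1^2*e2^2 - 2*e1^2*e2*e4 + e1^2*e4^2 - e1*e2^2*e3 - e1*e2^2*e5 + e1*e2*e3 + 2*e1*e2*e4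
    + e1*e2*e5 + 2*e1*e4^2*e5 - 2*e1*e4^2 - 2*e1*e4*e5 + e2^2*e3*e5 - e2*e3*e5
    + e2*e4*e5^2 - e2*e4*e5 + e2*e5^2*e6 - e2*e5^2 - e2*e5*e6 + e4^2*e5^2 - 2*e4^2*e5
    + e4^2 + e4*e5^2*e6 - 2*e4*e5^2 - e4*e5*e6 + 2*e4*e5 - e5^2*e6 + e5^2 + e5*e6) +
      a ^ 2 * (e1*e3 - e1*e5 - e3*e5 + e5) +
      b ^ 2 * (e2*e4 - e2*e6 - e4*e6 + e6)) = 0 := by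
    linear_combination ((k - a * e1) * (l - b * e4)) * (a ^ 2 * b ^ 2) * R.q12 +
      ((k - a * e1) * (l - b * e4)) * a ^ 2 * z₁ +
      ((k - a * e1) * (l - b * e4)) * b ^ 2 * z₂
  have W₂₁ : ((l - b * e2) * (k - a * e3)) * ((a ^ 2 * b ^ 2) * (- e1^2*e2^2 + e1^2*e2*e4 + e1^2*e2*e6 - e1^2*e4*e6 + 2*e1*e2^2*e3 - 2*e1*e2*e3
    - e1*e2*e4 - e1*e2*e6 - e1*e3*e6^2 + e1*e3*e6 + e1*e4*e6 - e1*e5*e6^2 + e1*e5*e6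
    + e1*e6^2 - e2^2*e3^2 - 2*e2*e3^2*e6 + 2*e2*e3^2 + 2*e2*e3*e6 - e3^2*e6^2
    + 2*e3^2*e6 - e3^2 - e3*e5*e6^2 + e3*e5*e6 + 2*e3*e6^2 - 2*e3*e6 + e5*e6^2 - e5*e6
    - e6^2) +
      (-a ^ 2) * (e1*e3 - e1*e5 - e3*e5 + e5) +
      (-b ^ 2) * (e2*e4 - e2*e6 - e4*e6 + e6)) = 0 := by
    linear_combination ((l - b * e2) * (k - a * e3)) * (a ^ 2 * b ^ 2) * R.q21 +
      ((l - b * e2) * (k - a * e3)) * (-a ^ 2) * z₁ +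
      ((l - b * e2) * (k - a * e3)) * (-b ^ 2) * z₂
  simp only [t₁, t₂, map_add, P.smul₁, P.smul₂, P.inv₁, P.inv₂, smul_add, smul_smul, map_mul,
    map_sub, hk₁, hk₂, map_one, hl₁, hl₂, ha₁, ha₂, hb₁, hb₂, h₁₁, h₁₂, h₁₃, h₁₄, h₁₅, h₁₆,
    h₂₁, h₂₂, h₂₃, h₂₄, h₂₅, h₂₆, smul_sub]
  clear t₁ t₂ hk₁ hk₂ hl₁ hl₂ ha₁ ha₂ hb₁ hb₂ h₁₁ h₁₂ h₁₃ h₁₄ h₁₅ h₁₆ h₂₁ h₂₂ h₂₃ h₂₄ h₂₅ h₂₆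
  clear R z₁ z₂ T₁ T₂
  match_scalars
  · ring
  · clear S W₁ W₁₂ W₂₁
    grind
  · clear S W₂ W₁₂ W₂₁
    grind
  · clear S W₁ W₂ W₂₁
    grind
  · clear S W₁ W₂ W₁₂
    grind
  all_goals
    clear W₁ W₂ W₁₂ W₂₁
    first | ring1 | grind

end Defect

/-! ### A single truncated Demazure-Lusztig operator -/

section Single

variable {F E : Type*} [Field F] [AddCommGroup E] [Module ℝ E]

theorem mono_induction {G : Type*} [AddCommGroup G] {p : AddMonoidAlgebra F G → Prop}
    (m : AddMonoidAlgebra F G) (h : ∀ y, p (mono F y)) (hadd : ∀ a b, p a → p b → p (a + b))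
    (hsmul : ∀ (c : F) a, p a → p (c • a)) : p m := by
  induction m using AddMonoidAlgebra.induction_on with
  | of y => exact h _
  | add f g hf hg => exact hadd f g hf hg
  | smul r f hf => exact hsmul r f hf

theorem linearMap_ext_mono {G A : Type*} [AddCommGroup G] [AddCommGroup A] [Module F A]
    {f g : AddMonoidAlgebra F G →ₗ[F] A} (h : ∀ y, f (mono F y) = g (mono F y)) : f = g := by
  refine LinearMap.ext fun m => ?_
  induction m using mono_induction with
  | h y => exact h y
  | hadd a b ha hb => rw [map_add, map_add, ha, hb]
  | hsmul c a ha => rw [map_smul, map_smul, ha]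

theorem floorE_add_even (s : ℝ) (n : ℤ) : floorE (s + (2 * n : ℤ)) = floorE s + 2 * n := by
  rw [floorE, floorE]
  have : (s + (2 * n : ℤ)) / 2 = s / 2 + n := by push_cast; ring
  rw [this, Int.floor_add_intCast]; ring

theorem floorO_add_even (s : ℝ) (n : ℤ) : floorO (s + (2 * n : ℤ)) = floorO s + 2 * n := by
  rw [floorO, floorO, add_right_comm, floorE_add_even]; ring

theorem floorE_add_odd (s : ℝ) (n : ℤ) :
    floorE (s + (2 * n + 1 : ℤ)) = floorO s + (2 * n + 1) := by
  have : s + (2 * n + 1 : ℤ) = (s + 1) + (2 * n : ℤ) := by push_cast; ring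
  rw [this, floorE_add_even, floorO]; ring

theorem floorO_add_odd (s : ℝ) (n : ℤ) :
    floorO (s + (2 * n + 1 : ℤ)) = floorE s + (2 * n + 1) := by
  have : s + (2 * n + 1 : ℤ) + 1 = s + (2 * (n + 1) : ℤ) := by push_cast; ring
  rw [floorO, this, floorE_add_even]; ring

theorem chiE_add_even (s : ℝ) (n : ℤ) : chiE (s + (2 * n : ℤ)) = chiE s := by
  rw [chiE, chiE]
  congr 1
  refine propext ⟨fun ⟨m, hm, h⟩ => ⟨m - 2 * n, hm.sub (even_two_mul n), ?_⟩,
    fun ⟨m, hm, h⟩ => ⟨m + 2 * n, hm.add (even_two_mul n), ?_⟩⟩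
  · push_cast at h ⊢; linarith
  · push_cast at h ⊢; linarith

theorem chiO_add_even (s : ℝ) (n : ℤ) : chiO (s + (2 * n : ℤ)) = chiO s := by
  rw [chiO, chiO]
  congr 1
  refine propext ⟨fun ⟨m, hm, h⟩ => ⟨m - 2 * n, hm.sub_even (even_two_mul n), ?_⟩,
    fun ⟨m, hm, h⟩ => ⟨m + 2 * n, hm.add_even (even_two_mul n), ?_⟩⟩
  · push_cast at h ⊢; linarith
  · push_cast at h ⊢; linarith

theorem chiE_add_one (s : ℝ) : chiE (s + 1) = chiO s := by
  rw [chiE, chiO]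
  congr 1
  refine propext ⟨fun ⟨m, hm, h⟩ => ⟨m - 1, hm.sub_odd odd_one, ?_⟩,
    fun ⟨m, hm, h⟩ => ⟨m + 1, hm.add_odd odd_one, ?_⟩⟩
  · push_cast at h ⊢; linarith
  · push_cast at h ⊢; linarith

theorem chiO_add_one (s : ℝ) : chiO (s + 1) = chiE s := by
  rw [chiE, chiO]
  congr 1
  refine propext ⟨fun ⟨m, hm, h⟩ => ⟨m - 1, hm.sub_odd odd_one, ?_⟩,
    fun ⟨m, hm, h⟩ => ⟨m + 1, hm.add_odd odd_one, ?_⟩⟩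
  · push_cast at h ⊢; linarith
  · push_cast at h ⊢; linarith

theorem chiE_add_odd (s : ℝ) (n : ℤ) : chiE (s + (2 * n + 1 : ℤ)) = chiO s := by
  have : s + (2 * n + 1 : ℤ) = (s + (2 * n : ℤ)) + 1 := by push_cast; ring
  rw [this, chiE_add_one, chiO_add_even]

theorem chiO_add_odd (s : ℝ) (n : ℤ) : chiO (s + (2 * n + 1 : ℤ)) = chiE s := by
  have : s + (2 * n + 1 : ℤ) = (s + (2 * n : ℤ)) + 1 := by push_cast; ring
  rw [this, chiO_add_one, chiE_add_even]

theorem chiE_zero : chiE 0 = 1 := by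
  rw [chiE, if_pos ⟨0, Even.zero, by simp⟩]

theorem chiE_one : chiE 1 = 0 := by
  rw [chiE, if_neg]
  rintro ⟨n, hn, h⟩
  have : n = 1 := by exact_mod_cast h
  subst this
  exact absurd hn (by decide)

theorem chiO_zero : chiO 0 = 0 := by rw [← chiE_add_one, zero_add, chiE_one]

theorem chiO_one : chiO 1 = 1 := by
  have := chiO_add_one 0
  rwa [zero_add, chiE_zero] at this

theorem not_int_of_mem_Ioo {s : ℝ} (h0 : 0 < s) (h1 : s < 1) (n : ℤ) : (n : ℝ) ≠ s := by
  rintro rfl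
  have h0' : 0 < n := by exact_mod_cast h0
  have h1' : n < 1 := by exact_mod_cast h1
  omega

theorem chiE_of_mem_Ioo {s : ℝ} (h0 : 0 < s) (h1 : s < 1) : chiE s = 0 := by
  rw [chiE, if_neg]
  rintro ⟨n, -, h⟩
  exact not_int_of_mem_Ioo h0 h1 n h

theorem chiO_of_mem_Ioo {s : ℝ} (h0 : 0 < s) (h1 : s < 1) : chiO s = 0 := by
  rw [chiO, if_neg]
  rintro ⟨n, -, h⟩
  exact not_int_of_mem_Ioo h0 h1 n h

theorem chiE_neg (s : ℝ) : chiE (-s) = chiE s := by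
  rw [chiE, chiE]
  congr 1
  refine propext ⟨fun ⟨m, hm, h⟩ => ⟨-m, hm.neg, ?_⟩, fun ⟨m, hm, h⟩ => ⟨-m, hm.neg, ?_⟩⟩
  · push_cast; linarith
  · push_cast; linarith

theorem chiO_neg (s : ℝ) : chiO (-s) = chiO s := by
  rw [chiO, chiO]
  congr 1
  refine propext ⟨fun ⟨m, hm, h⟩ => ⟨-m, hm.neg, ?_⟩, fun ⟨m, hm, h⟩ => ⟨-m, hm.neg, ?_⟩⟩
  · push_cast; linarith
  · push_cast; linarith

theorem floorE_eq {s : ℝ} {n : ℤ} (h0 : (2 * n : ℝ) ≤ s) (h1 : s < 2 * n + 2) :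
    floorE s = 2 * n := by
  rw [floorE, Int.floor_eq_iff.mpr (⟨by linarith, by linarith⟩ : (n : ℝ) ≤ s / 2 ∧ s / 2 < n + 1)]

theorem floorO_eq {s : ℝ} {n : ℤ} (h0 : (2 * n - 1 : ℝ) ≤ s) (h1 : s < 2 * n + 1) :
    floorO s = 2 * n - 1 := by
  rw [floorO, floorE_eq (n := n) (by linarith) (by linarith)]

/-- The truncated Demazure-Lusztig operator attached to a functional `α`, a vector `v` and
parameters `k`, `u`. -/
noncomputable def tdl (α : E →ₗ[ℝ] ℝ) (v : E) (k u : Fˣ) : Module.End F (AddMonoidAlgebra F E) :=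
  linExt fun y =>
    ((k ^ chiE (α y) * u ^ chiO (α y) : Fˣ) : F) • mono F (y - α y • v)
      + ((k : F) - (k⁻¹ : Fˣ)) • (exactQuot (1 - mono F (-floorE (α y) • v))
          (1 - mono F ((2 : ℤ) • v)) * mono F y)
      + ((u : F) - (u⁻¹ : Fˣ)) • (exactQuot (mono F v - mono F (-floorO (α y) • v))
          (1 - mono F ((2 : ℤ) • v)) * mono F y)

/-- The denominator `1 - x^{2 v}`. -/
noncomputable def den (F : Type*) [Field F] (v : E) : AddMonoidAlgebra F E :=
  1 - mono F ((2 : ℤ) • v)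

/-- The numerator `k - k⁻¹ + (u - u⁻¹) x^v`. -/
noncomputable def num (v : E) (k u : Fˣ) : AddMonoidAlgebra F E :=
  ((k : F) - (k⁻¹ : Fˣ)) • 1 + ((u : F) - (u⁻¹ : Fˣ)) • mono F v

theorem evenQuot_mul (v : E) (n : ℤ) (hn : Even n) :
    exactQuot (1 - mono F (n • v)) (1 - mono F ((2 : ℤ) • v)) * den F v
      = 1 - mono F (n • v) := by
  obtain ⟨m, rfl⟩ := hn
  apply exactQuot_mul
  have := one_sub_mono_dvd (F := F) ((2 : ℤ) • v) m
  rwa [smul_smul, mul_two] at this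

theorem oddQuot_mul (v : E) (n : ℤ) (hn : Odd n) :
    exactQuot (mono F v - mono F (n • v)) (1 - mono F ((2 : ℤ) • v)) * den F v
      = mono F v - mono F (n • v) := by
  obtain ⟨m, rfl⟩ := hn
  apply exactQuot_mul
  have h := (one_sub_mono_dvd (F := F) ((2 : ℤ) • v) m).mul_left (mono F v)
  rw [mul_sub, mul_one, mono_mul, smul_smul] at h
  have h2 : v + (m * 2) • v = (2 * m + 1) • v := by rw [add_smul, one_smul, mul_comm, add_comm]
  rwa [h2] at h

theorem even_neg_floorE (s : ℝ) : Even (-floorE s) := (floorE_isGreatest s).1.1.neg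

theorem odd_neg_floorO (s : ℝ) : Odd (-floorO s) := (floorO_isGreatest s).1.1.neg

variable (α : E →ₗ[ℝ] ℝ) (v : E) (k u : Fˣ)

/-- The denominator-free form of the operator: `exactQuot` is eliminated here, and identities are
later proved after multiplication by `den` and cancelled in the domain F[E]. -/
theorem den_mul_tdl_mono (y : E) :
    den F v * tdl α v k u (mono F y) =
      ((k ^ chiE (α y) * u ^ chiO (α y) : Fˣ) : F) • (den F v * mono F (y - α y • v))
        + (num v k u - ((k : F) - (k⁻¹ : Fˣ)) • mono F (-floorE (α y) • v)
          - ((u : F) - (u⁻¹ : Fˣ)) • mono F (-floorO (α y) • v)) * mono F y := by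
  have h1 := evenQuot_mul (F := F) v _ (even_neg_floorE (α y))
  have h2 := oddQuot_mul (F := F) v _ (odd_neg_floorO (α y))
  rw [tdl, linExt_mono, num]
  simp only [Algebra.smul_def] at *
  linear_combination
    (algebraMap F (AddMonoidAlgebra F E) ((k : F) - (k⁻¹ : Fˣ))) * mono F y * h1
    + (algebraMap F (AddMonoidAlgebra F E) ((u : F) - (u⁻¹ : Fˣ))) * mono F y * h2

variable {α v}

theorem ne_zero_of_apply_eq_two (hv : α v = 2) : v ≠ 0 := by
  rintro rfl
  simp at hv

theorem den_ne_zero (hv : v ≠ 0) : den F v ≠ 0 := by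
  apply one_sub_mono_ne_zero
  have h : ((2 : ℤ) • v) = (2 : ℝ) • v := by module
  rw [h]
  exact smul_ne_zero two_ne_zero hv

/-- The reflection `y ↦ y - α(y) v` as a ring automorphism of the quasi-polynomials. -/
noncomputable def reflHom (F : Type*) [Field F] (α : E →ₗ[ℝ] ℝ) (v : E) :
    AddMonoidAlgebra F E →ₐ[F] AddMonoidAlgebra F E :=
  AddMonoidAlgebra.mapDomainAlgHom F F
    ((LinearMap.id - α.smulRight v : E →ₗ[ℝ] E).toAddMonoidHom)

theorem reflHom_mono (y : E) : reflHom F α v (mono F y) = mono F (y - α y • v) := by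
  simp [reflHom, mono, AddMonoidAlgebra.mapDomain_single]

theorem mono_neg_one_smul_mul (y : E) : mono F ((-1 : ℤ) • y) * mono F y = 1 := by
  rw [mono_mul, neg_one_smul, neg_add_cancel, mono_zero]

variable (α v) in
/-- The intertwiner `(1 - x^{2 v}) T - (k - k⁻¹ + (u - u⁻¹) x^v)`. -/
noncomputable def inter : Module.End F (AddMonoidAlgebra F E) :=
  LinearMap.mulLeft F (den F v) * tdl α v k u - LinearMap.mulLeft F (num v k u)

theorem inter_apply (m : AddMonoidAlgebra F E) :
    inter α v k u m = den F v * tdl α v k u m - num v k u * m := rfl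

theorem inter_mono (y : E) :
    inter α v k u (mono F y) =
      ((k ^ chiE (α y) * u ^ chiO (α y) : Fˣ) : F) • (den F v * mono F (y - α y • v))
        - (((k : F) - (k⁻¹ : Fˣ)) • mono F (-floorE (α y) • v)
          + ((u : F) - (u⁻¹ : Fˣ)) • mono F (-floorO (α y) • v)) * mono F y := by
  rw [inter_apply, den_mul_tdl_mono]
  ring

/-- An even translation keeps the indicators and shifts both floors by n. An odd one exchanges the
even and odd data, which is harmless exactly because then k = u. The untruncated numerator, which
would not transform this way, has been removed in `inter`. -/
theorem inter_mono_add {k u : Fˣ} {μ : E} {n : ℤ} (hn : α μ = n) (h : Even n ∨ k = u) (y : E) :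
    inter α v k u (mono F (μ + y)) = mono F (μ - α μ • v) * inter α v k u (mono F y) := by
  have hs : μ + y - α (μ + y) • v = (μ - α μ • v) + (y - α y • v) := by
    rw [map_add]; module
  have hμ : ∀ m : ℤ, mono F ((m - n) • v) * mono F (μ + y)
      = mono F (μ - α μ • v) * (mono F (m • v) * mono F y) := by
    intro m
    rw [mono_mul, mono_mul, mono_mul, hn]
    congr 1
    rw [← Int.cast_smul_eq_zsmul ℝ, ← Int.cast_smul_eq_zsmul ℝ]
    push_cast
    module
  have ha : α (μ + y) = α y + n := by rw [map_add, hn, add_comm]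
  have key : ((k ^ chiE (α (μ + y)) * u ^ chiO (α (μ + y)) : Fˣ) : F)
        = ((k ^ chiE (α y) * u ^ chiO (α y) : Fˣ) : F) ∧
      (((k : F) - (k⁻¹ : Fˣ)) • mono F (-floorE (α (μ + y)) • v)
          + ((u : F) - (u⁻¹ : Fˣ)) • mono F (-floorO (α (μ + y)) • v))
        = (((k : F) - (k⁻¹ : Fˣ)) • mono F ((-floorE (α y) - n) • v)
          + ((u : F) - (u⁻¹ : Fˣ)) • mono F ((-floorO (α y) - n) • v)) := by
    rw [ha]
    rcases Int.even_or_odd' n with ⟨m, rfl | rfl⟩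
    · rw [chiE_add_even, chiO_add_even, floorE_add_even, floorO_add_even, neg_add', neg_add']
      exact ⟨rfl, rfl⟩
    · have hku : k = u := h.resolve_left (by simp)
      subst hku
      rw [chiE_add_odd, chiO_add_odd, floorE_add_odd, floorO_add_odd, neg_add', neg_add', mul_comm]
      exact ⟨rfl, add_comm _ _⟩
  rw [inter_mono, inter_mono, key.1, key.2, hs, ← mono_mul]
  have h1 := hμ (-floorE (α y))
  have h2 := hμ (-floorO (α y))
  simp only [Algebra.smul_def]
  linear_combination
    -(algebraMap F (AddMonoidAlgebra F E) ((k : F) - (k⁻¹ : Fˣ))) * h1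
    - (algebraMap F (AddMonoidAlgebra F E) ((u : F) - (u⁻¹ : Fˣ))) * h2

theorem inter_mono_mul {k u : Fˣ} {μ : E} {n : ℤ} (hn : α μ = n) (h : Even n ∨ k = u)
    (m : AddMonoidAlgebra F E) :
    inter α v k u (mono F μ * m) = mono F (μ - α μ • v) * inter α v k u m := by
  induction m using mono_induction with
  | h y => rw [mono_mul, inter_mono_add hn h]
  | hadd a b ha hb => rw [mul_add, map_add, ha, hb, map_add, mul_add]
  | hsmul c a ha => rw [mul_smul_comm, map_smul, ha, map_smul, mul_smul_comm]

/-- The cross relation, cleared of its denominator. -/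
theorem den_mul_tdl_mono_mul {k u : Fˣ} {μ : E} {n : ℤ} (hn : α μ = n) (h : Even n ∨ k = u)
    (m : AddMonoidAlgebra F E) :
    den F v * (tdl α v k u (mono F μ * m) - mono F (μ - α μ • v) * tdl α v k u m)
      = num v k u * (mono F μ - mono F (μ - α μ • v)) * m := by
  have := inter_mono_mul (F := F) (v := v) hn h m
  rw [inter_apply, inter_apply] at this
  linear_combination this

/-- The scalar `k^{χ_e(a)} u^{-χ_o(a)}`. -/
noncomputable def wallFactor (k u : Fˣ) (a : ℝ) : Fˣ := k ^ chiE a * u ^ (-chiO a)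

/-- Both truncated quotients vanish for 0 ≤ α(y) < 1, the floors being 0 and -1. At α(y) = 1 the odd
floor jumps to 1 and the odd quotient becomes -x^{-v}; as x^{sy} = x^{y-v}, the coefficient u turns
into u - (u - u⁻¹) = u⁻¹. This is the source of the exponent -χ_o in κ. -/
theorem tdl_mono_of_mem_Icc (hv : α v = 2) {y : E} (h0 : 0 ≤ α y) (h1 : α y ≤ 1) :
    tdl α v k u (mono F y) = (wallFactor k u (α y) : F) • mono F (y - α y • v) := by
  apply mul_left_cancel₀ (den_ne_zero (F := F) (ne_zero_of_apply_eq_two hv))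
  rw [den_mul_tdl_mono, wallFactor]
  rcases h0.eq_or_lt with h0 | h0
  · rw [← h0, floorE_eq (n := 0) (by norm_num) (by norm_num),
      floorO_eq (n := 0) (by norm_num) (by norm_num), chiE_zero, chiO_zero, num]
    simp [mono_zero]
  rcases h1.eq_or_lt with h1 | h1
  · rw [h1, floorE_eq (n := 0) (by norm_num) (by norm_num),
      floorO_eq (n := 1) (by norm_num) (by norm_num), chiE_one, chiO_one, num, den]
    have e1 := mono_neg_one_smul_mul (F := F) v
    have e2 : mono F ((2 : ℤ) • v) = mono F v * mono F v := by rw [two_smul, mono_mul]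
    have e3 : mono F (y - (1 : ℝ) • v) = mono F ((-1 : ℤ) • v) * mono F y := by
      rw [mono_mul]; congr 1; module
    rw [e2, e3]
    norm_num only [zpow_zero, zpow_one, mul_one, one_mul, mul_zero, neg_zero, zero_smul, mono_zero,
      zpow_neg, sub_self, Int.reduceNeg, Int.reduceSub]
    simp only [Algebra.smul_def, map_sub, mul_one]
    linear_combination (algebraMap F (AddMonoidAlgebra F E) (u : F)
       - algebraMap F (AddMonoidAlgebra F E) ((u⁻¹ : Fˣ) : F)) * mono F y * mono F v * e1 * (-1)
  · rw [floorE_eq (n := 0) (by push_cast; linarith) (by push_cast; linarith),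
      floorO_eq (n := 0) (by push_cast; linarith) (by push_cast; linarith),
      chiE_of_mem_Ioo h0 h1, chiO_of_mem_Ioo h0 h1, num]
    simp [mono_zero]

theorem refl_refl (hv : α v = 2) (y : E) :
    y - α y • v - α (y - α y • v) • v = y := by
  rw [map_sub, map_smul, hv, smul_eq_mul]; module

theorem apply_refl (hv : α v = 2) (y : E) : α (y - α y • v) = -α y := by
  rw [map_sub, map_smul, hv, smul_eq_mul]; ring

/-- The companion coefficients: off the wall, s y has α-value in [-1, 0), where the even floor is -2
and the odd floor is -1, so the even quotient is 1 and the odd one is 0. -/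
theorem tdl_mono_refl_of_mem_Icc (hv : α v = 2) {y : E} (h0 : 0 ≤ α y) (h1 : α y ≤ 1) :
    tdl α v k u (mono F (y - α y • v)) = (((wallFactor k u (α y))⁻¹ : Fˣ) : F) • mono F y
      + ((k : F) - (k⁻¹ : Fˣ)) • mono F (y - α y • v) := by
  apply mul_left_cancel₀ (den_ne_zero (F := F) (ne_zero_of_apply_eq_two hv))
  rw [den_mul_tdl_mono, wallFactor, refl_refl hv, apply_refl hv, chiE_neg, chiO_neg]
  rcases h0.eq_or_lt with h0 | h0
  · rw [← h0, neg_zero, floorE_eq (n := 0) (by norm_num) (by norm_num),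
      floorO_eq (n := 0) (by norm_num) (by norm_num), chiE_zero, chiO_zero, num]
    simp only [zpow_one, zpow_zero, mul_one, neg_zero, mul_zero, zero_sub, neg_neg, one_smul,
      zero_smul, mono_zero, sub_zero, Algebra.smul_def, map_sub]
    ring
  have hE : floorE (-α y) = 2 * (-1 : ℤ) :=
    floorE_eq (by push_cast; linarith) (by push_cast; linarith)
  have hO : floorO (-α y) = 2 * (0 : ℤ) - 1 :=
    floorO_eq (by push_cast; linarith) (by push_cast; linarith)
  rw [hE, hO, num, den]
  have hk : ((k ^ chiE (α y) * u ^ chiO (α y) : Fˣ) : F)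
      = (((k ^ chiE (α y) * u ^ (-chiO (α y)))⁻¹ : Fˣ) : F) := by
    rcases h1.eq_or_lt with h1 | h1
    · rw [h1, chiE_one, chiO_one]; simp
    · rw [chiE_of_mem_Ioo h0 h1, chiO_of_mem_Ioo h0 h1]; simp
  rw [hk]
  simp only [Algebra.smul_def, map_sub]
  norm_num
  ring

theorem reflHom_den (hv : α v = 2) : reflHom F α v (den F v) = 1 - mono F ((-2 : ℤ) • v) := by
  rw [den, map_sub, map_one, reflHom_mono, map_zsmul, hv]
  congr 2
  module

theorem reflHom_num (hv : α v = 2) : reflHom F α v (num v k u) =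
    ((k : F) - (k⁻¹ : Fˣ)) • 1 + ((u : F) - (u⁻¹ : Fˣ)) • mono F ((-1 : ℤ) • v) := by
  rw [num, map_add, map_smul, map_smul, map_one, reflHom_mono, hv]
  congr 3
  module

theorem reflHom_den_ne_zero (hv : α v = 2) : reflHom F α v (den F v) ≠ 0 := by
  rw [reflHom_den hv]
  apply one_sub_mono_ne_zero
  have h : ((-2 : ℤ) • v) = (-2 : ℝ) • v := by module
  rw [h]
  exact smul_ne_zero (by norm_num) (ne_zero_of_apply_eq_two hv)

/-- Divided by D·s(D) this says that e = N/D satisfies e + s(e) = k - k⁻¹, the rational-function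
form of the quadratic relation. -/
theorem num_mul_refl_den (hv : α v = 2) :
    num v k u * reflHom F α v (den F v) + den F v * reflHom F α v (num v k u)
      = ((k : F) - (k⁻¹ : Fˣ)) • (den F v * reflHom F α v (den F v)) := by
  rw [reflHom_den hv, reflHom_num k u hv, num, den]
  have e1 := mono_neg_one_smul_mul (F := F) v
  have e2 : mono F ((2 : ℤ) • v) = mono F v * mono F v := by rw [two_smul, mono_mul]
  have e3 : mono F ((-2 : ℤ) • v) = mono F ((-1 : ℤ) • v) * mono F ((-1 : ℤ) • v) := by
    rw [mono_mul]; congr 1; module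
  rw [e2, e3]
  simp only [Algebra.smul_def, mul_one]
  generalize mono F v = X at *
  generalize mono F ((-1 : ℤ) • v) = Y at *
  generalize algebraMap F (AddMonoidAlgebra F E) ((u : F) - (u⁻¹ : Fˣ)) = B at *
  generalize algebraMap F (AddMonoidAlgebra F E) ((k : F) - (k⁻¹ : Fˣ)) = A at *
  linear_combination (-A * (X * Y + 1) - B * (X + Y)) * e1

theorem inter_den_mul (hv : α v = 2) (m : AddMonoidAlgebra F E) :
    inter α v k u (den F v * m) = reflHom F α v (den F v) * inter α v k u m := by
  have h : α ((2 : ℤ) • v) = (4 : ℤ) := by rw [map_zsmul, hv]; norm_num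
  rw [den, sub_mul, one_mul, map_sub, inter_mono_mul h (Or.inl (by decide)), map_sub, map_one,
    reflHom_mono, sub_mul, one_mul]

theorem inter_num_mul (hv : α v = 2) (m : AddMonoidAlgebra F E) :
    inter α v k u (num v k u * m) = reflHom F α v (num v k u) * inter α v k u m := by
  have h : α v = (2 : ℤ) := by rw [hv]; norm_num
  rw [num, add_mul, smul_mul_assoc, smul_mul_assoc, one_mul, map_add, map_smul, map_smul,
    inter_mono_mul h (Or.inl (by decide)), map_add, map_smul, map_smul, map_one, reflHom_mono,
    add_mul, smul_mul_assoc, smul_mul_assoc, one_mul]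

/-- I sends x^y and x^{sy} to combinations of these two with coefficients in D, N and the wall
factor; pulling D and N through the second I by semilinearity and using e + s(e) = k - k⁻¹, the
off-diagonal terms cancel. -/
theorem inter_inter_of_mem_Icc (hv : α v = 2) {y : E} (h0 : 0 ≤ α y) (h1 : α y ≤ 1) :
    inter α v k u (inter α v k u (mono F y)) =
      (den F v * reflHom F α v (den F v) + num v k u * reflHom F α v (num v k u)) * mono F y ∧
    inter α v k u (inter α v k u (mono F (y - α y • v))) =
      (den F v * reflHom F α v (den F v) + num v k u * reflHom F α v (num v k u))
        * mono F (y - α y • v) := by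
  have hκ : ((wallFactor k u (α y) : Fˣ) : F) * (((wallFactor k u (α y))⁻¹ : Fˣ) : F) = 1 := by
    simp
  have hκ' := congrArg (algebraMap F (AddMonoidAlgebra F E)) hκ
  have key := num_mul_refl_den (F := F) (k := k) (u := u) hv
  have ha : inter α v k u (mono F y) = (wallFactor k u (α y) : F) •
      (den F v * mono F (y - α y • v)) - num v k u * mono F y := by
    rw [inter_apply, tdl_mono_of_mem_Icc k u hv h0 h1, mul_smul_comm]
  have hb : inter α v k u (mono F (y - α y • v)) = (((wallFactor k u (α y))⁻¹ : Fˣ) : F) •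
      (den F v * mono F y) + ((k : F) - (k⁻¹ : Fˣ)) • (den F v * mono F (y - α y • v))
        - num v k u * mono F (y - α y • v) := by
    rw [inter_apply, tdl_mono_refl_of_mem_Icc k u hv h0 h1, mul_add, mul_smul_comm, mul_smul_comm]
  have ha2 : inter α v k u (inter α v k u (mono F y)) = (wallFactor k u (α y) : F) •
      (reflHom F α v (den F v) * inter α v k u (mono F (y - α y • v)))
        - reflHom F α v (num v k u) * inter α v k u (mono F y) := by
    rw [ha, map_sub, map_smul, inter_den_mul k u hv, inter_num_mul k u hv, ← ha]
  have hb2 : inter α v k u (inter α v k u (mono F (y - α y • v))) =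
      (((wallFactor k u (α y))⁻¹ : Fˣ) : F) •
      (reflHom F α v (den F v) * inter α v k u (mono F y))
        + ((k : F) - (k⁻¹ : Fˣ)) •
          (reflHom F α v (den F v) * inter α v k u (mono F (y - α y • v)))
        - reflHom F α v (num v k u) * inter α v k u (mono F (y - α y • v)) := by
    rw [hb, map_sub, map_add, map_smul, map_smul, inter_den_mul k u hv, inter_num_mul k u hv,
      inter_den_mul k u hv, ← hb]
  rw [ha2, hb2, ha, hb]
  rw [map_mul, map_one] at hκ'
  simp only [Algebra.smul_def] at *
  set D := den F v
  set D' := reflHom F α v D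
  set N := num v k u
  set N' := reflHom F α v N
  set κ := algebraMap F (AddMonoidAlgebra F E) ((wallFactor k u (α y) : Fˣ) : F)
  set κ' := algebraMap F (AddMonoidAlgebra F E) (((wallFactor k u (α y))⁻¹ : Fˣ) : F)
  set A := algebraMap F (AddMonoidAlgebra F E) ((k : F) - (k⁻¹ : Fˣ))
  constructor
  · linear_combination D * D' * mono F y * hκ' - κ * mono F (y - α y • v) * key
  · linear_combination D * D' * mono F (y - α y • v) * hκ'
      - (κ' * mono F y + A * mono F (y - α y • v)) * key

theorem inter_inter (hv : α v = 2) (m : AddMonoidAlgebra F E) :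
    inter α v k u (inter α v k u m) =
      (den F v * reflHom F α v (den F v) + num v k u * reflHom F α v (num v k u)) * m := by
  induction m using mono_induction with
  | h y =>
    -- The multiple of v whose subtraction brings α(y) into [-1, 1). Its α-value 2n is even, so I is
    -- semilinear for it whatever k and u are.
    set n : ℤ := ⌊(α y + 1) / 2⌋
    have hn : α (n • v) = (2 * n : ℤ) := by rw [map_zsmul, hv, zsmul_eq_mul]; push_cast; ring
    have hn' : α (n • v - α (n • v) • v) = (2 * -n : ℤ) := by
      rw [apply_refl hv, hn]; push_cast; ring
    have hz : mono F y = mono F (n • v) * mono F (y - n • v) := by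
      rw [mono_mul, add_sub_cancel]
    have h1 : ∀ m : AddMonoidAlgebra F E, inter α v k u (inter α v k u (mono F (n • v) * m))
        = mono F (n • v) * inter α v k u (inter α v k u m) := by
      intro m
      rw [inter_mono_mul hn (Or.inl (even_two_mul _)),
        inter_mono_mul hn' (Or.inl (even_two_mul _)), refl_refl hv]
    rw [hz, h1, mul_left_comm]
    congr 1
    have hl := Int.floor_le ((α y + 1) / 2)
    have hu := Int.lt_floor_add_one ((α y + 1) / 2)
    have hα : α (y - n • v) = α y - 2 * n := by rw [map_sub, hn]; push_cast; ring
    by_cases h0 : 0 ≤ α (y - n • v)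
    · exact (inter_inter_of_mem_Icc k u hv h0 (by rw [hα]; linarith)).1
    · have h2 := apply_refl hv (y - n • v)
      have := (inter_inter_of_mem_Icc (F := F) k u hv
        (y := y - n • v - α (y - n • v) • v) (by rw [h2]; linarith)
        (by rw [h2, hα]; linarith)).2
      rwa [refl_refl hv] at this
  | hadd a b ha hb => rw [map_add, map_add, ha, hb, mul_add]
  | hsmul c a ha => rw [map_smul, map_smul, ha, mul_smul_comm]

/-- The quadratic relation. -/
theorem tdl_sq (hv : α v = 2) (m : AddMonoidAlgebra F E) :
    tdl α v k u (tdl α v k u m) = ((k : F) - (k⁻¹ : Fˣ)) • tdl α v k u m + m := by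
  apply mul_left_cancel₀ (mul_ne_zero (den_ne_zero (F := F) (ne_zero_of_apply_eq_two hv))
    (reflHom_den_ne_zero (F := F) hv))
  have h1 := inter_inter k u hv m
  have key := num_mul_refl_den (F := F) (k := k) (u := u) hv
  rw [inter_apply _ _ m, map_sub, inter_den_mul k u hv, inter_num_mul k u hv, inter_apply,
    inter_apply] at h1
  simp only [Algebra.smul_def] at *
  linear_combination h1 + tdl α v k u m * key

theorem tdl_quadratic (hv : α v = 2) :
    (tdl α v k u - (k : F) • 1) * (tdl α v k u + ((k⁻¹ : Fˣ) : F) • 1) = 0 := by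
  refine LinearMap.ext fun m => ?_
  have h := tdl_sq k u hv m
  have hk : (k : F) * (k : F)⁻¹ = 1 := by simp
  simp only [Module.End.mul_apply, LinearMap.sub_apply, LinearMap.add_apply, LinearMap.smul_apply,
    Module.End.one_apply, map_add, map_smul, LinearMap.zero_apply, h]
  match_scalars
  · ring
  · linear_combination -hk

end Single

/-! ### Extension of intertwiners to the fraction field -/

section Extension

open scoped TensorProduct

/-- A semilinear map `I` on an `R`-module with `I² = n σ(n)`, for an involution `σ` of `R`. -/
structure Intertwiner (R A : Type*) [CommRing R] [AddCommGroup A] [Module R A] where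
  σ : R →+* R
  I : A →+ A
  n : R
  invol : ∀ r, σ (σ r) = r
  smul : ∀ r a, I (r • a) = σ r • I a
  sq : ∀ a, I (I a) = (n * σ n) • a
  ne_zero : n ≠ 0

namespace Intertwiner

variable {R A : Type*} [CommRing R] [IsDomain R] [AddCommGroup A] [Module R A]
  (J : Intertwiner R A)

theorem σ_injective : Function.Injective J.σ :=
  Function.LeftInverse.injective J.invol

/-- The involution on the fraction field. -/
noncomputable def fracσ : FractionRing R →+* FractionRing R := IsFractionRing.map J.σ_injective

theorem fracσ_algebraMap (r : R) :
    J.fracσ (algebraMap R (FractionRing R) r) = algebraMap R (FractionRing R) (J.σ r) := by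
  rw [fracσ, IsFractionRing.map]
  exact IsLocalization.map_eq (M := nonZeroDivisors R) _ r

theorem fracσ_fracσ (g : FractionRing R) : J.fracσ (J.fracσ g) = g := by
  obtain ⟨x, y, -, rfl⟩ := IsFractionRing.div_surjective (A := R) g
  simp only [map_div₀, fracσ_algebraMap, J.invol]

/-- The image of `n` in the fraction field. -/
noncomputable def fracN : FractionRing R := algebraMap R (FractionRing R) J.n

theorem fracN_ne_zero : J.fracN ≠ 0 := by
  rw [fracN, Ne, FaithfulSMul.algebraMap_eq_zero_iff]
  exact J.ne_zero

/-- The normalised intertwiner on the extension of scalars. -/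
noncomputable def ext : FractionRing R ⊗[R] A →+ FractionRing R ⊗[R] A :=
  TensorProduct.liftAddHom
    { toFun := fun g =>
        { toFun := fun a => (J.fracσ g * J.fracN⁻¹) ⊗ₜ[R] J.I a
          map_zero' := by simp
          map_add' := fun a b => by rw [map_add, TensorProduct.tmul_add] }
      map_zero' := by ext a; simp
      map_add' := fun g h => by ext a; simp [add_mul, TensorProduct.add_tmul] }
    (fun r g a => by
      simp only [AddMonoidHom.coe_mk, ZeroHom.coe_mk, J.smul, Algebra.smul_def, map_mul,
        fracσ_algebraMap]
      rw [← TensorProduct.smul_tmul, Algebra.smul_def, mul_assoc])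

theorem ext_tmul (g : FractionRing R) (a : A) :
    J.ext (g ⊗ₜ a) = (J.fracσ g * J.fracN⁻¹) ⊗ₜ[R] J.I a := rfl

theorem ext_smul (g : FractionRing R) (m : FractionRing R ⊗[R] A) :
    J.ext (g • m) = J.fracσ g • J.ext m := by
  induction m with
  | zero => simp
  | add a b ha hb => rw [smul_add, map_add, ha, hb, map_add, smul_add]
  | tmul h a =>
    rw [TensorProduct.smul_tmul', ext_tmul, ext_tmul, TensorProduct.smul_tmul', smul_eq_mul,
      smul_eq_mul, map_mul, mul_assoc]

/-- The normalising factors of two applications multiply to 1/(n σ(n)), which is the inverse of the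
scalar I². -/
theorem ext_ext (m : FractionRing R ⊗[R] A) : J.ext (J.ext m) = m := by
  induction m with
  | zero => simp
  | add a b ha hb => rw [map_add, map_add, ha, hb]
  | tmul h a =>
    have h1 : J.fracσ J.fracN ≠ 0 := (map_ne_zero _).mpr J.fracN_ne_zero
    have h2 := J.fracN_ne_zero
    rw [ext_tmul, ext_tmul, J.sq, ← TensorProduct.smul_tmul, Algebra.smul_def, map_mul, map_mul,
      fracσ_fracσ, ← fracσ_algebraMap, map_inv₀]
    congr 1
    rw [← fracN]
    field_simp

/-- If `d T = I + h` and `n = k d - h`, then `T` extends to `e + (k - e) S` with `e = h / d`. -/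
theorem one_tmul_eq {T : A →+ A} {d h k : R} (hd : d ≠ 0) (hn : J.n = k * d - h)
    (hT : ∀ a, d • T a = J.I a + h • a) (a : A) :
    (1 : FractionRing R) ⊗ₜ[R] T a =
      (algebraMap R (FractionRing R) h / algebraMap R (FractionRing R) d) • ((1 : FractionRing R) ⊗ₜ[R] a)
      + (algebraMap R (FractionRing R) k
        - algebraMap R (FractionRing R) h / algebraMap R (FractionRing R) d) •
          J.ext ((1 : FractionRing R) ⊗ₜ[R] a) := by
  have hd' : algebraMap R (FractionRing R) d ≠ 0 := by
    rwa [Ne, FaithfulSMul.algebraMap_eq_zero_iff]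
  have hn' : J.fracN = algebraMap R (FractionRing R) k * algebraMap R (FractionRing R) d
      - algebraMap R (FractionRing R) h := by rw [fracN, hn, map_sub, map_mul]
  have h0 := J.fracN_ne_zero
  rw [ext_tmul, map_one, one_mul, TensorProduct.smul_tmul', TensorProduct.smul_tmul',
    smul_eq_mul, smul_eq_mul, mul_one]
  have e1 : (algebraMap R (FractionRing R) k
        - algebraMap R (FractionRing R) h / algebraMap R (FractionRing R) d) * J.fracN⁻¹
      = (algebraMap R (FractionRing R) d)⁻¹ := by
    rw [hn'] at h0 ⊢
    field_simp
  have e2 : algebraMap R (FractionRing R) h / algebraMap R (FractionRing R) d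
      = h • (algebraMap R (FractionRing R) d)⁻¹ := by
    rw [Algebra.smul_def, div_eq_mul_inv]
  have e3 : (1 : FractionRing R) = d • (algebraMap R (FractionRing R) d)⁻¹ := by
    rw [Algebra.smul_def, mul_inv_cancel₀ hd']
  rw [e1, e2, TensorProduct.smul_tmul, ← TensorProduct.tmul_add]
  conv_lhs => rw [e3]
  rw [TensorProduct.smul_tmul, hT, add_comm]

end Intertwiner

/-- A torsion-free module embeds in its localisation at the nonzero elements, so identities may be
tested over the fraction field. -/
theorem one_tmul_injective {R A : Type*} [CommRing R] [IsDomain R] [AddCommGroup A] [Module R A]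
    (h : ∀ (r : R) (a : A), r • a = 0 → r = 0 ∨ a = 0) {a : A}
    (ha : (1 : FractionRing R) ⊗ₜ[R] a = 0) : a = 0 := by
  have h2 : TensorProduct.mk R (FractionRing R) A 1 a = TensorProduct.mk R (FractionRing R) A 1 0 := by
    rw [map_zero]; exact ha
  obtain ⟨c, hc⟩ := IsLocalizedModule.exists_of_eq (S := nonZeroDivisors R) h2
  rw [smul_zero] at hc
  exact (h _ _ hc).resolve_left (nonZeroDivisors.coe_ne_zero c)

end Extension

/-! ### The braid relations in rank two -/

section Alcove

/-- A property of points of the plane, given by the values `a`, `b` of two simple roots with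
Cartan integers `-p`, `-q`, that is inherited along the affine Weyl group. -/
structure AlcoveClosed (p q : ℤ) (G : ℝ → ℝ → Prop) : Prop where
  trans : ∀ (a b : ℝ) (s t : ℤ), G (a + 2 * s - p * t) (b - q * s + 2 * t) → G a b
  refl₁ : ∀ a b : ℝ, G (-a) (b + q * a) → G a b
  refl₂ : ∀ a b : ℝ, G (a + p * b) (-b) → G a b

variable {G : ℝ → ℝ → Prop}

theorem AlcoveClosed.A1A1 (h : AlcoveClosed 0 0 G)
    (h0 : ∀ a b, 0 ≤ a → a ≤ 1 → 0 ≤ b → b ≤ 1 → G a b) (a b : ℝ) : G a b := by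
  have h1 : ∀ a b : ℝ, |a| ≤ 1 → |b| ≤ 1 → G a b := by
    have h2 : ∀ a b : ℝ, 0 ≤ a → a ≤ 1 → |b| ≤ 1 → G a b := by
      intro a b ha ha' hb
      rw [abs_le] at hb
      rcases le_total 0 b with hb' | hb'
      · exact h0 a b ha ha' hb' hb.2
      · refine h.refl₂ a b ?_
        push_cast
        exact h0 _ _ (by linarith) (by linarith) (by linarith) (by linarith)
    intro a b ha hb
    rw [abs_le] at ha
    rcases le_total 0 a with ha' | ha'
    · exact h2 a b ha' ha.2 hb
    · refine h.refl₁ a b (h2 _ _ (by linarith) (by linarith) ?_)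
      simpa using hb
  refine h.trans a b (-⌊(a + 1) / 2⌋) (-⌊(b + 1) / 2⌋) (h1 _ _ ?_ ?_)
  · have := Int.floor_le ((a + 1) / 2)
    have := Int.lt_floor_add_one ((a + 1) / 2)
    rw [abs_le]; push_cast; constructor <;> linarith
  · have := Int.floor_le ((b + 1) / 2)
    have := Int.lt_floor_add_one ((b + 1) / 2)
    rw [abs_le]; push_cast; constructor <;> linarith

theorem AlcoveClosed.B2 (h : AlcoveClosed 1 2 G)
    (h0 : ∀ a b, 0 ≤ a → 0 ≤ b → 2 * a + b ≤ 1 → G a b) (a b : ℝ) : G a b := by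
  have c1 : ∀ a b : ℝ, 0 ≤ a → -1 ≤ b → b ≤ 1 → -1 ≤ 2 * a + b → 2 * a + b ≤ 1 → G a b := by
    intro a b ha hb hb' hc hc'
    by_cases d1 : 0 ≤ b
    · exact h0 a b ha d1 hc'
    refine h.refl₂ a b ?_
    push_cast
    by_cases d2 : 0 ≤ a + b
    · exact h0 _ _ (by linarith) (by linarith) (by linarith)
    refine h.refl₁ _ _ ?_
    push_cast
    by_cases d3 : 0 ≤ 2 * a + b
    · exact h0 _ _ (by linarith) (by linarith) (by linarith)
    refine h.refl₂ _ _ ?_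
    push_cast
    exact h0 _ _ (by linarith) (by linarith) (by linarith)
  have c2 : ∀ a b : ℝ, -1 ≤ b → b ≤ 1 → -1 ≤ 2 * a + b → 2 * a + b ≤ 1 → G a b := by
    intro a b hb hb' hc hc'
    by_cases d1 : 0 ≤ a
    · exact c1 a b d1 hb hb' hc hc'
    · refine h.refl₁ a b ?_
      push_cast
      exact c1 _ _ (by linarith) (by linarith) (by linarith) (by linarith) (by linarith)
  -- The long roots β and 2α + β are orthogonal, and the lattice moves their values independently by
  -- even integers. The resulting square is the union of the eight alcoves around the origin,
  -- treated in `c2`.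
  set m := ⌊(b + 1) / 2⌋
  set n := ⌊(2 * a + b + 1) / 2⌋
  have := Int.floor_le ((b + 1) / 2)
  have := Int.lt_floor_add_one ((b + 1) / 2)
  have := Int.floor_le ((2 * a + b + 1) / 2)
  have := Int.lt_floor_add_one ((2 * a + b + 1) / 2)
  refine h.trans a b (-n) (-n - m) (c2 _ _ ?_ ?_ ?_ ?_) <;> push_cast <;> linarith

theorem AlcoveClosed.A2 (h : AlcoveClosed 1 1 G)
    (h0 : ∀ a b, 0 ≤ a → 0 ≤ b → a + b ≤ 1 → G a b) (a b : ℝ) : G a b := by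
  have c1 : ∀ a b : ℝ, -1 ≤ a → a ≤ 1 → -1 ≤ b → b ≤ 1 → -1 ≤ a + b → a + b ≤ 1 → G a b := by
    have c0 : ∀ a b : ℝ, 0 ≤ a → a ≤ 1 → -1 ≤ b → b ≤ 1 → -1 ≤ a + b → a + b ≤ 1 → G a b := by
      intro a b ha ha' hb hb' hc hc'
      by_cases d1 : 0 ≤ b
      · exact h0 a b ha d1 hc'
      refine h.refl₂ a b ?_
      push_cast
      by_cases d2 : 0 ≤ a + b
      · exact h0 _ _ (by linarith) (by linarith) (by linarith)
      refine h.refl₁ _ _ ?_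
      push_cast
      exact h0 _ _ (by linarith) (by linarith) (by linarith)
    intro a b ha ha' hb hb' hc hc'
    by_cases d1 : 0 ≤ a
    · exact c0 a b d1 ha' hb hb' hc hc'
    · refine h.refl₁ a b ?_
      push_cast
      exact c0 _ _ (by linarith) (by linarith) (by linarith) (by linarith) (by linarith)
        (by linarith)
  -- The target is the hexagon of the six alcoves around the origin. A lattice translation changes a
  -- + b by s + t and b by 2t - s, so x + z can only be moved by multiples of 3 and its residue
  -- decides the translation. For residue 2 the order of the two fractional parts selects which
  -- neighbouring hexagon contains the point.
  have f1 := Int.floor_le (a + b)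
  have f2 := Int.lt_floor_add_one (a + b)
  have f3 := Int.floor_le b
  have f4 := Int.lt_floor_add_one b
  set x := ⌊a + b⌋
  set z := ⌊b⌋
  obtain ⟨m, hm | hm | hm⟩ : ∃ m : ℤ, x + z = 3 * m ∨ x + z = 3 * m + 1 ∨ x + z = 3 * m + 2 :=
    ⟨(x + z) / 3, by omega⟩
  all_goals
    have hm' := congrArg (Int.cast : ℤ → ℝ) hm
    push_cast at hm'
  · refine h.trans a b (m - x) (-m) (c1 _ _ ?_ ?_ ?_ ?_ ?_ ?_) <;> push_cast <;> linarith
  · refine h.trans a b (m - x) (-m - 1) (c1 _ _ ?_ ?_ ?_ ?_ ?_ ?_) <;> push_cast <;> linarith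
  · rcases le_total (a + b - x) (b - z) with e | e
    · refine h.trans a b (m - x + 1) (-m - 1) (c1 _ _ ?_ ?_ ?_ ?_ ?_ ?_) <;> push_cast <;> linarith
    · refine h.trans a b (m - x) (-m - 1) (c1 _ _ ?_ ?_ ?_ ?_ ?_ ?_) <;> push_cast <;> linarith

/-- The affine Weyl group of type `G₂` contains that of its long roots, of type `A₂`. -/
theorem AlcoveClosed.long_of_G2 (h : AlcoveClosed 1 3 G) :
    AlcoveClosed 1 1 fun A B => G ((B - A) / 3) A where
  trans a b s t hG := by
    refine h.trans _ _ t (s + t) ?_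
    convert hG using 1 <;> push_cast <;> ring
  refl₁ a b hG := by
    refine h.refl₂ _ _ ?_
    convert hG using 1; push_cast; ring
  refl₂ a b hG := by
    -- The reflection in the second long root 3α + β is the conjugate s_α s_β s_α.
    refine h.refl₁ _ _ (h.refl₂ _ _ (h.refl₁ _ _ ?_))
    convert hG using 1 <;> push_cast <;> ring

theorem AlcoveClosed.G2 (h : AlcoveClosed 1 3 G)
    (h0 : ∀ a b, 0 ≤ a → 0 ≤ b → 3 * a + 2 * b ≤ 1 → G a b) (a b : ℝ) : G a b := by
  have h1 := h.long_of_G2.A2 (fun A B hA hB hAB => ?_) b (b + 3 * a)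
  · convert h1 using 1; ring
  -- Here A = β and B = 3α + β, so A ≤ B means α ≥ 0: the wall α = 0 bisects the long-root alcove
  -- into two alcoves of type G₂.
  · rcases le_total A B with e | e
    · exact h0 _ _ (by linarith) hA (by linarith)
    · refine h.refl₁ _ _ (h0 _ _ (by linarith) ?_ ?_) <;> push_cast <;> linarith

end Alcove
-- The group algebra of a lattice and the operators over its fraction field.
section LatticeAlgebra

open scoped TensorProduct

variable {F E : Type*} [Field F] [AddCommGroup E] [Module ℝ E]

/-- The group algebra of an additive subgroup, inside the quasi-polynomials. -/
noncomputable def latticeAlg (F : Type*) [Field F] (Λ : AddSubgroup E) :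
    Subalgebra F (AddMonoidAlgebra F E) :=
  Algebra.adjoin F (mono F '' (Λ : Set E))

instance isDomain_latticeAlg (Λ : AddSubgroup E) : IsDomain (latticeAlg F Λ) :=
  have : Nontrivial (AddMonoidAlgebra F E) := inferInstance
  have : IsDomain (AddMonoidAlgebra F E) := NoZeroDivisors.to_isDomain _
  inferInstance

variable {Λ : AddSubgroup E} {α : E →ₗ[ℝ] ℝ} {v : E} (k u : Fˣ)

theorem mono_mem_latticeAlg {μ : E} (h : μ ∈ Λ) : mono F μ ∈ latticeAlg F Λ :=
  Algebra.subset_adjoin ⟨μ, h, rfl⟩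

/-- A quasi-monomial with exponent in `Λ`, as an element of the group algebra of `Λ`. -/
noncomputable def latticeMono (F : Type*) [Field F] (μ : Λ) : latticeAlg F Λ :=
  ⟨mono F μ, mono_mem_latticeAlg μ.2⟩

theorem reflHom_mem (h : ∀ μ ∈ Λ, μ - α μ • v ∈ Λ) {r : AddMonoidAlgebra F E}
    (hr : r ∈ latticeAlg F Λ) : reflHom F α v r ∈ latticeAlg F Λ := by
  induction hr using Algebra.adjoin_induction with
  | mem x hx =>
    obtain ⟨μ, hμ, rfl⟩ := hx
    rw [reflHom_mono]
    exact mono_mem_latticeAlg (h μ hμ)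
  | algebraMap c => rw [AlgHom.commutes]; exact Subalgebra.algebraMap_mem _ _
  | add x y _ _ hx hy => rw [map_add]; exact add_mem hx hy
  | mul x y _ _ hx hy => rw [map_mul]; exact mul_mem hx hy

theorem inter_mul_of_mem (h : ∀ μ ∈ Λ, ∃ n : ℤ, α μ = n ∧ (Even n ∨ k = u))
    {r : AddMonoidAlgebra F E} (hr : r ∈ latticeAlg F Λ) (m : AddMonoidAlgebra F E) :
    inter α v k u (r * m) = reflHom F α v r * inter α v k u m := by
  induction hr using Algebra.adjoin_induction generalizing m with
  | mem x hx =>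
    obtain ⟨μ, hμ, rfl⟩ := hx
    obtain ⟨n, hn, hn'⟩ := h μ hμ
    rw [reflHom_mono, inter_mono_mul hn hn']
  | algebraMap c =>
    rw [AlgHom.commutes, ← Algebra.smul_def, map_smul, Algebra.smul_def]
  | add x y _ _ hx hy => rw [add_mul, map_add, hx, hy, map_add, add_mul]
  | mul x y _ _ hx hy => rw [mul_assoc, hx, hy, map_mul, mul_assoc]

theorem reflHom_reflHom (hv : α v = 2) (r : AddMonoidAlgebra F E) :
    reflHom F α v (reflHom F α v r) = r := by
  induction r using mono_induction with
  | h y => rw [reflHom_mono, reflHom_mono, refl_refl hv]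
  | hadd a b ha hb => rw [map_add, map_add, ha, hb]
  | hsmul c a ha => rw [map_smul, map_smul, ha]

theorem den_mem (h : v ∈ Λ) : den F v ∈ latticeAlg F Λ :=
  sub_mem (one_mem _) (mono_mem_latticeAlg (zsmul_mem h 2))

theorem num_mem (h : v ∈ Λ) : num v k u ∈ latticeAlg F Λ :=
  add_mem (Subalgebra.smul_mem _ (one_mem _) _)
    (Subalgebra.smul_mem _ (mono_mem_latticeAlg h) _)

/-- The constant coefficient is k - (k - k⁻¹) = k⁻¹. This makes the normalising factor n = kD - N of
the intertwiner invertible in the fraction field. -/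
theorem smul_den_sub_num_ne_zero (hv : v ≠ 0) : (k : F) • den F v - num v k u ≠ 0 := by
  intro h
  have h2 : (2 : ℤ) • v ≠ 0 := by
    have h : ((2 : ℤ) • v) = (2 : ℝ) • v := by module
    rw [h]
    exact smul_ne_zero two_ne_zero hv
  have h1 := congrArg (fun p => AddMonoidAlgebra.coeff p 0) h
  simp only [den, num, mono, AddMonoidAlgebra.one_def, AddMonoidAlgebra.coeff_sub,
    AddMonoidAlgebra.coeff_smul, AddMonoidAlgebra.coeff_add, AddMonoidAlgebra.coeff_single,
    Finsupp.sub_apply, Finsupp.add_apply, Finsupp.smul_apply, Finsupp.single_eq_same,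
    Finsupp.single_eq_of_ne' hv, Finsupp.single_eq_of_ne' h2, AddMonoidAlgebra.coeff_zero,
    Finsupp.zero_apply] at h1
  simp at h1

/-- The intertwiner of a truncated Demazure-Lusztig operator, over the group algebra of a stable
lattice. -/
noncomputable def latticeInter (hv : α v = 2) (hΛ : v ∈ Λ)
    (h : ∀ μ ∈ Λ, ∃ n : ℤ, α μ = n ∧ (Even n ∨ k = u)) :
    Intertwiner (latticeAlg F Λ) (AddMonoidAlgebra F E) where
  σ := (AlgHom.codRestrict ((reflHom F α v).comp (latticeAlg F Λ).val) (latticeAlg F Λ)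
    fun r => reflHom_mem (fun μ hμ => by
      obtain ⟨n, hn, -⟩ := h μ hμ
      rw [hn, Int.cast_smul_eq_zsmul]
      exact sub_mem hμ (zsmul_mem hΛ n)) r.2).toRingHom
  I := (inter α v k u).toAddMonoidHom
  n := ⟨(k : F) • den F v - num v k u, sub_mem (Subalgebra.smul_mem _ (den_mem hΛ) _)
    (num_mem k u hΛ)⟩
  invol r := Subtype.ext (reflHom_reflHom hv r.1)
  smul r a := inter_mul_of_mem k u h r.2 a
  sq a := by
    refine (inter_inter k u hv a).trans ?_
    change _ = ((k : F) • den F v - num v k u) *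
      reflHom F α v ((k : F) • den F v - num v k u) * a
    -- The product (kD - N)·s(kD - N) is k²D s(D) - k(k - k⁻¹)D s(D) + N s(N), which is the known
    -- square D s(D) + N s(N).
    have key := num_mul_refl_den (F := F) (k := k) (u := u) hv
    have hk : (k : F) * ((k⁻¹ : Fˣ) : F) = 1 := by simp
    have hk' := congrArg (algebraMap F (AddMonoidAlgebra F E)) hk
    rw [map_mul, map_one] at hk'
    rw [map_sub, map_smul]
    simp only [Algebra.smul_def, map_sub] at *
    linear_combination -(den F v * reflHom F α v (den F v)) * a * hk' 
      + algebraMap F (AddMonoidAlgebra F E) k * a * key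
  ne_zero := fun h0 => smul_den_sub_num_ne_zero k u (ne_zero_of_apply_eq_two hv)
    (congrArg Subtype.val h0)

variable (hv : α v = 2) (hΛ : v ∈ Λ) (h : ∀ μ ∈ Λ, ∃ n : ℤ, α μ = n ∧ (Even n ∨ k = u))

/-- The image of a quasi-monomial in the fraction field. -/
noncomputable def fracMono (F : Type*) [Field F] (Λ : AddSubgroup E) (μ : Λ) :
    FractionRing (latticeAlg F Λ) :=
  algebraMap _ _ (latticeMono F μ)

/-- The image of a constant in the fraction field. -/
noncomputable def fracConst (F : Type*) [Field F] (Λ : AddSubgroup E) :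
    F →+* FractionRing (latticeAlg F Λ) :=
  (algebraMap (latticeAlg F Λ) _).comp (algebraMap F (latticeAlg F Λ))

theorem fracMono_add (μ ν : Λ) : fracMono F Λ (μ + ν) = fracMono F Λ μ * fracMono F Λ ν := by
  rw [fracMono, fracMono, fracMono, ← map_mul]
  congr 1
  exact Subtype.ext (mono_mul _ _).symm

theorem fracMono_zero : fracMono F Λ 0 = 1 := by
  rw [fracMono, ← map_one (algebraMap (latticeAlg F Λ) _)]
  rfl

theorem one_sub_fracMono_ne_zero {μ : Λ} (hμ : (μ : E) ≠ 0) : 1 - fracMono F Λ μ ≠ 0 := by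
  rw [fracMono, ← map_one (algebraMap (latticeAlg F Λ) _), ← map_sub, Ne,
    IsFractionRing.to_map_eq_zero_iff]
  exact fun h => one_sub_mono_ne_zero (F := F) hμ (congrArg Subtype.val h)

theorem fracσ_const (c : F) :
    (latticeInter k u hv hΛ h).fracσ (fracConst F Λ c) = fracConst F Λ c := by
  rw [fracConst, RingHom.comp_apply, Intertwiner.fracσ_algebraMap]
  congr 1
  exact Subtype.ext (AlgHom.commutes (reflHom F α v) c)

theorem fracσ_mono (μ ν : Λ) (hμ : (ν : E) = μ - α μ • v) :
    (latticeInter k u hv hΛ h).fracσ (fracMono F Λ μ) = fracMono F Λ ν := by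
  rw [fracMono, Intertwiner.fracσ_algebraMap, fracMono]
  congr 1
  refine Subtype.ext ?_
  change reflHom F α v (mono F (μ : E)) = mono F (ν : E)
  rw [reflHom_mono, hμ]

/-- The rational function `(k - k⁻¹ + (u - u⁻¹) x^v) / (1 - x^{2 v})`. -/
noncomputable def fracE (k u : Fˣ) (v : Λ) : FractionRing (latticeAlg F Λ) :=
  (fracConst F Λ (k - (k⁻¹ : Fˣ)) + fracConst F Λ (u - (u⁻¹ : Fˣ)) * fracMono F Λ v)
    / (1 - fracMono F Λ v ^ 2)

theorem one_tmul_tdl (a : AddMonoidAlgebra F E) :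
    (1 : FractionRing (latticeAlg F Λ)) ⊗ₜ[latticeAlg F Λ] tdl α v k u a =
      fracE k u ⟨v, hΛ⟩ • (1 : FractionRing (latticeAlg F Λ)) ⊗ₜ[latticeAlg F Λ] a +
      (fracConst F Λ k - fracE k u ⟨v, hΛ⟩) • (latticeInter k u hv hΛ h).ext
        ((1 : FractionRing (latticeAlg F Λ)) ⊗ₜ[latticeAlg F Λ] a) := by
  have h1 := (latticeInter k u hv hΛ h).one_tmul_eq (T := (tdl α v k u).toAddMonoidHom)
    (d := ⟨den F v, den_mem hΛ⟩) (h := ⟨num v k u, num_mem k u hΛ⟩)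
    (k := algebraMap F (latticeAlg F Λ) k)
    (fun h0 => den_ne_zero (F := F) (ne_zero_of_apply_eq_two hv) (congrArg Subtype.val h0))
    (Subtype.ext (by
      change (k : F) • den F v - num v k u = algebraMap F (AddMonoidAlgebra F E) k * den F v - _
      rw [Algebra.smul_def]))
    (fun a => by
      change den F v * tdl α v k u a = inter α v k u a + num v k u * a
      rw [inter_apply]; ring) a
  have h2 : algebraMap (latticeAlg F Λ) (FractionRing (latticeAlg F Λ))
      ⟨num v k u, num_mem k u hΛ⟩ / algebraMap (latticeAlg F Λ) (FractionRing (latticeAlg F Λ))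
      ⟨den F v, den_mem hΛ⟩ = fracE k u ⟨v, hΛ⟩ := by
    rw [fracE]
    congr 1
    · rw [fracMono, fracConst, RingHom.comp_apply, RingHom.comp_apply, ← map_mul, ← map_add]
      congr 1
      refine Subtype.ext ?_
      change num v k u = algebraMap F (AddMonoidAlgebra F E) _
        + algebraMap F (AddMonoidAlgebra F E) _ * mono F v
      rw [num, Algebra.smul_def, Algebra.smul_def, mul_one]
    · rw [fracMono, ← map_pow, ← map_one (algebraMap (latticeAlg F Λ) _), ← map_sub]
      congr 1
      refine Subtype.ext ?_
      change den F v = 1 - mono F v ^ 2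
      rw [den, two_smul, sq, mono_mul]
  rw [h2] at h1
  exact h1

end LatticeAlgebra

/-! ### Rank-two root data and their model over the fraction field. -/

open scoped TensorProduct

/-- Two functionals and two vectors spanning a root system of rank two with Cartan integers
`-p` and `-q`. -/
structure RankTwo (E : Type*) [AddCommGroup E] [Module ℝ E] (p q : ℕ) where
  α : E →ₗ[ℝ] ℝ
  β : E →ₗ[ℝ] ℝ
  v : E
  w : E
  αv : α v = 2
  βw : β w = 2
  αw : α w = -p
  βv : β v = -q

namespace RankTwo

variable {F E : Type*} [Field F] [AddCommGroup E] [Module ℝ E] {p q : ℕ} (R : RankTwo E p q)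

/-- The lattice spanned by the two co-roots. -/
def lattice : AddSubgroup E := AddSubgroup.closure {R.v, R.w}

theorem v_mem : R.v ∈ R.lattice := AddSubgroup.subset_closure (by simp)

theorem w_mem : R.w ∈ R.lattice := AddSubgroup.subset_closure (by simp)

theorem mem_lattice {μ : E} : μ ∈ R.lattice ↔ ∃ s t : ℤ, s • R.v + t • R.w = μ :=
  AddSubgroup.mem_closure_pair

theorem α_apply (s t : ℤ) : R.α (s • R.v + t • R.w) = 2 * s - p * t := by
  rw [map_add, map_zsmul, map_zsmul, R.αv, R.αw, zsmul_eq_mul, zsmul_eq_mul]; ring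

theorem β_apply (s t : ℤ) : R.β (s • R.v + t • R.w) = 2 * t - q * s := by
  rw [map_add, map_zsmul, map_zsmul, R.βv, R.βw, zsmul_eq_mul, zsmul_eq_mul]; ring

theorem α_lattice {k u : Fˣ} (hp : Even p ∨ k = u) :
    ∀ μ ∈ R.lattice, ∃ n : ℤ, R.α μ = n ∧ (Even n ∨ k = u) := by
  intro μ hμ
  obtain ⟨s, t, rfl⟩ := R.mem_lattice.mp hμ
  refine ⟨2 * s - p * t, by rw [α_apply]; push_cast; ring, hp.imp_left fun h => ?_⟩
  exact (even_two_mul s).sub (((Int.even_coe_nat p).mpr h).mul_right t)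

theorem β_lattice {k u : Fˣ} (hq : Even q ∨ k = u) :
    ∀ μ ∈ R.lattice, ∃ n : ℤ, R.β μ = n ∧ (Even n ∨ k = u) := by
  intro μ hμ
  obtain ⟨s, t, rfl⟩ := R.mem_lattice.mp hμ
  refine ⟨2 * t - q * s, by rw [β_apply]; push_cast; ring, hq.imp_left fun h => ?_⟩
  exact (even_two_mul t).sub (((Int.even_coe_nat q).mpr h).mul_right s)

/-- The element `s v + t w` of the lattice. -/
def point (s t : ℤ) : R.lattice := ⟨s • R.v + t • R.w, R.mem_lattice.mpr ⟨s, t, rfl⟩⟩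

/-- The field over which the braid relations are compared. -/
abbrev Frac (F : Type*) [Field F] := FractionRing (latticeAlg F R.lattice)

/-- The quasi-polynomials, with scalars extended to the field `Frac`. -/
abbrev Mod (F : Type*) [Field F] := R.Frac F ⊗[latticeAlg F R.lattice] AddMonoidAlgebra F E

/-- The image of `x^{s v + t w}` in the field `Frac`. -/
noncomputable def fmono (F : Type*) [Field F] (s t : ℤ) : R.Frac F :=
  fracMono F R.lattice (R.point s t)

/-- The constants of the field `Frac`. -/
noncomputable def const (F : Type*) [Field F] : F →+* R.Frac F := fracConst F R.lattice

theorem fmono_mul (s t s' t' : ℤ) :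
    R.fmono F s t * R.fmono F s' t' = R.fmono F (s + s') (t + t') := by
  rw [fmono, fmono, fmono, ← fracMono_add]
  congr 1
  refine Subtype.ext ?_
  change s • R.v + t • R.w + (s' • R.v + t' • R.w) = (s + s') • R.v + (t + t') • R.w
  module

theorem fmono_zero : R.fmono F 0 0 = 1 := by
  rw [fmono, ← fracMono_zero]
  congr 1
  refine Subtype.ext ?_
  change (0 : ℤ) • R.v + (0 : ℤ) • R.w = 0
  module

/-- The Cartan determinant 4 - pq is nonzero, so the two co-roots are independent and all
denominators 1 - x^γ are invertible. -/
theorem one_sub_fmono_ne_zero (hpq : p * q < 4) {s t : ℤ} (h : s ≠ 0 ∨ t ≠ 0) :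
    1 - R.fmono F s t ≠ 0 := by
  apply one_sub_fracMono_ne_zero
  intro h0
  change s • R.v + t • R.w = 0 at h0
  have h1 := R.α_apply s t
  have h2 := R.β_apply s t
  rw [h0, map_zero] at h1 h2
  have h1' : (0 : ℤ) = 2 * s - p * t := by exact_mod_cast h1
  have h2' : (0 : ℤ) = 2 * t - q * s := by exact_mod_cast h2
  have h3 : ((4 : ℤ) - p * q) * s = 0 := by linear_combination -2 * h1' - p * h2'
  have h4 : ((4 : ℤ) - p * q) * t = 0 := by linear_combination -2 * h2' - q * h1'
  have h5 : ((4 : ℤ) - p * q) ≠ 0 := by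
    have : ((p * q : ℕ) : ℤ) < 4 := by exact_mod_cast hpq
    push_cast at this
    omega
  rcases h with h | h
  · exact h ((mul_eq_zero.mp h3).resolve_left h5)
  · exact h ((mul_eq_zero.mp h4).resolve_left h5)

variable {k₁ u₁ k₂ u₂ : Fˣ} (hp : Even p ∨ k₁ = u₁) (hq : Even q ∨ k₂ = u₂)

/-- The pair of normalised intertwiners. -/
noncomputable def pair : SkewPair (R.Frac F) (R.Mod F) where
  σ₁ := (latticeInter k₁ u₁ R.αv R.v_mem (R.α_lattice hp)).fracσ
  σ₂ := (latticeInter k₂ u₂ R.βw R.w_mem (R.β_lattice hq)).fracσ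
  S₁ := (latticeInter k₁ u₁ R.αv R.v_mem (R.α_lattice hp)).ext
  S₂ := (latticeInter k₂ u₂ R.βw R.w_mem (R.β_lattice hq)).ext
  smul₁ := Intertwiner.ext_smul _
  smul₂ := Intertwiner.ext_smul _
  inv₁ := Intertwiner.ext_ext _
  inv₂ := Intertwiner.ext_ext _

theorem σ₁_const (c : F) : (R.pair hp hq).σ₁ (R.const F c) = R.const F c :=
  fracσ_const _ _ _ _ _ c

theorem σ₂_const (c : F) : (R.pair hp hq).σ₂ (R.const F c) = R.const F c :=
  fracσ_const _ _ _ _ _ c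

theorem σ₁_fmono (s t : ℤ) :
    (R.pair hp hq).σ₁ (R.fmono F s t) = R.fmono F (p * t - s) t := by
  refine fracσ_mono _ _ _ _ _ _ _ ?_
  change ((p * t - s : ℤ) • R.v + t • R.w) = s • R.v + t • R.w - R.α (s • R.v + t • R.w) • R.v
  rw [α_apply, ← Int.cast_smul_eq_zsmul ℝ, ← Int.cast_smul_eq_zsmul ℝ, ← Int.cast_smul_eq_zsmul ℝ]
  push_cast
  module

theorem σ₂_fmono (s t : ℤ) :
    (R.pair hp hq).σ₂ (R.fmono F s t) = R.fmono F s (q * s - t) := by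
  refine fracσ_mono _ _ _ _ _ _ _ ?_
  change (s • R.v + (q * s - t : ℤ) • R.w) = s • R.v + t • R.w - R.β (s • R.v + t • R.w) • R.w
  rw [β_apply, ← Int.cast_smul_eq_zsmul ℝ, ← Int.cast_smul_eq_zsmul ℝ, ← Int.cast_smul_eq_zsmul ℝ]
  push_cast
  module

/-- The inclusion of the quasi-polynomials in `Mod`. -/
noncomputable def incl (F : Type*) [Field F] : AddMonoidAlgebra F E →+ R.Mod F :=
  (TensorProduct.mk (latticeAlg F R.lattice) (R.Frac F) (AddMonoidAlgebra F E) 1).toAddMonoidHom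

theorem incl_injective {a : AddMonoidAlgebra F E} (h : R.incl F a = 0) : a = 0 :=
  one_tmul_injective (fun r a h => by
    have h1 : (r : AddMonoidAlgebra F E) * a = 0 := h
    exact (mul_eq_zero.mp h1).imp_left fun h => Subtype.ext h) h

theorem incl_mono_mul (s t : ℤ) (a : AddMonoidAlgebra F E) :
    R.incl F (mono F (s • R.v + t • R.w) * a) = R.fmono F s t • R.incl F a := by
  change (1 : R.Frac F) ⊗ₜ (latticeMono F (R.point s t) • a) = _
  rw [← TensorProduct.smul_tmul, Algebra.smul_def]
  rfl

theorem incl_tdl₁ (a : AddMonoidAlgebra F E) :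
    R.incl F (tdl R.α R.v k₁ u₁ a) = fracE k₁ u₁ (R.point 1 0) • R.incl F a +
      (R.const F k₁ - fracE k₁ u₁ (R.point 1 0)) • (R.pair hp hq).S₁ (R.incl F a) := by
  have h := one_tmul_tdl k₁ u₁ R.αv R.v_mem (R.α_lattice hp) a
  have h2 : R.point 1 0 = ⟨R.v, R.v_mem⟩ := Subtype.ext (by
    change (1 : ℤ) • R.v + (0 : ℤ) • R.w = R.v
    module)
  rw [← h2] at h
  exact h

theorem incl_tdl₂ (a : AddMonoidAlgebra F E) :
    R.incl F (tdl R.β R.w k₂ u₂ a) = fracE k₂ u₂ (R.point 0 1) • R.incl F a +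
      (R.const F k₂ - fracE k₂ u₂ (R.point 0 1)) • (R.pair hp hq).S₂ (R.incl F a) := by
  have h := one_tmul_tdl k₂ u₂ R.βw R.w_mem (R.β_lattice hq) a
  have h2 : R.point 0 1 = ⟨R.w, R.w_mem⟩ := Subtype.ext (by
    change (0 : ℤ) • R.v + (1 : ℤ) • R.w = R.w
    module)
  rw [← h2] at h
  exact h

/-- A vector space over a field with two semilinear involutions in which the quasi-polynomials
embed, such that the truncated Demazure-Lusztig operators become Demazure-Lusztig operators. -/
structure Model (k₁ u₁ k₂ u₂ : Fˣ) (K M : Type*) [Field K] [AddCommGroup M] [Module K M] extends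
    SkewPair K M where
  c : F →+* K
  x : ℤ → ℤ → K
  incl : AddMonoidAlgebra F E →+ M
  x_mul : ∀ s t s' t', x s t * x s' t' = x (s + s') (t + t')
  x_zero : x 0 0 = 1
  one_sub_x_ne_zero : ∀ s t, s ≠ 0 ∨ t ≠ 0 → 1 - x s t ≠ 0
  σ₁_c : ∀ a, σ₁ (c a) = c a
  σ₂_c : ∀ a, σ₂ (c a) = c a
  σ₁_x : ∀ s t, σ₁ (x s t) = x (p * t - s) t
  σ₂_x : ∀ s t, σ₂ (x s t) = x s (q * s - t)
  incl_injective : ∀ a, incl a = 0 → a = 0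
  incl_mono_mul : ∀ (s t : ℤ) a, incl (mono F (s • R.v + t • R.w) * a) = x s t • incl a
  incl_tdl₁ : ∀ a, incl (tdl R.α R.v k₁ u₁ a) =
    ((c (k₁ - (k₁⁻¹ : Fˣ)) + c (u₁ - (u₁⁻¹ : Fˣ)) * x 1 0) / (1 - x 1 0 ^ 2)) • incl a +
      (c k₁ - (c (k₁ - (k₁⁻¹ : Fˣ)) + c (u₁ - (u₁⁻¹ : Fˣ)) * x 1 0) / (1 - x 1 0 ^ 2)) •
        S₁ (incl a)
  incl_tdl₂ : ∀ a, incl (tdl R.β R.w k₂ u₂ a) =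
    ((c (k₂ - (k₂⁻¹ : Fˣ)) + c (u₂ - (u₂⁻¹ : Fˣ)) * x 0 1) / (1 - x 0 1 ^ 2)) • incl a +
      (c k₂ - (c (k₂ - (k₂⁻¹ : Fˣ)) + c (u₂ - (u₂⁻¹ : Fˣ)) * x 0 1) / (1 - x 0 1 ^ 2)) •
        S₂ (incl a)

/-- The model given by extension of scalars to the field of fractions of the group algebra of the
lattice. -/
noncomputable def model (hpq : p * q < 4) : R.Model k₁ u₁ k₂ u₂ (R.Frac F) (R.Mod F) where
  toSkewPair := R.pair hp hq
  c := R.const F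
  x := R.fmono F
  incl := R.incl F
  x_mul := R.fmono_mul
  x_zero := R.fmono_zero
  one_sub_x_ne_zero _ _ := R.one_sub_fmono_ne_zero hpq
  σ₁_c := R.σ₁_const hp hq
  σ₂_c := R.σ₂_const hp hq
  σ₁_x := R.σ₁_fmono hp hq
  σ₂_x := R.σ₂_fmono hp hq
  incl_injective _ := R.incl_injective
  incl_mono_mul := R.incl_mono_mul
  incl_tdl₁ := R.incl_tdl₁ hp hq
  incl_tdl₂ := R.incl_tdl₂ hp hq

end RankTwo

end QuasiPoly

/-! ### Semilinearity of the braid defect over the lattice. -/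

namespace QuasiPoly
namespace RankTwo

variable {F E : Type*} [Field F] [AddCommGroup E] [Module ℝ E]

/-- Passing to the negative co-root replaces e by a - e; this and its two-parameter form supply the
hypotheses on σᵢ eᵢ in the defect formulas. -/
theorem quot_inv {K : Type*} [Field K] (a : K) {y : K} (hy : y ≠ 0) (h : 1 - y ≠ 0) :
    a / (1 - y⁻¹) = a - a / (1 - y) := by
  have h1 : 1 - y⁻¹ = -(1 - y) / y := by
    field_simp
    ring
  rw [h1]
  field_simp
  ring

theorem quot_sq_inv {K : Type*} [Field K] (b c : K) {y : K} (hy : y ≠ 0) (h : 1 - y ^ 2 ≠ 0) :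
    (b + c * y⁻¹) / (1 - y⁻¹ ^ 2) = b - (b + c * y) / (1 - y ^ 2) := by
  have h1 : 1 - y⁻¹ ^ 2 = -(1 - y ^ 2) / y ^ 2 := by
    field_simp
    ring
  rw [h1]
  field_simp
  ring

namespace Model

variable {p q : ℕ} {R : RankTwo E p q} {k₁ u₁ k₂ u₂ : Fˣ} {K M : Type*} [Field K]
  [AddCommGroup M] [Module K M] (Q : R.Model k₁ u₁ k₂ u₂ K M)

theorem x_ne_zero (s t : ℤ) : Q.x s t ≠ 0 := by
  intro h
  have := Q.x_mul s t (-s) (-t)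
  rw [h, zero_mul, add_neg_cancel, add_neg_cancel, Q.x_zero] at this
  exact zero_ne_one this

theorem x_neg (s t : ℤ) : Q.x (-s) (-t) = (Q.x s t)⁻¹ := by
  apply eq_inv_of_mul_eq_one_left
  rw [Q.x_mul, neg_add_cancel, neg_add_cancel, Q.x_zero]

theorem x_eq (s t : ℕ) : Q.x s t = Q.x 1 0 ^ s * Q.x 0 1 ^ t := by
  induction s with
  | zero =>
    induction t with
    | zero => simp [Q.x_zero]
    | succ t ih =>
      rw [pow_succ, ← mul_assoc, ← ih, Q.x_mul]; simp
  | succ s ih => rw [pow_succ, mul_right_comm, ← ih, Q.x_mul]; simp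

theorem x_neg_one_zero : Q.x (-1) 0 = (Q.x 1 0)⁻¹ := by rw [← x_neg]; norm_num

theorem x_zero_neg_one : Q.x 0 (-1) = (Q.x 0 1)⁻¹ := by rw [← x_neg]; norm_num

theorem σ₁_quot (a : F) (s t : ℤ) : Q.σ₁ (Q.c a / (1 - Q.x s t)) =
    Q.c a / (1 - Q.x (p * t - s) t) := by
  rw [map_div₀, map_sub Q.σ₁, map_one, Q.σ₁_x, Q.σ₁_c]

theorem σ₁_quot_sq (a b : F) (s t : ℤ) :
    Q.σ₁ ((Q.c a + Q.c b * Q.x s t) / (1 - Q.x s t ^ 2)) =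
      (Q.c a + Q.c b * Q.x (p * t - s) t) / (1 - Q.x (p * t - s) t ^ 2) := by
  rw [map_div₀, map_add, map_mul, map_sub Q.σ₁, map_one, map_pow, Q.σ₁_x, Q.σ₁_c, Q.σ₁_c]

theorem σ₂_quot (a : F) (s t : ℤ) : Q.σ₂ (Q.c a / (1 - Q.x s t)) =
    Q.c a / (1 - Q.x s (q * s - t)) := by
  rw [map_div₀, map_sub Q.σ₂, map_one, Q.σ₂_x, Q.σ₂_c]

theorem σ₂_quot_sq (a b : F) (s t : ℤ) :
    Q.σ₂ ((Q.c a + Q.c b * Q.x s t) / (1 - Q.x s t ^ 2)) =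
      (Q.c a + Q.c b * Q.x s (q * s - t)) / (1 - Q.x s (q * s - t) ^ 2) := by
  rw [map_div₀, map_add, map_mul, map_sub Q.σ₂, map_one, map_pow, Q.σ₂_x, Q.σ₂_c, Q.σ₂_c]

theorem quotient_self (k : Fˣ) {s t : ℤ} (h : s ≠ 0 ∨ t ≠ 0) :
    (Q.c (k - (k⁻¹ : Fˣ)) + Q.c (k - (k⁻¹ : Fˣ)) * Q.x s t) / (1 - Q.x s t ^ 2)
      = Q.c (k - (k⁻¹ : Fˣ)) / (1 - Q.x s t) := by
  have h1 := Q.one_sub_x_ne_zero s t h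
  have h2 : 1 - Q.x s t ^ 2 ≠ 0 := by
    rw [sq, x_mul]
    exact Q.one_sub_x_ne_zero _ _ (h.imp (by omega) (by omega))
  field_simp
  ring

theorem c_sq (k : Fˣ) : Q.c k ^ 2 = Q.c (k - (k⁻¹ : Fˣ)) * Q.c k + 1 := by
  have hk : (k : F) * ((k⁻¹ : Fˣ) : F) = 1 := by simp
  rw [← map_pow, ← map_mul, ← map_one Q.c, ← map_add]
  congr 1
  linear_combination hk

/-- The operator `e + (k - e) S`. -/
noncomputable def op (e k : K) (S : M →+ M) : M →+ M :=
  DistribSMul.toAddMonoidHom _ e + (DistribSMul.toAddMonoidHom _ (k - e)).comp S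

theorem op_apply (e k : K) (S : M →+ M) (m : M) : op e k S m = e • m + (k - e) • S m := rfl

/-- A defect of the form `C (W - W')`, for two words in the intertwiners that act in the same way on
the lattice, commutes with the lattice up to the action of that word. -/
theorem defect_semilinear {D : Module.End F (AddMonoidAlgebra F E)} {W W' : M → M} {f g : ℤ → ℤ → ℤ}
    (hW : ∀ s t m, W (Q.x s t • m) = Q.x (f s t) (g s t) • W m)
    (hW' : ∀ s t m, W' (Q.x s t • m) = Q.x (f s t) (g s t) • W' m)
    (hD : ∃ C : K, ∀ a, Q.incl (D a) = C • (W (Q.incl a) - W' (Q.incl a))) :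
    ∀ μ ∈ R.lattice, ∃ ν : E, ∀ a, D (mono F μ * a) = mono F ν * D a := by
  intro μ hμ
  obtain ⟨C, hD⟩ := hD
  obtain ⟨s, t, rfl⟩ := R.mem_lattice.mp hμ
  refine ⟨f s t • R.v + g s t • R.w, fun a => ?_⟩
  rw [← sub_eq_zero]
  apply Q.incl_injective
  rw [map_sub, hD, Q.incl_mono_mul, Q.incl_mono_mul, hD, hW, hW', ← smul_sub, smul_comm, sub_self]


theorem incl_tdl₁_self {k : Fˣ} (Q : R.Model k k k₂ u₂ K M) (a : AddMonoidAlgebra F E) :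
    Q.incl (tdl R.α R.v k k a) = (Q.c (k - (k⁻¹ : Fˣ)) / (1 - Q.x 1 0)) • Q.incl a +
      (Q.c k - Q.c (k - (k⁻¹ : Fˣ)) / (1 - Q.x 1 0)) • Q.S₁ (Q.incl a) := by
  rw [Q.incl_tdl₁, Q.quotient_self k (Or.inl one_ne_zero)]

theorem incl_tdl₂_self {k : Fˣ} (Q : R.Model k₁ u₁ k k K M) (a : AddMonoidAlgebra F E) :
    Q.incl (tdl R.β R.w k k a) = (Q.c (k - (k⁻¹ : Fˣ)) / (1 - Q.x 0 1)) • Q.incl a +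
      (Q.c k - Q.c (k - (k⁻¹ : Fˣ)) / (1 - Q.x 0 1)) • Q.S₂ (Q.incl a) := by
  rw [Q.incl_tdl₂, Q.quotient_self k (Or.inr one_ne_zero)]

/-- Both words in the involutions represent the longest element w₀ of the finite Weyl group, so they
act on the lattice alike; `f` and `g` are the coordinates of w₀(s v + t w). This is -1 except in
type A₂, where v and w are exchanged as well. -/
theorem semilinear_A1A1 {R : RankTwo E 0 0} (Q : R.Model k₁ u₁ k₂ u₂ K M) :
    ∀ μ ∈ R.lattice, ∃ ν : E, ∀ a : AddMonoidAlgebra F E,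
      (tdl R.α R.v k₁ u₁ * tdl R.β R.w k₂ u₂ - tdl R.β R.w k₂ u₂ * tdl R.α R.v k₁ u₁) (mono F μ * a)
      = mono F ν *
        (tdl R.α R.v k₁ u₁ * tdl R.β R.w k₂ u₂ - tdl R.β R.w k₂ u₂ * tdl R.α R.v k₁ u₁) a := by
  refine Q.defect_semilinear (W := fun m => Q.S₁ (Q.S₂ m)) (W' := fun m => Q.S₂ (Q.S₁ m))
    (f := fun s t => -s) (g := fun s t => -t) (fun s t m => ?_) (fun s t m => ?_) ?_
  · simp only [Q.smul₁, Q.smul₂, Q.σ₁_x, Q.σ₂_x]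
    congr 2 <;> push_cast <;> ring
  · simp only [Q.smul₁, Q.smul₂, Q.σ₁_x, Q.σ₂_x]
    congr 2 <;> push_cast <;> ring
  -- The constant is left open and is read off from the defect formula.
  · apply Exists.intro
    intro a
    have h := Q.defect_A1A1 (k := Q.c k₁) (l := Q.c k₂)
      (e₁ := (Q.c (k₁ - (k₁⁻¹ : Fˣ)) + Q.c (u₁ - (u₁⁻¹ : Fˣ)) * Q.x 1 0) / (1 - Q.x 1 0 ^ 2))
      (e₂ := (Q.c (k₂ - (k₂⁻¹ : Fˣ)) + Q.c (u₂ - (u₂⁻¹ : Fˣ)) * Q.x 0 1) / (1 - Q.x 0 1 ^ 2))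
      (Q.σ₂_c k₁) (Q.σ₁_c k₂)
      (by
        rw [Q.σ₂_quot_sq]
        norm_num)
      (by
        rw [Q.σ₁_quot_sq]
        norm_num)
      (op_apply _ _ Q.S₁) (op_apply _ _ Q.S₂) (Q.incl a)
    simp only [op_apply _ _ Q.S₁ (Q.incl _), op_apply _ _ Q.S₂ (Q.incl _),
      ← Q.incl_tdl₁, ← Q.incl_tdl₂] at h
    rw [← h, ← map_sub]
    rfl

theorem semilinear_A2 {R : RankTwo E 1 1} {k : Fˣ} (Q : R.Model k k k k K M) :
    ∀ μ ∈ R.lattice, ∃ ν : E, ∀ a : AddMonoidAlgebra F E,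
      (tdl R.α R.v k k * tdl R.β R.w k k * tdl R.α R.v k k -
        tdl R.β R.w k k * tdl R.α R.v k k * tdl R.β R.w k k) (mono F μ * a)
      = mono F ν * (tdl R.α R.v k k * tdl R.β R.w k k * tdl R.α R.v k k -
        tdl R.β R.w k k * tdl R.α R.v k k * tdl R.β R.w k k) a := by
  refine Q.defect_semilinear (W := fun m => Q.S₁ (Q.S₂ (Q.S₁ m)))
    (W' := fun m => Q.S₂ (Q.S₁ (Q.S₂ m)))
    (f := fun s t => -t) (g := fun s t => -s) (fun s t m => ?_) (fun s t m => ?_) ?_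
  · simp only [Q.smul₁, Q.smul₂, Q.σ₁_x, Q.σ₂_x]
    congr 2 <;> push_cast <;> ring
  · simp only [Q.smul₁, Q.smul₂, Q.σ₁_x, Q.σ₂_x]
    congr 2 <;> push_cast <;> ring
  have n₁ := Q.one_sub_x_ne_zero 1 0 (by norm_num)
  have n₂ := Q.one_sub_x_ne_zero 0 1 (by norm_num)
  have n₃ := Q.one_sub_x_ne_zero 1 1 (by norm_num)
  have x₁ := Q.x_ne_zero 1 0
  have x₂ := Q.x_ne_zero 0 1
  have x₃ : Q.x 1 1 = Q.x 1 0 * Q.x 0 1 := by rw [Q.x_mul]; norm_num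
  apply Exists.intro
  intro a
  have h := Q.defect_A2 (k := Q.c k) (a := Q.c (k - (k⁻¹ : Fˣ)))
      (e₁ := Q.c (k - (k⁻¹ : Fˣ)) / (1 - Q.x 1 0))
      (e₂ := Q.c (k - (k⁻¹ : Fˣ)) / (1 - Q.x 0 1))
      (e₃ := Q.c (k - (k⁻¹ : Fˣ)) / (1 - Q.x 1 1)) (Q.σ₁_c k) (Q.σ₂_c k)
      (by
        rw [Q.σ₁_quot]
        norm_num only [mul_zero, zero_sub, Q.x_neg_one_zero]
        exact quot_inv _ x₁ n₁)
      (by rw [Q.σ₁_quot]; norm_num)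
      (by rw [Q.σ₁_quot]; norm_num)
      (by rw [Q.σ₂_quot]; norm_num)
      (by
        rw [Q.σ₂_quot]
        norm_num only [mul_zero, zero_sub, Q.x_zero_neg_one]
        exact quot_inv _ x₂ n₂)
      (by rw [Q.σ₂_quot]; norm_num)
      (by rw [x₃] at n₃ ⊢; field_simp; ring)
      (op_apply _ _ Q.S₁) (op_apply _ _ Q.S₂) (Q.incl a)
  simp only [op_apply _ _ Q.S₁ (Q.incl _), op_apply _ _ Q.S₂ (Q.incl _),
      ← Q.incl_tdl₁_self, ← Q.incl_tdl₂_self] at h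
  rw [← h, ← map_sub]
  rfl

theorem semilinear_B2 {R : RankTwo E 1 2} {k : Fˣ} (Q : R.Model k k k₂ u₂ K M) :
    ∀ μ ∈ R.lattice, ∃ ν : E, ∀ a : AddMonoidAlgebra F E,
      (tdl R.α R.v k k * tdl R.β R.w k₂ u₂ * tdl R.α R.v k k * tdl R.β R.w k₂ u₂ -
        tdl R.β R.w k₂ u₂ * tdl R.α R.v k k * tdl R.β R.w k₂ u₂ * tdl R.α R.v k k) (mono F μ * a)
      = mono F ν * (tdl R.α R.v k k * tdl R.β R.w k₂ u₂ * tdl R.α R.v k k * tdl R.β R.w k₂ u₂ -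
        tdl R.β R.w k₂ u₂ * tdl R.α R.v k k * tdl R.β R.w k₂ u₂ * tdl R.α R.v k k) a := by
  refine Q.defect_semilinear (W := fun m => Q.S₁ (Q.S₂ (Q.S₁ (Q.S₂ m))))
    (W' := fun m => Q.S₂ (Q.S₁ (Q.S₂ (Q.S₁ m))))
    (f := fun s t => -s) (g := fun s t => -t) (fun s t m => ?_) (fun s t m => ?_) ?_
  · simp only [Q.smul₁, Q.smul₂, Q.σ₁_x, Q.σ₂_x]
    congr 2 <;> push_cast <;> ring
  · simp only [Q.smul₁, Q.smul₂, Q.σ₁_x, Q.σ₂_x]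
    congr 2 <;> push_cast <;> ring
  have n₁ := Q.one_sub_x_ne_zero 1 0 (by norm_num)
  have n₂ := Q.one_sub_x_ne_zero 0 2 (by norm_num)
  have n₃ := Q.one_sub_x_ne_zero 1 2 (by norm_num)
  have n₄ := Q.one_sub_x_ne_zero 2 2 (by norm_num)
  have x₁ := Q.x_ne_zero 1 0
  have x₂ := Q.x_ne_zero 0 1
  have x₃ := Q.x_eq 1 1
  have x₄ := Q.x_eq 1 2
  have x₅ := Q.x_eq 2 2
  have x₆ := Q.x_eq 0 2
  push_cast at x₃ x₄ x₅ x₆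
  rw [pow_zero, one_mul] at x₆
  rw [pow_one] at x₃ x₄
  rw [pow_one] at x₃
  rw [x₄] at n₃
  rw [x₅] at n₄
  rw [x₆] at n₂
  apply Exists.intro
  intro a
  have h := Q.defect_B2 (k := Q.c k) (a := Q.c (k - (k⁻¹ : Fˣ))) (l := Q.c k₂)
      (b := Q.c (k₂ - (k₂⁻¹ : Fˣ)))
      (e₁ := Q.c (k - (k⁻¹ : Fˣ)) / (1 - Q.x 1 0))
      (e₂ := (Q.c (k₂ - (k₂⁻¹ : Fˣ)) + Q.c (u₂ - (u₂⁻¹ : Fˣ)) * Q.x 0 1) / (1 - Q.x 0 1 ^ 2))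
      (e₃ := Q.c (k - (k⁻¹ : Fˣ)) / (1 - Q.x 1 2))
      (e₄ := (Q.c (k₂ - (k₂⁻¹ : Fˣ)) + Q.c (u₂ - (u₂⁻¹ : Fˣ)) * Q.x 1 1) / (1 - Q.x 1 1 ^ 2))
      (Q.σ₁_c k) (Q.σ₂_c k) (Q.σ₁_c k₂) (Q.σ₂_c k₂) (Q.σ₂_c _) (Q.σ₁_c _) (Q.c_sq k) (Q.c_sq k₂)
      (by
        rw [Q.σ₁_quot]
        norm_num only [mul_zero, zero_sub, Q.x_neg_one_zero]
        exact quot_inv _ x₁ n₁)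
      (by
        rw [Q.σ₁_quot_sq]
        norm_num)
      (by rw [Q.σ₁_quot]; norm_num)
      (by
        rw [Q.σ₁_quot_sq]
        norm_num)
      (by rw [Q.σ₂_quot]; norm_num)
      (by
        rw [Q.σ₂_quot_sq]
        norm_num only [mul_zero, zero_sub, Q.x_zero_neg_one]
        exact quot_sq_inv _ _ x₂ n₂)
      (by rw [Q.σ₂_quot]; norm_num)
      (by
        rw [Q.σ₂_quot_sq]
        norm_num)
      (by
        rw [x₃, x₄, mul_pow]
        field_simp
        ring)
      (op_apply _ _ Q.S₁) (op_apply _ _ Q.S₂) (Q.incl a)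
  simp only [op_apply _ _ Q.S₁ (Q.incl _), op_apply _ _ Q.S₂ (Q.incl _),
      ← Q.incl_tdl₁_self, ← Q.incl_tdl₂] at h
  rw [← h, ← map_sub]
  rfl

theorem semilinear_G2 {R : RankTwo E 1 3} {k l : Fˣ} (Q : R.Model k k l l K M) :
    ∀ μ ∈ R.lattice, ∃ ν : E, ∀ a : AddMonoidAlgebra F E,
      (tdl R.α R.v k k * tdl R.β R.w l l * tdl R.α R.v k k * tdl R.β R.w l l
          * tdl R.α R.v k k * tdl R.β R.w l l -
        tdl R.β R.w l l * tdl R.α R.v k k * tdl R.β R.w l l * tdl R.α R.v k k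
          * tdl R.β R.w l l * tdl R.α R.v k k) (mono F μ * a)
      = mono F ν * (tdl R.α R.v k k * tdl R.β R.w l l * tdl R.α R.v k k * tdl R.β R.w l l
          * tdl R.α R.v k k * tdl R.β R.w l l -
        tdl R.β R.w l l * tdl R.α R.v k k * tdl R.β R.w l l * tdl R.α R.v k k
          * tdl R.β R.w l l * tdl R.α R.v k k) a := by
  refine Q.defect_semilinear (W := fun m => Q.S₁ (Q.S₂ (Q.S₁ (Q.S₂ (Q.S₁ (Q.S₂ m))))))
    (W' := fun m => Q.S₂ (Q.S₁ (Q.S₂ (Q.S₁ (Q.S₂ (Q.S₁ m))))))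
    (f := fun s t => -s) (g := fun s t => -t) (fun s t m => ?_) (fun s t m => ?_) ?_
  · simp only [Q.smul₁, Q.smul₂, Q.σ₁_x, Q.σ₂_x]
    congr 2 <;> push_cast <;> ring
  · simp only [Q.smul₁, Q.smul₂, Q.σ₁_x, Q.σ₂_x]
    congr 2 <;> push_cast <;> ring
  have n₁ := Q.one_sub_x_ne_zero 1 0 (by norm_num)
  have n₂ := Q.one_sub_x_ne_zero 0 1 (by norm_num)
  have n₃ := Q.one_sub_x_ne_zero 1 3 (by norm_num)
  have n₄ := Q.one_sub_x_ne_zero 1 1 (by norm_num)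
  have n₅ := Q.one_sub_x_ne_zero 2 3 (by norm_num)
  have n₆ := Q.one_sub_x_ne_zero 1 2 (by norm_num)
  have x₁ := Q.x_ne_zero 1 0
  have x₂ := Q.x_ne_zero 0 1
  have x₃ := Q.x_eq 1 3
  have x₄ := Q.x_eq 1 1
  have x₅ := Q.x_eq 2 3
  have x₆ := Q.x_eq 1 2
  push_cast at x₃ x₄ x₅ x₆
  rw [pow_one] at x₃ x₄ x₆
  rw [pow_one] at x₄
  have rel := G2Relations.of_inv n₁ n₂ (x₃ ▸ n₃) (x₄ ▸ n₄) (x₅ ▸ n₅) (x₆ ▸ n₆)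
  rw [← x₃, ← x₄, ← x₅, ← x₆] at rel
  apply Exists.intro
  intro a
  have h := Q.defect_G2 (k := Q.c k) (a := Q.c (k - (k⁻¹ : Fˣ))) (l := Q.c l)
      (b := Q.c (l - (l⁻¹ : Fˣ)))
      (Q.σ₁_c _) (Q.σ₂_c _) (Q.σ₁_c _) (Q.σ₂_c _) (Q.σ₁_c _) (Q.σ₂_c _) (Q.σ₁_c _) (Q.σ₂_c _)
      (Q.c_sq k) (Q.c_sq l)
      (by
        rw [map_inv₀, map_sub, map_one, Q.σ₁_x]
        norm_num only [mul_zero, zero_sub, Q.x_neg_one_zero]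
        simpa only [one_div] using quot_inv 1 x₁ n₁)
      (by rw [map_inv₀, map_sub, map_one, Q.σ₁_x]; norm_num)
      (by rw [map_inv₀, map_sub, map_one, Q.σ₁_x]; norm_num)
      (by rw [map_inv₀, map_sub, map_one, Q.σ₁_x]; norm_num)
      (by rw [map_inv₀, map_sub, map_one, Q.σ₁_x]; norm_num)
      (by rw [map_inv₀, map_sub, map_one, Q.σ₁_x]; norm_num)
      (by rw [map_inv₀, map_sub, map_one, Q.σ₂_x]; norm_num)
      (by
        rw [map_inv₀, map_sub, map_one, Q.σ₂_x]
        norm_num only [mul_zero, zero_sub, Q.x_zero_neg_one]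
        simpa only [one_div] using quot_inv 1 x₂ n₂)
      (by rw [map_inv₀, map_sub, map_one, Q.σ₂_x]; norm_num)
      (by rw [map_inv₀, map_sub, map_one, Q.σ₂_x]; norm_num)
      (by rw [map_inv₀, map_sub, map_one, Q.σ₂_x]; norm_num)
      (by rw [map_inv₀, map_sub, map_one, Q.σ₂_x]; norm_num)
      rel (op_apply _ _ Q.S₁) (op_apply _ _ Q.S₂) (Q.incl a)
  simp only [op_apply _ _ Q.S₁ (Q.incl _), op_apply _ _ Q.S₂ (Q.incl _), ← div_eq_mul_inv,
      ← Q.incl_tdl₁_self, ← Q.incl_tdl₂_self] at h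
  rw [← h, ← map_sub]
  rfl

end Model

end RankTwo

/-! ### The kernel of the braid defect, and the braid relations of rank two. -/

variable {F E : Type*} [Field F] [AddCommGroup E] [Module ℝ E]

/-- With a common quadratic equation, c - S = -S⁻¹ and D·T = (c - S)·D. Applied to a braid defect,
where S is the first letter of one word and T the last letter of the other, it makes the kernel
stable under T. -/
theorem exists_mul_eq {A : Type*} [Ring A] [Algebra F A] {c : F} {D S T X : A}
    (hS : S * S = c • S + 1) (hT : T * T = c • T + 1)
    (hD : D = S * X - X * T ∨ D = X * T - S * X) : ∃ U, D * T = U * D := by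
  have h1 : S * (S * X) = c • (S * X) + X := by
    rw [← mul_assoc, hS, add_mul, smul_mul_assoc, one_mul]
  have h2 : X * T * T = c • (X * T) + X := by
    rw [mul_assoc, hT, mul_add, mul_smul_comm, mul_one]
  have h3 : (S * X - X * T) * T = (c • 1 - S) * (S * X - X * T) := by
    rw [sub_mul, sub_mul, mul_sub S, h1, h2, smul_mul_assoc, one_mul, mul_assoc S X T]
    module
  refine ⟨c • 1 - S, ?_⟩
  rcases hD with rfl | rfl
  · exact h3
  · rw [← neg_sub, neg_mul, mul_neg, h3]

theorem tdl_mul_self {α : E →ₗ[ℝ] ℝ} {v : E} (k u : Fˣ) (hv : α v = 2) :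
    tdl α v k u * tdl α v k u = ((k : F) - (k⁻¹ : Fˣ)) • tdl α v k u + 1 :=
  LinearMap.ext fun m => tdl_sq k u hv m

/-- If |α(y)| ≤ 1, then T x^y is a unit times x^{sy}, plus possibly a multiple of x^y; since the
kernel is T-stable, x^{sy} lies in it. Translations by multiples of v reduce the general case to
this one. -/
theorem apply_mono_refl_eq_zero {α : E →ₗ[ℝ] ℝ} {v : E} {k u : Fˣ} (hv : α v = 2)
    {D : Module.End F (AddMonoidAlgebra F E)}
    (hD : ∀ (n : ℤ) a, D a = 0 → D (mono F (n • v) * a) = 0)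
    (hT : ∃ U, D * tdl α v k u = U * D) {y : E} (hy : D (mono F y) = 0) :
    D (mono F (y - α y • v)) = 0 := by
  obtain ⟨U, hU⟩ := hT
  have hT' : ∀ a, D a = 0 → D (tdl α v k u a) = 0 := by
    intro a ha
    have := LinearMap.congr_fun hU a
    rw [Module.End.mul_apply, Module.End.mul_apply, ha, map_zero] at this
    exact this
  have hn : ∀ {y : E} (n : ℤ), D (mono F y) = 0 → D (mono F (n • v + y)) = 0 := by
    intro y n h
    rw [← mono_mul]
    exact hD n _ h
  have small : ∀ {y : E}, -1 ≤ α y → α y ≤ 1 → D (mono F y) = 0 → D (mono F (y - α y • v)) = 0 := by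
    intro y h1 h2 hy
    have h3 := hT' _ hy
    rcases le_total 0 (α y) with h0 | h0
    · rw [tdl_mono_of_mem_Icc k u hv h0 h2, map_smul, smul_eq_zero] at h3
      exact h3.resolve_left (Units.ne_zero _)
    · have e := refl_refl hv y
      have e' := apply_refl hv y
      rw [← e, tdl_mono_refl_of_mem_Icc k u hv (by linarith) (by linarith), e, map_add, map_smul,
        map_smul, hy, smul_zero, add_zero, smul_eq_zero] at h3
      exact h3.resolve_left (Units.ne_zero _)
  -- Translate by -n v, reflect, and translate by -n v once more: the reflection turns the first
  -- shift into +n v, so the two cancel.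
  set n : ℤ := ⌊(α y + 1) / 2⌋
  have hl := Int.floor_le ((α y + 1) / 2)
  have hu := Int.lt_floor_add_one ((α y + 1) / 2)
  have hα : α (-n • v + y) = α y - 2 * n := by
    rw [map_add, map_zsmul, hv, zsmul_eq_mul]; push_cast; ring
  have h := hn (-n) (small (by rw [hα]; linarith) (by rw [hα]; linarith) (hn (-n) hy))
  convert h using 3
  rw [hα, ← Int.cast_smul_eq_zsmul ℝ]
  push_cast
  module

namespace RankTwo

variable {p q : ℕ} (R : RankTwo E p q) (k u l m : Fˣ)

/-- The first operator of the pair. -/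
noncomputable def T₁ : Module.End F (AddMonoidAlgebra F E) := tdl R.α R.v k u

/-- The second operator of the pair. -/
noncomputable def T₂ : Module.End F (AddMonoidAlgebra F E) := tdl R.β R.w l m

theorem T₁_mul_self : R.T₁ k u * R.T₁ k u = ((k : F) - (k⁻¹ : Fˣ)) • R.T₁ k u + 1 :=
  tdl_mul_self k u R.αv

theorem T₂_mul_self : R.T₂ l m * R.T₂ l m = ((l : F) - (l⁻¹ : Fˣ)) • R.T₂ l m + 1 :=
  tdl_mul_self l m R.βw

theorem alcoveClosed {D : Module.End F (AddMonoidAlgebra F E)}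
    (hΛ : ∀ μ ∈ R.lattice, ∃ ν : E, ∀ a, D (mono F μ * a) = mono F ν * D a)
    (h₁ : ∃ U, D * R.T₁ k u = U * D) (h₂ : ∃ U, D * R.T₂ l m = U * D) :
    AlcoveClosed p q fun a b => ∀ y, R.α y = a → R.β y = b → D (mono F y) = 0 where
  trans a b s t hG y ha hb := by
    have h := hG (s • R.v + t • R.w + y) (by rw [map_add, R.α_apply, ha]; push_cast; ring)
      (by rw [map_add, R.β_apply, hb]; push_cast; ring)
    obtain ⟨ν, hν⟩ := hΛ (-s • R.v + -t • R.w) (R.mem_lattice.mpr ⟨_, _, rfl⟩)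
    have h2 := hν (mono F (s • R.v + t • R.w + y))
    rw [h, mul_zero, mono_mul] at h2
    convert h2 using 3
    module
  refl₁ a b hG y ha hb := by
    have h := hG (y - R.α y • R.v) (by rw [apply_refl R.αv, ha])
      (by rw [map_sub, map_smul, R.βv, hb, ha, smul_eq_mul]; push_cast; ring)
    rw [← refl_refl R.αv y]
    refine apply_mono_refl_eq_zero R.αv (fun n a ha => ?_) h₁ h
    obtain ⟨ν, hν⟩ := hΛ (n • R.v) (zsmul_mem R.v_mem n)
    rw [hν, ha, mul_zero]
  refl₂ a b hG y ha hb := by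
    have h := hG (y - R.β y • R.w)
      (by rw [map_sub, map_smul, R.αw, hb, ha, smul_eq_mul]; push_cast; ring)
      (by rw [apply_refl R.βw, hb])
    rw [← refl_refl R.βw y]
    refine apply_mono_refl_eq_zero R.βw (fun n a ha => ?_) h₂ h
    obtain ⟨ν, hν⟩ := hΛ (n • R.w) (zsmul_mem R.w_mem n)
    rw [hν, ha, mul_zero]

variable {R k u l m}

/-- One step of the walk from y to w₀ y, with position recorded by the coefficients of v and w; c is
the value of the simple root at the current point, which equals the value at y of some positive
root. -/
theorem T₁_point {y : E} (s t c : ℝ) (hc : R.α y - 2 * s + p * t = c) (h0 : 0 ≤ c) (h1 : c ≤ 1) :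
    R.T₁ k u (mono F (y - s • R.v - t • R.w)) =
      (wallFactor k u c : F) • mono F (y - (s + c) • R.v - t • R.w) := by
  have h : R.α (y - s • R.v - t • R.w) = c := by
    rw [map_sub, map_sub, map_smul, map_smul, R.αv, R.αw, ← hc, smul_eq_mul, smul_eq_mul]; ring
  rw [T₁, tdl_mono_of_mem_Icc k u R.αv (by rwa [h]) (by rwa [h]), h]
  congr 2
  module

theorem T₂_point {y : E} (s t c : ℝ) (hc : R.β y - 2 * t + q * s = c) (h0 : 0 ≤ c) (h1 : c ≤ 1) :
    R.T₂ l m (mono F (y - s • R.v - t • R.w)) =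
      (wallFactor l m c : F) • mono F (y - s • R.v - (t + c) • R.w) := by
  have h : R.β (y - s • R.v - t • R.w) = c := by
    rw [map_sub, map_sub, map_smul, map_smul, R.βv, R.βw, ← hc, smul_eq_mul, smul_eq_mul]; ring
  rw [T₂, tdl_mono_of_mem_Icc l m R.βw (by rwa [h]) (by rwa [h]), h]
  congr 2
  module

theorem mono_eq_point (y : E) : mono F y = mono F (y - (0 : ℝ) • R.v - (0 : ℝ) • R.w) := by
  congr 1
  module

/-- In all four types it remains to see that the defect kills x^y for y in the closed alcove. There
the two words meet the positive roots in opposite orders, with all values in [0,1], so both sides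
give the same product of wall factors times x^{w₀ y}. -/
theorem braid_A1A1 (R : RankTwo E 0 0) (k u l m : Fˣ) :
    R.T₁ k u * R.T₂ l m = R.T₂ (F := F) l m * R.T₁ k u := by
  rw [← sub_eq_zero]
  refine linearMap_ext_mono fun y => ?_
  have hΛ := (R.model (k₁ := k) (u₁ := u) (k₂ := l) (u₂ := m) (Or.inl Even.zero)
    (Or.inl Even.zero) (by norm_num)).semilinear_A1A1
  have t₁ := R.T₁_mul_self k u
  have t₂ := R.T₂_mul_self l m
  refine (R.alcoveClosed (D := R.T₁ k u * R.T₂ l m - R.T₂ l m * R.T₁ k u) k u l m hΛ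
    (exists_mul_eq t₁ t₁ (Or.inl rfl)) (exists_mul_eq t₂ t₂ (Or.inr rfl))).A1A1 ?_ _ _ y rfl rfl
  rintro a b ha ha' hb hb' y rfl rfl
  change R.T₁ k u (R.T₂ l m (mono F y)) - R.T₂ l m (R.T₁ k u (mono F y)) = 0
  rw [mono_eq_point (R := R) y, T₂_point 0 0 (R.β y) (by ring) hb hb', map_smul,
      T₁_point 0 _ (R.α y) (by push_cast; ring) ha ha', T₁_point 0 0 (R.α y) (by ring) ha ha',
      map_smul, T₂_point _ _ (R.β y) (by push_cast; ring) hb hb', smul_comm, sub_self]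

theorem braid_A2 (R : RankTwo E 1 1) (k : Fˣ) :
    R.T₁ k k * R.T₂ k k * R.T₁ k k = R.T₂ (F := F) k k * R.T₁ k k * R.T₂ k k := by
  rw [← sub_eq_zero]
  refine linearMap_ext_mono fun y => ?_
  have hΛ := (R.model (k₁ := k) (u₁ := k) (k₂ := k) (u₂ := k) (Or.inr rfl)
    (Or.inr rfl) (by norm_num)).semilinear_A2
  have t₁ := R.T₁_mul_self k k
  have t₂ := R.T₂_mul_self k k
  refine (R.alcoveClosed
    (D := R.T₁ k k * R.T₂ k k * R.T₁ k k - R.T₂ k k * R.T₁ k k * R.T₂ k k) k k k k hΛ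
    (exists_mul_eq t₂ t₁ (X := R.T₁ k k * R.T₂ k k) (Or.inr (by simp only [mul_assoc])))
    (exists_mul_eq t₁ t₂ (X := R.T₂ k k * R.T₁ k k) (Or.inl (by simp only [mul_assoc])))).A2
    ?_ _ _ y rfl rfl
  rintro a b ha hb hab y hα hβ
  change R.T₁ k k (R.T₂ k k (R.T₁ k k (mono F y)))
    - R.T₂ k k (R.T₁ k k (R.T₂ k k (mono F y))) = 0
  rw [mono_eq_point (R := R) y,
    T₁_point 0 0 a (by linarith) (by linarith) (by linarith), map_smul,
    T₂_point _ _ (a + b) (by push_cast; linarith) (by linarith) (by linarith), map_smul, map_smul,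
    T₁_point _ _ b (by push_cast; linarith) (by linarith) (by linarith),
    T₂_point 0 0 b (by linarith) (by linarith) (by linarith), map_smul,
    T₁_point _ _ (a + b) (by push_cast; linarith) (by linarith) (by linarith), map_smul, map_smul,
    T₂_point _ _ a (by push_cast; linarith) (by linarith) (by linarith)]
  simp only [smul_smul]
  rw [sub_eq_zero]
  congr 1
  · ring
  · congr 1; module

theorem braid_B2 (R : RankTwo E 1 2) (k l m : Fˣ) :
    R.T₁ k k * R.T₂ l m * R.T₁ k k * R.T₂ l m
      = R.T₂ (F := F) l m * R.T₁ k k * R.T₂ l m * R.T₁ k k := by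
  rw [← sub_eq_zero]
  refine linearMap_ext_mono fun y => ?_
  have hΛ := (R.model (k₁ := k) (u₁ := k) (k₂ := l) (u₂ := m) (Or.inr rfl)
    (Or.inl even_two) (by norm_num)).semilinear_B2
  have t₁ := R.T₁_mul_self k k
  have t₂ := R.T₂_mul_self l m
  refine (R.alcoveClosed (D := R.T₁ k k * R.T₂ l m * R.T₁ k k * R.T₂ l m
      - R.T₂ l m * R.T₁ k k * R.T₂ l m * R.T₁ k k) k k l m hΛ
    (exists_mul_eq t₁ t₁ (X := R.T₂ l m * R.T₁ k k * R.T₂ l m)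
      (Or.inl (by simp only [mul_assoc])))
    (exists_mul_eq t₂ t₂ (X := R.T₁ k k * R.T₂ l m * R.T₁ k k)
      (Or.inr (by simp only [mul_assoc])))).B2
    ?_ _ _ y rfl rfl
  rintro a b ha hb hab y hα hβ
  change R.T₁ k k (R.T₂ l m (R.T₁ k k (R.T₂ l m (mono F y))))
    - R.T₂ l m (R.T₁ k k (R.T₂ l m (R.T₁ k k (mono F y)))) = 0
  rw [mono_eq_point (R := R) y,
    T₂_point 0 0 b (by linarith) (by linarith) (by linarith)]
  simp only [map_smul]
  rw [T₁_point _ _ (a + b) (by push_cast; linarith) (by linarith) (by linarith)]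
  simp only [map_smul]
  rw [T₂_point _ _ (2 * a + b) (by push_cast; linarith) (by linarith) (by linarith)]
  simp only [map_smul]
  rw [T₁_point _ _ a (by push_cast; linarith) (by linarith) (by linarith),
    T₁_point 0 0 a (by linarith) (by linarith) (by linarith)]
  simp only [map_smul]
  rw [T₂_point _ _ (2 * a + b) (by push_cast; linarith) (by linarith) (by linarith)]
  simp only [map_smul]
  rw [T₁_point _ _ (a + b) (by push_cast; linarith) (by linarith) (by linarith)]
  simp only [map_smul]
  rw [T₂_point _ _ b (by push_cast; linarith) (by linarith) (by linarith)]
  simp only [smul_smul]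
  rw [sub_eq_zero]
  congr 1
  · ring
  · congr 1; module

theorem braid_G2 (R : RankTwo E 1 3) (k l : Fˣ) :
    R.T₁ k k * R.T₂ l l * R.T₁ k k * R.T₂ l l * R.T₁ k k * R.T₂ l l
      = R.T₂ (F := F) l l * R.T₁ k k * R.T₂ l l * R.T₁ k k * R.T₂ l l * R.T₁ k k := by
  rw [← sub_eq_zero]
  refine linearMap_ext_mono fun y => ?_
  have hΛ := (R.model (k₁ := k) (u₁ := k) (k₂ := l) (u₂ := l) (Or.inr rfl)
    (Or.inr rfl) (by norm_num)).semilinear_G2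
  have t₁ := R.T₁_mul_self k k
  have t₂ := R.T₂_mul_self l l
  refine (R.alcoveClosed
    (D := R.T₁ k k * R.T₂ l l * R.T₁ k k * R.T₂ l l * R.T₁ k k * R.T₂ l l
      - R.T₂ l l * R.T₁ k k * R.T₂ l l * R.T₁ k k * R.T₂ l l * R.T₁ k k) k k l l hΛ
    (exists_mul_eq t₁ t₁ (X := R.T₂ l l * R.T₁ k k * R.T₂ l l * R.T₁ k k * R.T₂ l l)
      (Or.inl (by simp only [mul_assoc])))
    (exists_mul_eq t₂ t₂ (X := R.T₁ k k * R.T₂ l l * R.T₁ k k * R.T₂ l l * R.T₁ k k)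
      (Or.inr (by simp only [mul_assoc])))).G2
    ?_ _ _ y rfl rfl
  rintro a b ha hb hab y hα hβ
  change R.T₁ k k (R.T₂ l l (R.T₁ k k (R.T₂ l l (R.T₁ k k (R.T₂ l l (mono F y))))))
    - R.T₂ l l (R.T₁ k k (R.T₂ l l (R.T₁ k k (R.T₂ l l (R.T₁ k k (mono F y)))))) = 0
  rw [mono_eq_point (R := R) y,
    T₂_point 0 0 b (by linarith) (by linarith) (by linarith)]
  simp only [map_smul]
  rw [T₁_point _ _ (a + b) (by push_cast; linarith) (by linarith) (by linarith)]
  simp only [map_smul]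
  rw [T₂_point _ _ (3 * a + 2 * b) (by push_cast; linarith) (by linarith) (by linarith)]
  simp only [map_smul]
  rw [T₁_point _ _ (2 * a + b) (by push_cast; linarith) (by linarith) (by linarith)]
  simp only [map_smul]
  rw [T₂_point _ _ (3 * a + b) (by push_cast; linarith) (by linarith) (by linarith)]
  simp only [map_smul]
  rw [T₁_point _ _ a (by push_cast; linarith) (by linarith) (by linarith),
    T₁_point 0 0 a (by linarith) (by linarith) (by linarith)]
  simp only [map_smul]
  rw [T₂_point _ _ (3 * a + b) (by push_cast; linarith) (by linarith) (by linarith)]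
  simp only [map_smul]
  rw [T₁_point _ _ (2 * a + b) (by push_cast; linarith) (by linarith) (by linarith)]
  simp only [map_smul]
  rw [T₂_point _ _ (3 * a + 2 * b) (by push_cast; linarith) (by linarith) (by linarith)]
  simp only [map_smul]
  rw [T₁_point _ _ (a + b) (by push_cast; linarith) (by linarith) (by linarith)]
  simp only [map_smul]
  rw [T₂_point _ _ b (by push_cast; linarith) (by linarith) (by linarith)]
  simp only [smul_smul]
  rw [sub_eq_zero]
  congr 1
  · ring
  · congr 1; module

end RankTwo

end QuasiPoly

/-! ### Orders of products of two reflections, and the uniform braid relation. -/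

namespace QuasiPoly
namespace RankTwo

variable {F E : Type*} [Field F] [AddCommGroup E] [Module ℝ E] {p q : ℕ} (R : RankTwo E p q)

/-- The two roots in the opposite order. -/
def swap : RankTwo E q p where
  α := R.β
  β := R.α
  v := R.w
  w := R.v
  αv := R.βw
  βw := R.αv
  αw := R.βv
  βv := R.αw

theorem eq_zero_of_smul_add_smul (hpq : p * q < 4) {s t : ℝ} (h : s • R.v + t • R.w = 0) :
    s = 0 ∧ t = 0 := by
  have h1 := congrArg R.α h
  have h2 := congrArg R.β h
  rw [map_add, map_smul, map_smul, map_zero, R.αv, R.αw, smul_eq_mul, smul_eq_mul] at h1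
  rw [map_add, map_smul, map_smul, map_zero, R.βv, R.βw, smul_eq_mul, smul_eq_mul] at h2
  have h5 : ((4 : ℝ) - p * q) ≠ 0 := by
    have : ((p * q : ℕ) : ℝ) < 4 := by exact_mod_cast hpq
    push_cast at this
    linarith
  constructor
  · refine (mul_eq_zero.mp (?_ : (4 - p * q : ℝ) * s = 0)).resolve_left h5
    linear_combination 2 * h1 + p * h2
  · refine (mul_eq_zero.mp (?_ : (4 - p * q : ℝ) * t = 0)).resolve_left h5
    linear_combination 2 * h2 + q * h1

/-- A pair of affine reflections whose hyperplanes meet in `e`, with the given linear parts. -/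
structure Reflections (e : E) (S₁ S₂ : Equiv.Perm E) : Prop where
  apply₁ : ∀ y, S₁ y = y - R.α (y - e) • R.v
  apply₂ : ∀ y, S₂ y = y - R.β (y - e) • R.w

namespace Reflections

variable {R} {e : E} {S₁ S₂ : Equiv.Perm E}

theorem swap (h : R.Reflections e S₁ S₂) : R.swap.Reflections e S₂ S₁ := ⟨h.apply₂, h.apply₁⟩

/-- The product moves a point only within its coset of the plane of v and w, so its powers are
followed through the two coefficients. They return to zero after 2, 3, 4 or 6 steps, and the point e
+ v shows that no earlier power is trivial. -/
theorem mul_apply (h : R.Reflections e S₁ S₂) (y : E) (s t s' t' : ℝ) (ht : t' = R.β (y - e) - t + q * s)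
    (hs : s' = R.α (y - e) - s + p * t') :
    (S₁ * S₂) (y - s • R.v - t • R.w) = y - s' • R.v - t' • R.w := by
  have e2 : R.β (y - s • R.v - t • R.w - e) = R.β (y - e) - 2 * t + q * s := by
    simp only [map_sub, map_smul, R.βv, R.βw, smul_eq_mul]; ring
  have e1 : R.α (y - s • R.v - t' • R.w - e) = R.α (y - e) - 2 * s + p * t' := by
    simp only [map_sub, map_smul, R.αv, R.αw, smul_eq_mul]; ring
  rw [Equiv.Perm.mul_apply, h.apply₂, e2]
  have : y - s • R.v - t • R.w - (R.β (y - e) - 2 * t + q * s) • R.w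
      = y - s • R.v - t' • R.w := by rw [ht]; module
  rw [this, h.apply₁, e1, hs]
  module

theorem pow_ne_one (hpq : p * q < 4) {g : Equiv.Perm E} (y : E) (s t : ℝ)
    (hy : g y = y - s • R.v - t • R.w) (hst : s ≠ 0 ∨ t ≠ 0) : g ≠ 1 := by
  rintro rfl
  have h : s • R.v + t • R.w = 0 := by
    have h2 : y - s • R.v - t • R.w = y - (s • R.v + t • R.w) := by module
    rw [Equiv.Perm.one_apply, h2, eq_comm, sub_eq_self] at hy
    exact hy
  obtain ⟨hs, ht⟩ := R.eq_zero_of_smul_add_smul hpq h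
  exact hst.elim (fun h => h hs) (fun h => h ht)

theorem point_zero (y : E) : y - (0 : ℝ) • R.v - (0 : ℝ) • R.w = y := by module

theorem orderOf_A1A1 {R : RankTwo E 0 0} (h : R.Reflections e S₁ S₂) : orderOf (S₁ * S₂) = 2 := by
  have s1 : ∀ y, (S₁ * S₂) y = y - R.α (y - e) • R.v - R.β (y - e) • R.w := fun y => by
    conv_lhs => rw [← point_zero (R := R) y]
    exact h.mul_apply y 0 0 _ _ (by push_cast; ring) (by push_cast; ring)
  refine orderOf_eq_prime ?_ (pow_ne_one (R := R) (by norm_num) (e + R.v) _ _ (s1 _) (Or.inl ?_))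
  · ext y
    rw [sq, Equiv.Perm.mul_apply (S₁ * S₂), s1 y, h.mul_apply y _ _ 0 0 (by push_cast; ring)
      (by push_cast; ring), point_zero, Equiv.Perm.one_apply]
  · rw [add_sub_cancel_left, R.αv]; norm_num

theorem orderOf_A2 {R : RankTwo E 1 1} (h : R.Reflections e S₁ S₂) : orderOf (S₁ * S₂) = 3 := by
  have s1 : ∀ y, (S₁ * S₂) y = y - (R.α (y - e) + R.β (y - e)) • R.v - R.β (y - e) • R.w :=
    fun y => by
      conv_lhs => rw [← point_zero (R := R) y]
      exact h.mul_apply y 0 0 _ _ (by push_cast; ring) (by push_cast; ring)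
  have : Fact (Nat.Prime 3) := ⟨Nat.prime_three⟩
  refine orderOf_eq_prime ?_ (pow_ne_one (R := R) (by norm_num) (e + R.v) _ _ (s1 _) (Or.inl ?_))
  · ext y
    rw [pow_succ, sq, Equiv.Perm.mul_apply, Equiv.Perm.mul_apply (S₁ * S₂), s1 y,
      h.mul_apply y _ _ (R.α (y - e)) (R.α (y - e) + R.β (y - e)) (by push_cast; ring)
      (by push_cast; ring), h.mul_apply y _ _ 0 0 (by push_cast; ring) (by push_cast; ring),
      point_zero, Equiv.Perm.one_apply]
  · rw [add_sub_cancel_left, R.αv, R.βv]; norm_num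

theorem orderOf_B2 {R : RankTwo E 1 2} (h : R.Reflections e S₁ S₂) : orderOf (S₁ * S₂) = 4 := by
  have s2 : ∀ y, ((S₁ * S₂) ^ 2) y = y - (2 * R.α (y - e) + R.β (y - e)) • R.v
      - (2 * R.α (y - e) + 2 * R.β (y - e)) • R.w := fun y => by
    conv_lhs => rw [← point_zero (R := R) y]
    rw [sq, Equiv.Perm.mul_apply (S₁ * S₂), h.mul_apply y 0 0 (R.α (y - e) + R.β (y - e))
      (R.β (y - e)) (by push_cast; ring) (by push_cast; ring)]
    exact h.mul_apply y _ _ _ _ (by push_cast; ring) (by push_cast; ring)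
  have : Fact (Nat.Prime 2) := ⟨Nat.prime_two⟩
  refine orderOf_eq_prime_pow (p := 2) (n := 1)
    (pow_ne_one (R := R) (by norm_num) (e + R.v) _ _ (s2 _) (Or.inl ?_)) ?_
  · rw [add_sub_cancel_left, R.αv, R.βv]; norm_num
  · ext y
    rw [show 2 ^ (1 + 1) = 2 + 2 from rfl, pow_add, Equiv.Perm.mul_apply, s2 y, sq,
      Equiv.Perm.mul_apply (S₁ * S₂), h.mul_apply y _ _ (R.α (y - e))
      (2 * R.α (y - e) + R.β (y - e)) (by push_cast; ring) (by push_cast; ring),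
      h.mul_apply y _ _ 0 0 (by push_cast; ring) (by push_cast; ring), point_zero,
      Equiv.Perm.one_apply]

theorem orderOf_G2 {R : RankTwo E 1 3} (h : R.Reflections e S₁ S₂) : orderOf (S₁ * S₂) = 6 := by
  have s2 : ∀ y, ((S₁ * S₂) ^ 2) y = y - (3 * R.α (y - e) + 2 * R.β (y - e)) • R.v
      - (3 * R.α (y - e) + 3 * R.β (y - e)) • R.w := fun y => by
    conv_lhs => rw [← point_zero (R := R) y]
    rw [sq, Equiv.Perm.mul_apply (S₁ * S₂), h.mul_apply y 0 0 (R.α (y - e) + R.β (y - e))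
      (R.β (y - e)) (by push_cast; ring) (by push_cast; ring)]
    exact h.mul_apply y _ _ _ _ (by push_cast; ring) (by push_cast; ring)
  have s3 : ∀ y, ((S₁ * S₂) ^ 3) y = y - (4 * R.α (y - e) + 2 * R.β (y - e)) • R.v
      - (6 * R.α (y - e) + 4 * R.β (y - e)) • R.w := fun y => by
    rw [pow_succ', Equiv.Perm.mul_apply, s2]
    exact h.mul_apply y _ _ _ _ (by push_cast; ring) (by push_cast; ring)
  refine orderOf_eq_of_pow_and_pow_div_prime (by norm_num) ?_ fun r hr hr6 => ?_
  · ext y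
    rw [show 6 = 3 + 3 from rfl, pow_add, Equiv.Perm.mul_apply, s3 y, pow_succ, sq,
      Equiv.Perm.mul_apply, Equiv.Perm.mul_apply (S₁ * S₂), h.mul_apply y _ _
      (3 * R.α (y - e) + R.β (y - e)) (6 * R.α (y - e) + 3 * R.β (y - e)) (by push_cast; ring)
      (by push_cast; ring), h.mul_apply y _ _ (R.α (y - e)) (3 * R.α (y - e) + R.β (y - e))
      (by push_cast; ring) (by push_cast; ring),
      h.mul_apply y _ _ 0 0 (by push_cast; ring) (by push_cast; ring), point_zero,
      Equiv.Perm.one_apply]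
  · have hr' : r = 2 ∨ r = 3 := by
      have hd : r ∣ 2 * 3 := hr6
      rcases (Nat.Prime.dvd_mul hr).mp hd with hd | hd
      · exact Or.inl ((Nat.prime_dvd_prime_iff_eq hr Nat.prime_two).mp hd)
      · exact Or.inr ((Nat.prime_dvd_prime_iff_eq hr Nat.prime_three).mp hd)
    rcases hr' with rfl | rfl
    · refine pow_ne_one (R := R) (by norm_num) (e + R.v) _ _ (s3 _) (Or.inl ?_)
      rw [add_sub_cancel_left, R.αv, R.βv]; norm_num
    · refine pow_ne_one (R := R) (by norm_num) (e + R.v) _ _ (s2 _) (Or.inr ?_)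
      rw [add_sub_cancel_left, R.αv, R.βv]; norm_num

end Reflections

theorem orderOf_mul_swap {G : Type*} [Group G] (a b : G) : orderOf (a * b) = orderOf (b * a) := by
  rw [← (MulAut.conj a).orderOf_eq (b * a), MulAut.conj_apply]
  group

/-- The braid relation, of length the order of the product of the reflections, up to a homomorphism
of algebras. -/
theorem braid (hpq : (p, q) ∈ ({(0, 0), (1, 1), (1, 2), (2, 1), (1, 3), (3, 1)} : Set (ℕ × ℕ)))
    {k u l m : Fˣ} (hp : Odd p → u = k) (hq : Odd q → m = l) (hkl : p = 1 → q = 1 → k = l)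
    {e : E} {S₁ S₂ : Equiv.Perm E} (h : R.Reflections e S₁ S₂) {J B : Type*} [Monoid B]
    (c : Module.End F (AddMonoidAlgebra F E) →* B) (T : J → B) {i j : J}
    (hi : T i = c (R.T₁ k u)) (hj : T j = c (R.T₂ l m)) :
    ((CoxeterSystem.alternatingWord i j (orderOf (S₁ * S₂))).map T).prod =
      ((CoxeterSystem.alternatingWord j i (orderOf (S₁ * S₂))).map T).prod := by
  have odd3 : Odd 3 := by decide
  simp only [Set.mem_insert_iff, Set.mem_singleton_iff, Prod.mk.injEq] at hpq
  rcases hpq with ⟨rfl, rfl⟩ | ⟨rfl, rfl⟩ | ⟨rfl, rfl⟩ | ⟨rfl, rfl⟩ | ⟨rfl, rfl⟩ | ⟨rfl, rfl⟩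
  · have hb := congrArg c (R.braid_A1A1 k u l m)
    simp only [map_mul, ← hi, ← hj] at hb
    simpa [h.orderOf_A1A1, CoxeterSystem.alternatingWord, mul_assoc] using hb
  · obtain rfl := hp odd_one
    obtain rfl := hq odd_one
    obtain rfl := hkl rfl rfl
    have hb := congrArg c (R.braid_A2 u)
    simp only [map_mul, ← hi, ← hj] at hb
    -- An alternating word is indexed by its last letter, so in odd length the word in i, j also
    -- begins with j; hence the reversed equation.
    simpa [h.orderOf_A2, CoxeterSystem.alternatingWord, mul_assoc] using hb.symm
  · obtain rfl := hp odd_one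
    have hb := congrArg c (R.braid_B2 u l m)
    simp only [map_mul, ← hi, ← hj] at hb
    simpa [h.orderOf_B2, CoxeterSystem.alternatingWord, mul_assoc] using hb
  · obtain rfl := hq odd_one
    have hb := congrArg c (R.swap.braid_B2 m k u)
    have hi' : c (R.swap.T₂ k u) = T i := hi.symm
    have hj' : c (R.swap.T₁ m m) = T j := hj.symm
    simp only [map_mul, hi', hj'] at hb
    rw [orderOf_mul_swap S₁ S₂, h.swap.orderOf_B2]
    simpa [CoxeterSystem.alternatingWord, mul_assoc] using hb.symm
  · obtain rfl := hp odd_one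
    obtain rfl := hq odd3
    have hb := congrArg c (R.braid_G2 u m)
    simp only [map_mul, ← hi, ← hj] at hb
    simpa [h.orderOf_G2, CoxeterSystem.alternatingWord, mul_assoc] using hb
  · obtain rfl := hp odd3
    obtain rfl := hq odd_one
    have hb := congrArg c (R.swap.braid_G2 m u)
    have hi' : c (R.swap.T₂ u u) = T i := hi.symm
    have hj' : c (R.swap.T₁ m m) = T j := hj.symm
    simp only [map_mul, hi', hj'] at hb
    rw [orderOf_mul_swap S₁ S₂, h.swap.orderOf_G2]
    simpa [CoxeterSystem.alternatingWord, mul_assoc] using hb.symm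

end RankTwo
/-! ### Twisting by a character -/

/-- Over an algebraically closed field the group Lˣ is divisible, hence injective, so 1 ↦ q extends
from ℤ to ℝ. Real powers of q are needed because the quasi-exponents are real. -/
theorem exists_character {L : Type*} [Field L] [IsAlgClosed L] (q : Lˣ) :
    ∃ γ : ℝ →+ Additive Lˣ, γ 1 = Additive.ofMul q := by
  have hs : ∀ {n : ℤ}, n ≠ 0 → Function.Surjective fun a : Additive Lˣ => n • a := by
    have hn : ∀ {n : ℕ}, n ≠ 0 → ∀ a : Lˣ, ∃ b : Lˣ, b ^ n = a := by
      intro n hn a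
      obtain ⟨z, hz⟩ := IsAlgClosed.exists_pow_nat_eq (a : L) (Nat.pos_of_ne_zero hn)
      have hz0 : z ≠ 0 := by
        rintro rfl
        rw [zero_pow hn] at hz
        exact a.ne_zero hz.symm
      exact ⟨Units.mk0 z hz0, Units.ext (by simpa using hz)⟩
    intro n hn0 a
    obtain ⟨b, hb⟩ := hn (Int.natAbs_ne_zero.mpr hn0) a.toMul
    rcases n.natAbs_eq with h | h
    · refine ⟨Additive.ofMul b, ?_⟩
      change n • Additive.ofMul b = a
      rw [h, natCast_zsmul, ← ofMul_pow, hb]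
      rfl
    · refine ⟨Additive.ofMul b⁻¹, ?_⟩
      change n • Additive.ofMul b⁻¹ = a
      rw [h, neg_smul, natCast_zsmul, ← ofMul_pow, inv_pow, hb, ofMul_inv, neg_neg]
      rfl
  let _ : DivisibleBy (Additive Lˣ) ℤ := divisibleByOfSMulRightSurj _ _ hs
  obtain ⟨γ, hγ⟩ := (Module.Baer.of_divisible (Additive Lˣ)).extension_property_addMonoidHom
    (Int.castAddHom ℝ) Int.cast_injective (zmultiplesHom (Additive Lˣ) (Additive.ofMul q))
  refine ⟨γ, ?_⟩
  have := DFunLike.congr_fun hγ 1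
  simpa using this

section Twist

variable {L E : Type*} [Field L] [AddCommGroup E] [Module ℝ E] (γ : ℝ →+ Additive Lˣ)

/-- The value of the character. -/
def charVal (s : ℝ) : Lˣ := (γ s).toMul

theorem charVal_add (s t : ℝ) : charVal γ (s + t) = charVal γ s * charVal γ t := by
  rw [charVal, map_add]; rfl

theorem charVal_zero : charVal γ 0 = 1 := by
  rw [charVal, map_zero]; rfl

theorem charVal_intCast (q : Lˣ) (hγ : γ 1 = Additive.ofMul q) (n : ℤ) : charVal γ n = q ^ n := by
  have : (n : ℝ) = n • (1 : ℝ) := by simp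
  rw [charVal, this, map_zsmul, hγ]
  rfl

/-- The automorphism `x^y ↦ γ(f y) x^y`. -/
noncomputable def twistLin (f : E →ₗ[ℝ] ℝ) : AddMonoidAlgebra L E →ₗ[L] AddMonoidAlgebra L E :=
  linExt fun y => (charVal γ (f y) : L) • mono L y

theorem twistLin_mono (f : E →ₗ[ℝ] ℝ) (y : E) :
    twistLin γ f (mono L y) = (charVal γ (f y) : L) • mono L y := linExt_mono _ _

theorem twistLin_add (f g : E →ₗ[ℝ] ℝ) (m : AddMonoidAlgebra L E) :
    twistLin γ (f + g) m = twistLin γ f (twistLin γ g m) := by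
  induction m using mono_induction with
  | h y =>
    rw [twistLin_mono, twistLin_mono, map_smul, twistLin_mono, LinearMap.add_apply, charVal_add,
      Units.val_mul, smul_smul, mul_comm]
  | hadd a b ha hb => simp only [map_add, ha, hb]
  | hsmul c a ha => simp only [map_smul, ha]

theorem twistLin_zero (m : AddMonoidAlgebra L E) : twistLin γ (0 : E →ₗ[ℝ] ℝ) m = m := by
  induction m using mono_induction with
  | h y => rw [twistLin_mono, LinearMap.zero_apply, charVal_zero, Units.val_one, one_smul]
  | hadd a b ha hb => rw [map_add, ha, hb]
  | hsmul c a ha => rw [map_smul, ha]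

theorem twistLin_mul (f : E →ₗ[ℝ] ℝ) (m m' : AddMonoidAlgebra L E) :
    twistLin γ f (m * m') = twistLin γ f m * twistLin γ f m' := by
  induction m using mono_induction with
  | h y =>
    induction m' using mono_induction with
    | h z =>
      rw [mono_mul, twistLin_mono, twistLin_mono, twistLin_mono, map_add, charVal_add,
        smul_mul_smul_comm, mono_mul, Units.val_mul]
    | hadd a b ha hb => rw [mul_add, map_add, ha, hb, map_add, mul_add]
    | hsmul c a ha => rw [mul_smul_comm, map_smul, ha, map_smul, mul_smul_comm]
  | hadd a b ha hb => rw [add_mul, map_add, ha, hb, map_add, add_mul]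
  | hsmul c a ha => rw [smul_mul_assoc, map_smul, ha, map_smul, smul_mul_assoc]

/-- `twistLin` as a linear equivalence. -/
noncomputable def twist (f : E →ₗ[ℝ] ℝ) : AddMonoidAlgebra L E ≃ₗ[L] AddMonoidAlgebra L E :=
  LinearEquiv.ofLinearMap (twistLin γ f) (twistLin γ (-f))
    (LinearMap.ext fun m => by
      rw [LinearMap.comp_apply, ← twistLin_add, add_neg_cancel, twistLin_zero]; rfl)
    (LinearMap.ext fun m => by
      rw [LinearMap.comp_apply, ← twistLin_add, neg_add_cancel, twistLin_zero]; rfl)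

/-- Conjugation by a twist. -/
noncomputable def conjTwist (f : E →ₗ[ℝ] ℝ) :
    Module.End L (AddMonoidAlgebra L E) ≃ₐ[L] Module.End L (AddMonoidAlgebra L E) :=
  (twist γ f).conjAlgEquiv L

theorem conjTwist_apply (f : E →ₗ[ℝ] ℝ) (T : Module.End L (AddMonoidAlgebra L E))
    (m : AddMonoidAlgebra L E) :
    conjTwist γ f T m = twistLin γ f (T (twistLin γ (-f) m)) := rfl

/-- The truncated Demazure-Lusztig operator of the affine functional `α + r`. -/
noncomputable def affTdl (α : E →ₗ[ℝ] ℝ) (v : E) (k u : Lˣ) (r : ℝ) :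
    Module.End L (AddMonoidAlgebra L E) :=
  conjTwist γ ((r / 2) • α) (tdl α v k u)

variable {α : E →ₗ[ℝ] ℝ} {v : E} (k u : Lˣ)

/-- The operator moves exponents only along v, where f is constant, so the twist scales all terms of
T x^y by the same γ(f(y)). -/
theorem twistLin_tdl_of_apply_eq_zero (hv : v ≠ 0) {f : E →ₗ[ℝ] ℝ} (hf : f v = 0)
    (m : AddMonoidAlgebra L E) :
    twistLin γ f (tdl α v k u m) = tdl α v k u (twistLin γ f m) := by
  have hm : ∀ n : ℤ, twistLin γ f (mono L (n • v)) = mono L (n • v) := by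
    intro n
    rw [twistLin_mono, map_zsmul, hf, smul_zero, charVal_zero, Units.val_one, one_smul]
  have hone : twistLin γ f (1 : AddMonoidAlgebra L E) = 1 := by
    simpa [mono_zero] using hm 0
  have hv1 : twistLin γ f (mono L v) = mono L v := by simpa using hm 1
  have hden : twistLin γ f (den L v) = den L v := by rw [den, map_sub, hm, hone]
  induction m using mono_induction with
  | h y =>
    apply mul_left_cancel₀ (den_ne_zero (F := L) hv)
    conv_lhs => rw [← hden]
    rw [← twistLin_mul, den_mul_tdl_mono, twistLin_mono, map_smul, mul_smul_comm,
      den_mul_tdl_mono, num]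
    simp only [map_add, map_sub, map_smul, twistLin_mul, hden, hm, hone, hv1, twistLin_mono, hf,
      smul_zero, sub_zero]
    simp only [Algebra.smul_def]
    ring
  | hadd a b ha hb => simp only [map_add, ha, hb]
  | hsmul c a ha => simp only [map_smul, ha]

/-- Split f as (f(v)/2) α plus a functional killing v; the second part commutes with the operator.
This independence of f lets one twist serve two roots at once. -/
theorem conjTwist_tdl (hv : α v = 2) (f : E →ₗ[ℝ] ℝ) :
    conjTwist γ f (tdl α v k u) = affTdl γ α v k u (f v) := by
  refine LinearMap.ext fun m => ?_
  rw [affTdl, conjTwist_apply, conjTwist_apply]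
  have hg : (f - (f v / 2) • α) v = 0 := by
    rw [LinearMap.sub_apply, LinearMap.smul_apply, hv, smul_eq_mul]; ring
  have h1 : f = (f v / 2) • α + (f - (f v / 2) • α) := by abel
  conv_lhs => rw [h1]
  rw [twistLin_add, twistLin_tdl_of_apply_eq_zero γ k u (ne_zero_of_apply_eq_two hv) hg,
    ← twistLin_add]
  congr 4
  abel

theorem affTdl_zero (hv : α v = 2) : affTdl γ α v k u 0 = tdl α v k u := by
  have h := conjTwist_tdl γ k u hv (0 : E →ₗ[ℝ] ℝ)
  rw [LinearMap.zero_apply] at h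
  rw [← h]
  refine LinearMap.ext fun m => ?_
  rw [conjTwist_apply, neg_zero, twistLin_zero, twistLin_zero]

theorem affTdl_quadratic (hv : α v = 2) (r : ℝ) :
    (affTdl γ α v k u r - (k : L) • 1) * (affTdl γ α v k u r + ((k⁻¹ : Lˣ) : L) • 1) = 0 := by
  have h := congrArg (conjTwist γ ((r / 2) • α)) (tdl_quadratic (F := L) k u hv)
  rwa [map_mul, map_sub, map_add, map_smul, map_smul, map_one, map_zero] at h

/-- The cross relation of an affine truncated Demazure-Lusztig operator, cleared of its
denominator. -/
theorem affTdl_cross {k u : Lˣ} (hv : α v = 2) {μ : E} {n : ℤ} (hn : α μ = n)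
    (h : Even n ∨ k = u) (r : ℝ) (m : AddMonoidAlgebra L E) :
    (1 - ((charVal γ r : L) • mono L v) ^ 2) * (affTdl γ α v k u r (mono L μ * m)
      - ((charVal γ (-(α μ * r)) : L) • mono L (μ - α μ • v)) * affTdl γ α v k u r m)
      = (((k : L) - (k⁻¹ : Lˣ)) • 1 + ((u : L) - (u⁻¹ : Lˣ)) • ((charVal γ r : L) • mono L v))
        * (mono L μ - (charVal γ (-(α μ * r)) : L) • mono L (μ - α μ • v)) * m := by
  have key := congrArg (twistLin γ ((r / 2) • α)) (den_mul_tdl_mono_mul (F := L) (v := v) hn h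
    (twistLin γ (-((r / 2) • α)) m))
  set f := (r / 2) • α with hf
  have hfv : f v = r := by rw [hf, LinearMap.smul_apply, hv, smul_eq_mul]; ring
  have e1 : twistLin γ f (den L v) = 1 - ((charVal γ r : L) • mono L v) ^ 2 := by
    have h1 : twistLin γ f (1 : AddMonoidAlgebra L E) = 1 := by
      rw [← mono_zero, twistLin_mono, map_zero, charVal_zero, Units.val_one, one_smul]
    rw [den, two_smul, ← mono_mul, map_sub, twistLin_mul, twistLin_mono, hfv, h1, sq]
  have e2 : twistLin γ f (num v k u) =
      ((k : L) - (k⁻¹ : Lˣ)) • 1 + ((u : L) - (u⁻¹ : Lˣ)) • ((charVal γ r : L) • mono L v) := by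
    have h1 : twistLin γ f (1 : AddMonoidAlgebra L E) = 1 := by
      rw [← mono_zero, twistLin_mono, map_zero, charVal_zero, Units.val_one, one_smul]
    rw [num, map_add, map_smul, map_smul, twistLin_mono, hfv, h1]
  have e3 : twistLin γ f (mono L (μ - α μ • v)) = (charVal γ (f μ) : L) •
      ((charVal γ (-(α μ * r)) : L) • mono L (μ - α μ • v)) := by
    rw [twistLin_mono, smul_smul, ← Units.val_mul, ← charVal_add]
    congr 3
    rw [map_sub, map_smul, hfv, smul_eq_mul]; ring
  have e4 : twistLin γ f (twistLin γ (-f) m) = m := by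
    rw [← twistLin_add, add_neg_cancel, twistLin_zero]
  have e5 : mono L μ * twistLin γ (-f) m = ((charVal γ (f μ) : Lˣ) : L) •
      twistLin γ (-f) (mono L μ * m) := by
    rw [twistLin_mul, twistLin_mono, smul_mul_assoc, smul_smul, ← Units.val_mul, ← charVal_add,
      LinearMap.neg_apply, add_neg_cancel, charVal_zero, Units.val_one, one_smul]
  rw [e5, map_smul] at key
  generalize hZ : twistLin γ (-f) (mono L μ * m) = Z at key
  simp only [twistLin_mul, map_sub, map_smul, e1, e2, e3, e4, twistLin_mono] at key
  rw [← hZ, ← conjTwist_apply, ← conjTwist_apply] at key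
  have h0 : ((charVal γ (f μ) : Lˣ) : L) ≠ 0 := Units.ne_zero _
  rw [affTdl, ← hf]
  refine smul_right_injective _ h0 ?_
  simp only [Algebra.smul_def] at key ⊢
  linear_combination key

end Twist

/-! ### Braid relations of affine operators -/

section AffineBraid

variable {ι V E : Type*} [AddCommGroup V] [Module ℝ V] [AddCommGroup E] [Module ℝ E]
  {P : RootPairing ι ℝ V E}

theorem root'_coroot_two (i : ι) : P.root' i (P.coroot i) = 2 := P.root_coroot_two i

theorem affRefl_apply (a : ι × ℤ) (y : E) :
    affRefl P a y = y - (P.root' a.1 y + (a.2 : ℝ)) • P.coroot a.1 := rfl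

/-- The hyperplanes are parallel, so the product is a translation, of infinite order, and the braid
relation is void. -/
theorem orderOf_affRefl_of_root_eq {φ j : ι} (h : P.root φ = P.root j) :
    orderOf (affRefl P (P.reflectionPerm φ φ, 1) * affRefl P (j, 0)) = 0 := by
  obtain rfl := P.root.injective h
  have h0 : ∀ y, (affRefl P (P.reflectionPerm φ φ, 1) * affRefl P (φ, 0)) y
      = y + P.coroot φ := by
    intro y
    have h1 : P.root' (P.reflectionPerm φ φ) = -P.root' φ := by
      rw [RootPairing.root', P.root_reflectionPerm]; simp [RootPairing.root']
    have h2 : P.coroot (P.reflectionPerm φ φ) = -P.coroot φ := by simp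
    rw [Equiv.Perm.mul_apply, affRefl_apply, affRefl_apply, h1, h2]
    simp only [LinearMap.neg_apply, map_sub, map_smul, root'_coroot_two, smul_eq_mul]
    push_cast
    module
  have hn : ∀ (n : ℕ) y, ((affRefl P (P.reflectionPerm φ φ, 1) * affRefl P (φ, 0)) ^ n) y
      = y + (n : ℝ) • P.coroot φ := by
    intro n
    induction n with
    | zero => intro y; simp
    | succ n ih =>
      intro y
      rw [pow_succ, Equiv.Perm.mul_apply, h0, ih]
      push_cast
      module
  rw [orderOf_eq_zero_iff']
  intro n hn0 h
  have h3 := hn n 0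
  rw [h, Equiv.Perm.one_apply, zero_add, eq_comm, smul_eq_zero] at h3
  rcases h3 with h3 | h3
  · exact hn0.ne' (by exact_mod_cast h3)
  · exact ne_zero_of_apply_eq_two (root'_coroot_two (P := P) φ) h3

variable [P.IsCrystallographic]

theorem root'_coroot_eq_pairingIn (i j : ι) :
    P.root' i (P.coroot j) = (P.pairingIn ℤ i j : ℝ) := (P.algebraMap_pairingIn ℤ i j).symm

theorem not_isEvenRoot_of_odd {i j : ι} (h : Odd (P.pairingIn ℤ i j)) : ¬ IsEvenRoot P i := by
  intro he
  have h2 := he (P.corootSpanMem ℤ j)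
  have h3 : P.root'In ℤ i (P.corootSpanMem ℤ j) = P.pairingIn ℤ i j := rfl
  rw [h3] at h2
  exact (Int.not_even_iff_odd.mpr h) h2

/-- The rank two datum of a pair of roots with nonpositive pairings. -/
noncomputable def rankTwo {i j : ι} {p q : ℕ} (hp : P.pairingIn ℤ i j = -(p : ℤ))
    (hq : P.pairingIn ℤ j i = -(q : ℤ)) : RankTwo E p q where
  α := P.root' i
  β := P.root' j
  v := P.coroot i
  w := P.coroot j
  αv := root'_coroot_two i
  βw := root'_coroot_two j
  αw := by rw [root'_coroot_eq_pairingIn, hp]; push_cast; rfl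
  βv := by rw [root'_coroot_eq_pairingIn, hq]; push_cast; rfl

variable {L : Type*} [Field L] (γ : ℝ →+ Additive Lˣ) (k : Multiplicity L P)

/-- The truncated Demazure-Lusztig operator of an affine root. -/
noncomputable def affOp (k : Multiplicity L P) (a : ι × ℤ) :
    Module.End L (AddMonoidAlgebra L E) :=
  affTdl γ (P.root' a.1) (P.coroot a.1) (k.k a) (k.u a) a.2

theorem RankTwo.exists_apply_eq {p q : ℕ} (R : RankTwo E p q) (hpq : p * q < 4) (m n : ℝ) :
    (∃ f : E →ₗ[ℝ] ℝ, f R.v = m ∧ f R.w = n) ∧ ∃ e : E, R.α e = m ∧ R.β e = n := by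
  have hd : ((4 : ℝ) - p * q) ≠ 0 := by
    have : ((p * q : ℕ) : ℝ) < 4 := by exact_mod_cast hpq
    push_cast at this
    linarith
  constructor
  · obtain ⟨s, hs⟩ : ∃ s : ℝ, s * (4 - p * q) = 2 * m + q * n := ⟨_, div_mul_cancel₀ _ hd⟩
    obtain ⟨t, ht⟩ : ∃ t : ℝ, t * (4 - p * q) = 2 * n + p * m := ⟨_, div_mul_cancel₀ _ hd⟩
    refine ⟨s • R.α + t • R.β, mul_right_cancel₀ hd ?_, mul_right_cancel₀ hd ?_⟩
    · rw [LinearMap.add_apply, LinearMap.smul_apply, LinearMap.smul_apply, R.αv, R.βv, smul_eq_mul,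
        smul_eq_mul]
      linear_combination 2 * hs - q * ht
    · rw [LinearMap.add_apply, LinearMap.smul_apply, LinearMap.smul_apply, R.αw, R.βw, smul_eq_mul,
        smul_eq_mul]
      linear_combination 2 * ht - p * hs
  · obtain ⟨s, hs⟩ : ∃ s : ℝ, s * (4 - p * q) = 2 * m + p * n := ⟨_, div_mul_cancel₀ _ hd⟩
    obtain ⟨t, ht⟩ : ∃ t : ℝ, t * (4 - p * q) = 2 * n + q * m := ⟨_, div_mul_cancel₀ _ hd⟩
    refine ⟨s • R.v + t • R.w, mul_right_cancel₀ hd ?_, mul_right_cancel₀ hd ?_⟩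
    · rw [map_add, map_smul, map_smul, R.αv, R.αw, smul_eq_mul, smul_eq_mul]
      linear_combination 2 * hs - p * ht
    · rw [map_add, map_smul, map_smul, R.βv, R.βw, smul_eq_mul, smul_eq_mul]
      linear_combination 2 * ht - q * hs

/-- The gradients are independent, so some functional f takes the constants of a and b as values on
the two co-roots and untwists both operators, while a common zero e of a and b centres the
reflections. The relation becomes the linear one of rank two. -/
theorem affOp_braid [P.IsReduced] [Finite ι] {a b : ι × ℤ} (h1 : P.root a.1 ≠ P.root b.1)
    (h2 : P.root a.1 ≠ -P.root b.1) (h3 : P.pairingIn ℤ a.1 b.1 ≤ 0)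
    {J : Type*} (T : J → Module.End L (AddMonoidAlgebra L E)) {i j : J}
    (hi : T i = affOp γ k a) (hj : T j = affOp γ k b) :
    ((CoxeterSystem.alternatingWord i j (orderOf (affRefl P a * affRefl P b))).map T).prod =
      ((CoxeterSystem.alternatingWord j i (orderOf (affRefl P a * affRefl P b))).map T).prod := by
  have hset := P.pairingIn_pairingIn_mem_set_of_isCrystal_of_isRed' a.1 b.1 h1 h2
  obtain ⟨p, q, hpq, hp, hq⟩ : ∃ p q : ℕ,
      (p, q) ∈ ({(0, 0), (1, 1), (1, 2), (2, 1), (1, 3), (3, 1)} : Set (ℕ × ℕ)) ∧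
      P.pairingIn ℤ a.1 b.1 = -(p : ℤ) ∧ P.pairingIn ℤ b.1 a.1 = -(q : ℤ) := by
    refine ⟨(-P.pairingIn ℤ a.1 b.1).toNat, (-P.pairingIn ℤ b.1 a.1).toNat, ?_⟩
    simp only [Set.mem_insert_iff, Set.mem_singleton_iff, Prod.mk.injEq] at hset ⊢
    omega
  have hlt : p * q < 4 := by
    simp only [Set.mem_insert_iff, Set.mem_singleton_iff, Prod.mk.injEq] at hpq
    rcases hpq with ⟨rfl, rfl⟩ | ⟨rfl, rfl⟩ | ⟨rfl, rfl⟩ | ⟨rfl, rfl⟩ | ⟨rfl, rfl⟩ | ⟨rfl, rfl⟩ <;>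
      norm_num
  obtain ⟨⟨f, hfv, hfw⟩, -⟩ := (rankTwo hp hq).exists_apply_eq hlt (a.2 : ℝ) (b.2 : ℝ)
  obtain ⟨-, ⟨e, hev, hew⟩⟩ := (rankTwo hp hq).exists_apply_eq hlt (-(a.2 : ℝ)) (-(b.2 : ℝ))
  refine (rankTwo hp hq).braid hpq (k := k.k a) (u := k.u a) (l := k.k b) (m := k.u b)
    (fun hpo => k.u_eq_k a (not_isEvenRoot_of_odd (j := b.1) ?_))
    (fun hqo => k.u_eq_k b (not_isEvenRoot_of_odd (j := a.1) ?_)) (fun hp1 hq1 => ?_) (e := e)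
    (S₁ := affRefl P a) (S₂ := affRefl P b) ⟨fun y => ?_, fun y => ?_⟩
    (conjTwist γ f : _ →* _) T ?_ ?_
  · rw [hp, odd_neg]; exact_mod_cast hpo
  · rw [hq, odd_neg]; exact_mod_cast hqo
  -- When both pairings are -1, s_a(b) = a + b = s_b(a), so a and b lie in one W-orbit and their
  -- parameters agree.
  · rw [← k.k_invariant a b, ← k.k_invariant b a]
    congr 1
    rw [affAct, affAct]
    refine Prod.ext (P.root.injective ?_) ?_
    · rw [P.root_reflectionPerm, P.root_reflectionPerm, P.reflection_apply_root,
        P.reflection_apply_root, ← P.algebraMap_pairingIn ℤ, ← P.algebraMap_pairingIn ℤ, hp, hq,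
        hp1, hq1]
      simp [add_comm]
    · simp only [hp, hq, hp1, hq1]
      push_cast
      ring
  · rw [affRefl_apply, map_sub, hev]
    congr 2
    change _ = P.root' a.1 y - _
    ring
  · rw [affRefl_apply, map_sub, hew]
    congr 2
    change _ = P.root' b.1 y - _
    ring
  · rw [hi, affOp, ← hfv]
    exact (conjTwist_tdl γ _ _ (root'_coroot_two a.1) f).symm
  · rw [hj, affOp, ← hfw]
    exact (conjTwist_tdl γ _ _ (root'_coroot_two b.1) f).symm

variable {b : P.Base} {φ : ι}

theorem IsHighestRoot.exists_height [P.IsRootSystem] (hφ : IsHighestRoot b φ) :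
    ∃ h : V →ₗ[ℝ] ℝ, (∀ j ∈ b.support, h (P.root j) = 1) ∧ ∀ i, h (P.root i) ≤ h (P.root φ) := by
  have h1 : ∀ j ∈ b.support, b.toWeightBasis.constr ℝ (fun _ => (1 : ℝ)) (P.root j) = 1 := by
    intro j hj
    have := b.toWeightBasis.constr_basis ℝ (fun _ => (1 : ℝ)) ⟨j, hj⟩
    rwa [RootPairing.Base.toWeightBasis_apply] at this
  refine ⟨_, h1, fun i => ?_⟩
  rw [← sub_nonneg, ← map_sub]
  have hi := hφ i
  revert hi
  generalize P.root φ - P.root i = x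
  intro hi
  induction hi using AddSubmonoid.closure_induction with
  | mem x hx =>
    obtain ⟨j, hj, rfl⟩ := hx
    rw [h1 j hj]
    exact zero_le_one
  | zero => rw [map_zero]
  | add x y _ _ hx hy => rw [map_add]; exact add_nonneg hx hy

/-- Reflecting φ in a simple root lowers its height by the pairing, and no root is higher than φ. -/
theorem IsHighestRoot.pairingIn_nonneg [P.IsRootSystem] (hφ : IsHighestRoot b φ) {j : ι}
    (hj : j ∈ b.support) : 0 ≤ P.pairingIn ℤ φ j := by
  obtain ⟨h, h1, h2⟩ := hφ.exists_height
  have h3 := h2 (P.reflectionPerm j φ)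
  rw [P.root_reflectionPerm, P.reflection_apply_root, map_sub, map_smul, h1 j hj, smul_eq_mul,
    mul_one, sub_le_self_iff, ← P.algebraMap_pairingIn ℤ] at h3
  exact (Int.cast_nonneg_iff (R := ℝ)).mp h3

theorem IsHighestRoot.root_ne_neg [P.IsRootSystem] (hφ : IsHighestRoot b φ) {j : ι}
    (hj : j ∈ b.support) : P.root φ ≠ -P.root j := by
  intro h'
  obtain ⟨h, h1, h2⟩ := hφ.exists_height
  have h3 := h2 j
  rw [h', map_neg, h1 j hj] at h3
  linarith

theorem affOp_braid_simpleAff [Finite ι] [P.IsRootSystem] [P.IsReduced] (hφ : IsHighestRoot b φ) {i j : Option b.support}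
    (hij : i ≠ j) (T : Option b.support → Module.End L (AddMonoidAlgebra L E))
    (hT : ∀ i, T i = affOp γ k (simpleAff b φ i)) :
    ((CoxeterSystem.alternatingWord i j (orderOf
        (affRefl P (simpleAff b φ i) * affRefl P (simpleAff b φ j)))).map T).prod =
      ((CoxeterSystem.alternatingWord j i (orderOf
        (affRefl P (simpleAff b φ i) * affRefl P (simpleAff b φ j)))).map T).prod := by
  have hnone : ∀ j : b.support,
      ((CoxeterSystem.alternatingWord none (some j) (orderOf
        (affRefl P (simpleAff b φ none) * affRefl P (simpleAff b φ (some j))))).map T).prod =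
      ((CoxeterSystem.alternatingWord (some j) none (orderOf
        (affRefl P (simpleAff b φ none) * affRefl P (simpleAff b φ (some j))))).map T).prod := by
    intro j
    have hr : P.root (simpleAff b φ none).1 = -P.root φ := by
      rw [simpleAff, P.root_reflectionPerm, P.reflection_apply_self]
    by_cases hj : P.root φ = P.root j
    · rw [simpleAff, simpleAff, orderOf_affRefl_of_root_eq hj]
      rfl
    · refine affOp_braid γ k ?_ ?_ ?_ T (hT _) (hT _)
      · rw [hr]
        intro h
        exact hφ.root_ne_neg j.2 (by rw [← neg_neg (P.root φ), h]; rfl)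
      · rw [hr]
        exact fun h => hj (neg_injective h)
      · have := hφ.pairingIn_nonneg j.2
        change P.pairingIn ℤ (P.reflectionPerm φ φ) j ≤ 0
        rw [P.pairingIn_reflectionPerm_self_left]
        exact neg_nonpos.mpr this
  rcases i with _ | i <;> rcases j with _ | j
  · exact absurd rfl hij
  · exact hnone j
  · rw [RankTwo.orderOf_mul_swap]
    exact (hnone i).symm
  · have hij' : (i : ι) ≠ j := fun h => hij (by rw [Subtype.ext h])
    refine affOp_braid γ k (fun h => hij' (P.root.injective h))
      (b.root_ne_neg_of_ne i.2 j.2 hij') (b.pairingIn_le_zero_of_ne hij' i.2 j.2) T (hT _) (hT _)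

end AffineBraid

/-! ### Extension of scalars and of exponents -/

section Extend

variable {F L : Type*} [Field F] [Field L] [Algebra F L] {G E : Type*} [AddCommGroup G]
  [AddCommGroup E]

variable (L) in
/-- The map `F[G] → L[E]` induced by a homomorphism `G → E`. -/
noncomputable def extend (g : G →+ E) : AddMonoidAlgebra F G →ₗ[F] AddMonoidAlgebra L E :=
  linExt fun y => mono L (g y)

theorem extend_mono (g : G →+ E) (y : G) : extend L g (mono F y) = mono L (g y) := linExt_mono _ _

theorem extend_one (g : G →+ E) : extend L g (1 : AddMonoidAlgebra F G) = 1 := by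
  rw [← mono_zero, extend_mono, map_zero, mono_zero]

theorem extend_mul (g : G →+ E) (m m' : AddMonoidAlgebra F G) :
    extend L g (m * m') = extend L g m * extend L g m' := by
  induction m using mono_induction with
  | h y =>
    induction m' using mono_induction with
    | h z => rw [mono_mul, extend_mono, extend_mono, extend_mono, map_add, mono_mul]
    | hadd a b ha hb => rw [mul_add, map_add, ha, hb, map_add, mul_add]
    | hsmul c a ha => rw [mul_smul_comm, map_smul, ha, map_smul, mul_smul_comm]
  | hadd a b ha hb => rw [add_mul, map_add, ha, hb, map_add, add_mul]
  | hsmul c a ha => rw [smul_mul_assoc, map_smul, ha, map_smul, smul_mul_assoc]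

theorem extend_injective (g : G →+ E) (hg : Function.Injective g) :
    Function.Injective (extend L g : AddMonoidAlgebra F G →ₗ[F] AddMonoidAlgebra L E) := by
  have h : ∀ (m : AddMonoidAlgebra F G) (y : G),
      (extend L g m).coeff (g y) = algebraMap F L (m.coeff y) := by
    intro m y
    induction m using mono_induction with
    | h z =>
      classical
      rw [extend_mono, mono, mono, AddMonoidAlgebra.coeff_single, AddMonoidAlgebra.coeff_single,
        Finsupp.single_apply, Finsupp.single_apply, hg.eq_iff]
      split_ifs <;> simp
    | hadd a b ha hb =>
      rw [map_add, AddMonoidAlgebra.coeff_add, AddMonoidAlgebra.coeff_add, Finsupp.add_apply,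
        Finsupp.add_apply, ha, hb, map_add]
    | hsmul c a ha =>
      rw [map_smul, AddMonoidAlgebra.coeff_smul, AddMonoidAlgebra.coeff_smul, Finsupp.smul_apply,
        Finsupp.smul_apply, ha, smul_eq_mul, map_mul, Algebra.smul_def]
  intro m m' hm
  refine AddMonoidAlgebra.coeff_injective (Finsupp.ext fun y => ?_)
  apply (algebraMap F L).injective
  rw [← h, ← h, hm]

/-- The image of a unit. -/
def unitMap (L : Type*) [Field L] [Algebra F L] (k : Fˣ) : Lˣ := Units.map (algebraMap F L) k

theorem coe_unitMap (k : Fˣ) : (unitMap L k : L) = algebraMap F L k := rfl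

theorem coe_inv_unitMap (k : Fˣ) : (((unitMap L k)⁻¹ : Lˣ) : L) = algebraMap F L (k⁻¹ : Fˣ) := by
  rw [unitMap, ← map_inv]; rfl

theorem sub_unitMap (k : Fˣ) : (unitMap L k : L) - ((unitMap L k)⁻¹ : Lˣ)
    = algebraMap F L ((k : F) - (k⁻¹ : Fˣ)) := by
  rw [coe_inv_unitMap, map_sub]; rfl

theorem extend_tdl [Module ℝ E] {α : E →ₗ[ℝ] ℝ} {v : E} (hv : v ≠ 0) (k u : Fˣ)
    (m : AddMonoidAlgebra F E) : extend L (AddMonoidHom.id E) (tdl α v k u m)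
      = tdl α v (unitMap L k) (unitMap L u) (extend L (AddMonoidHom.id E) m) := by
  have hden : extend L (AddMonoidHom.id E) (den F v) = den L v := by
    rw [den, map_sub, extend_one, extend_mono]; rfl
  induction m using mono_induction with
  | h y =>
    apply mul_left_cancel₀ (den_ne_zero (F := L) hv)
    have hz : ((unitMap L k ^ chiE (α y) * unitMap L u ^ chiO (α y) : Lˣ) : L)
        = algebraMap F L ((k ^ chiE (α y) * u ^ chiO (α y) : Fˣ) : F) := by
      rw [unitMap, unitMap, ← map_zpow, ← map_zpow, ← map_mul]; rfl
    conv_lhs => rw [← hden]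
    rw [← extend_mul, den_mul_tdl_mono, extend_mono, AddMonoidHom.id_apply, den_mul_tdl_mono, num,
      num, hz, sub_unitMap, sub_unitMap]
    simp only [LinearMap.map_add, LinearMap.map_sub, LinearMap.map_smul, extend_mul, hden,
      extend_one, extend_mono, algebraMap_smul, AddMonoidHom.id_apply]
  | hadd a b ha hb => simp only [map_add, ha, hb]
  | hsmul c a ha => rw [map_smul, map_smul, ha, map_smul, LinearMap.map_smul_of_tower]

end Extend

/-! ### The representation of the double affine Hecke algebra over the algebraic closure. -/

section DahaRep

variable {F ι V E : Type*} [Field F] [AddCommGroup V] [Module ℝ V] [AddCommGroup E]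
  [Module ℝ E] {P : RootPairing ι ℝ V E} [P.IsCrystallographic]

/-- Extension of scalars of a multiplicity function. -/
def Multiplicity.extend (k : Multiplicity F P) (L : Type*) [Field L] [Algebra F L] :
    Multiplicity L P where
  k a := unitMap L (k.k a)
  u a := unitMap L (k.u a)
  k_invariant a c := by rw [k.k_invariant]
  u_invariant a c := by rw [k.u_invariant]
  u_eq_k a h := by rw [k.u_eq_k a h]

variable {L : Type*} [Field L] [Algebra F L] (γ : ℝ →+ Additive Lˣ) (b : P.Base) (φ : ι)
  (k : Multiplicity F P)

/-- The representation of the free algebra on `L[E]`. -/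
noncomputable def freeRep :
    FreeAlgebra F (Gen b) →ₐ[F] Module.End L (AddMonoidAlgebra L E) :=
  FreeAlgebra.lift F fun
    | .X μ => LinearMap.mulLeft L (mono L (μ : E))
    | .T j => affOp γ (k.extend L) (simpleAff b φ j)

theorem freeRep_freeT (j : Option b.support) :
    freeRep γ b φ k (freeT F b j) = affOp γ (k.extend L) (simpleAff b φ j) :=
  FreeAlgebra.lift_ι_apply _ _

variable (P) in
/-- The inclusion of the co-root lattice. -/
def corootIncl : P.corootSpan ℤ →+ E := (P.corootSpan ℤ).subtype.toAddMonoidHom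

theorem corootIncl_apply (μ : P.corootSpan ℤ) : corootIncl P μ = (μ : E) := rfl

theorem freeRep_freeX (p : AddMonoidAlgebra F (P.corootSpan ℤ)) :
    freeRep γ b φ k (freeX b p) = LinearMap.mulLeft L (extend L (corootIncl P) p) := by
  induction p using mono_induction with
  | h y =>
    rw [extend_mono, freeX, linExt_mono]
    exact FreeAlgebra.lift_ι_apply _ _
  | hadd p p' hp hp' =>
    refine LinearMap.ext fun m => ?_
    rw [map_add, map_add, hp, hp', map_add]
    simp [add_mul]
  | hsmul c p hp =>
    refine LinearMap.ext fun m => ?_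
    rw [map_smul, map_smul, hp, map_smul]
    simp

variable [Finite ι] [P.IsRootSystem] [P.IsReduced]

theorem freeRep_rel (hφ : IsHighestRoot b φ) (q : Fˣ)
    (hγ : γ 1 = Additive.ofMul (unitMap L q)) {s t : FreeAlgebra F (Gen b)}
    (h : DahaRel b φ k q s t) : freeRep γ b φ k s = freeRep γ b φ k t := by
  induction h with
  | braid i j hij =>
    rw [map_list_prod, map_list_prod, List.map_map, List.map_map]
    exact affOp_braid_simpleAff γ (k.extend L) hφ hij _ fun i => freeRep_freeT γ b φ k i
  | quad j =>
    rw [map_mul, map_sub, map_add, map_smul, map_smul, map_one, map_zero, freeRep_freeT]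
    have := affTdl_quadratic γ (α := P.root' (simpleAff b φ j).1)
      ((k.extend L).k (simpleAff b φ j)) ((k.extend L).u (simpleAff b φ j)) (root'_coroot_two _)
      ((simpleAff b φ j).2 : ℝ)
    change (affOp γ (k.extend L) (simpleAff b φ j) - _) *
      (affOp γ (k.extend L) (simpleAff b φ j) + _) = 0 at this
    rw [← this]
    refine LinearMap.ext fun m => ?_
    simp only [Module.End.mul_apply, LinearMap.sub_apply, LinearMap.add_apply, LinearMap.smul_apply,
      Module.End.one_apply, Multiplicity.extend, coe_unitMap, coe_inv_unitMap, algebraMap_smul]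
  | mul μ ν =>
    rw [map_mul, freeRep_freeX, freeRep_freeX, freeRep_freeX, ← mono_mul, extend_mul]
    refine LinearMap.ext fun m => ?_
    exact (mul_assoc _ _ _).symm
  | one =>
    rw [mono_zero, freeRep_freeX, extend_one, map_one, LinearMap.mulLeft_one]
    rfl
  | cross j μ =>
    generalize hT : freeRep γ b φ k (freeT F b j) = T
    rw [freeRep_freeT] at hT
    rw [map_sub, map_mul, map_mul, freeRep_freeX, freeRep_freeX, freeRep_freeX, freeRep_freeT, hT]
    generalize simpleAff b φ j = a at hT
    have hq : ∀ n : ℤ, algebraMap F L ((q ^ n : Fˣ) : F) = (charVal γ n : L) := by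
      intro n
      rw [charVal_intCast γ _ hγ, unitMap, ← map_zpow]; rfl
    have hμ : P.root' a.1 (μ : E) = (P.root'In ℤ a.1 μ : ℝ) :=
      (P.algebraMap_root'In_apply ℤ a.1 μ).symm
    have e0 : ∀ (x : P.corootSpan ℤ) (c : F), extend L (corootIncl P)
        (AddMonoidAlgebra.single x c) = algebraMap F L c • mono L (x : E) := by
      intro x c
      have : AddMonoidAlgebra.single x c = c • mono F x := by simp [mono]
      rw [this, map_smul, extend_mono, algebraMap_smul]; rfl
    have eF : ∀ (c : F) (m : AddMonoidAlgebra L E), c • m = algebraMap F L c • m :=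
      fun c m => (algebraMap_smul L c m).symm
    have e1 : extend L (corootIncl P) (corootMono q a)
        = (charVal γ a.2 : L) • mono L (P.coroot a.1) := by
      rw [corootMono, e0, hq]
    have e2 : extend L (corootIncl P) (reflMono q a μ)
        = (charVal γ (-(P.root' a.1 (μ : E) * a.2)) : L)
          • mono L ((μ : E) - P.root' a.1 (μ : E) • P.coroot a.1) := by
      rw [reflMono, e0, hq, hμ]
      congr 3
      · push_cast; ring
      · rw [Int.cast_smul_eq_zsmul]; rfl
    -- The cross relation is known with its denominator cleared; this nonvanishing permits
    -- cancelling it.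
    have hd : (1 : AddMonoidAlgebra L E) - ((charVal γ a.2 : L) • mono L (P.coroot a.1)) ^ 2 ≠ 0 := by
      intro h0
      have h1 := congrArg (fun m => m.coeff 0) (sub_eq_zero.mp h0)
      have h2 : P.coroot a.1 + P.coroot a.1 ≠ 0 := by
        rw [← two_smul ℝ]
        exact smul_ne_zero two_ne_zero (ne_zero_of_apply_eq_two (root'_coroot_two a.1))
      rw [sq, smul_mul_smul_comm, mono_mul, ← mono_zero] at h1
      simp [mono, h2] at h1
    refine LinearMap.ext fun m => mul_left_cancel₀ hd ?_
    have hpar : Even (P.root'In ℤ a.1 μ) ∨ (k.extend L).k a = (k.extend L).u a := by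
      by_cases he : IsEvenRoot P a.1
      · exact Or.inl (he μ)
      · exact Or.inr ((k.extend L).u_eq_k a he).symm
    have key := affTdl_cross γ (v := P.coroot a.1) (root'_coroot_two a.1) hμ hpar a.2 m
    have hc := congrArg (extend L (corootIncl P)) (exactQuot_mul (crossTerm_dvd k q a μ))
    rw [← crossTerm, extend_mul, extend_mul, map_sub, map_sub, map_add, map_smul, map_smul,
      extend_one, sq, extend_mul, e1, e2, eF, eF, ← sub_unitMap,
      ← sub_unitMap, extend_mono, corootIncl_apply] at hc
    change _ * (T (extend L (corootIncl P) (mono F μ) * m) - extend L (corootIncl P) _ * T m)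
      = _ * (extend L (corootIncl P) _ * m)
    rw [← hT, extend_mono, corootIncl_apply, e2]
    refine key.trans ?_
    rw [sq, ← mul_assoc, mul_comm _ (extend L (corootIncl P) _), hc]
    rfl

/-- The representation of the double affine Hecke algebra on `L[E]`. -/
theorem exists_dahaRep [IsAlgClosed L] (hφ : IsHighestRoot b φ) (q : Fˣ) :
    ∃ ρ : Daha b φ k q →ₐ[F] Module.End L (AddMonoidAlgebra L E),
      (∀ (μ : P.corootSpan ℤ) m, ρ (dahaX b φ k q μ) m = mono L (μ : E) * m) ∧
      ∀ i : b.support, ρ (dahaT b φ k q (some i))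
        = tdl (P.root' i) (P.coroot i) (unitMap L (k.k (i, 0))) (unitMap L (k.u (i, 0))) := by
  obtain ⟨γ, hγ⟩ := exists_character (unitMap L q)
  refine ⟨RingQuot.liftAlgHom F ⟨freeRep γ b φ k, fun _ _ h => freeRep_rel γ b φ k hφ q hγ h⟩,
    fun μ m => ?_, fun i => ?_⟩
  · rw [dahaX, RingQuot.liftAlgHom_mkAlgHom_apply, freeRep_freeX, extend_mono]
    rfl
  · rw [dahaT, RingQuot.liftAlgHom_mkAlgHom_apply, freeRep_freeT]
    have := affTdl_zero γ (unitMap L (k.k (i, 0))) (unitMap L (k.u (i, 0)))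
      (root'_coroot_two (P := P) (i : ι))
    rw [← this, affOp]
    simp [simpleAff, Multiplicity.extend]

end DahaRep

/-! ### Descent to F and restriction to H^X. -/

theorem exists_restrict {F A M N : Type*} [Field F] [Ring A] [Algebra F A] [AddCommGroup M]
    [Module F M] [AddCommGroup N] {L : Type*} [Field L] [Algebra F L] [Module F N] [Module L N]
    [IsScalarTower F L N] (f : A →ₐ[F] Module.End L N) (j : M →ₗ[F] N)
    (hj : Function.Injective j) (X : Set A)
    (hX : ∀ a ∈ X, ∃ T : Module.End F M, ∀ m, f a (j m) = j (T m)) :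
    ∃ π : Algebra.adjoin F X →ₐ[F] Module.End F M,
      ∀ (a : Algebra.adjoin F X) m, f a (j m) = j (π a m) := by
  -- Elements preserving the image of j form a subalgebra, so the generators suffice. Injectivity of
  -- j makes the induced operator unique, hence multiplicative in a.
  have h : ∀ a : Algebra.adjoin F X, ∃ T : Module.End F M, ∀ m, f a (j m) = j (T m) := by
    rintro ⟨a, ha⟩
    induction ha using Algebra.adjoin_induction with
    | mem x hx => exact hX x hx
    | algebraMap c =>
      refine ⟨algebraMap F _ c, fun m => ?_⟩
      change f (algebraMap F A c) _ = _
      rw [AlgHom.commutes, Module.algebraMap_end_apply]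
      exact (map_smul j c m).symm
    | add x y hx hy hx' hy' =>
      obtain ⟨S, hS⟩ := hx'
      obtain ⟨T, hT⟩ := hy'
      refine ⟨S + T, fun m => ?_⟩
      change f (x + y) _ = _
      rw [map_add, LinearMap.add_apply, LinearMap.add_apply, map_add, ← hS, ← hT]
    | mul x y hx hy hx' hy' =>
      obtain ⟨S, hS⟩ := hx'
      obtain ⟨T, hT⟩ := hy'
      refine ⟨S * T, fun m => ?_⟩
      change f (x * y) _ = _
      rw [map_mul, Module.End.mul_apply, Module.End.mul_apply, ← hS, ← hT]
  choose T hT using h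
  refine ⟨AlgHom.ofLinearMap ⟨⟨T, fun a a' => ?_⟩, fun c a => ?_⟩ ?_ fun a a' => ?_, hT⟩
  · refine LinearMap.ext fun m => hj ?_
    rw [← hT, LinearMap.add_apply, map_add, ← hT, ← hT, Subalgebra.coe_add, map_add,
      LinearMap.add_apply]
  · refine LinearMap.ext fun m => hj ?_
    rw [← hT, LinearMap.smul_apply, map_smul, RingHom.id_apply, ← hT, Subalgebra.coe_smul, map_smul]
    rfl
  · refine LinearMap.ext fun m => hj ?_
    change j (T 1 m) = _
    rw [← hT, Subalgebra.coe_one, map_one]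
    rfl
  · refine LinearMap.ext fun m => hj ?_
    change j (T (a * a') m) = j (T a (T a' m))
    rw [← hT, ← hT, ← hT, Subalgebra.coe_mul, map_mul, Module.End.mul_apply]

theorem truncDL_eq_tdl {F ι V E : Type*} [Field F] [AddCommGroup V] [Module ℝ V] [AddCommGroup E]
    [Module ℝ E] {P : RootPairing ι ℝ V E} [P.IsCrystallographic] (k : Multiplicity F P) (i : ι) :
    truncDL k i = tdl (P.root' i) (P.coroot i) (k.k (i, 0)) (k.u (i, 0)) := by
  refine linearMap_ext_mono fun y => ?_
  rw [truncDL, tdl, linExt_mono, linExt_mono, nablaE, nablaO, linExt_mono, linExt_mono,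
    affRefl_apply]
  simp

/-- The representation of `H^X` on quasi-polynomials. -/
theorem exists_rep {F ι V E : Type*} [Field F] [Finite ι] [AddCommGroup V]
    [Module ℝ V] [AddCommGroup E] [Module ℝ E] {P : RootPairing ι ℝ V E} [P.IsRootSystem]
    [P.IsCrystallographic] [P.IsReduced] (b : P.Base) (φ : ι) (hφ : IsHighestRoot b φ)
    (k : Multiplicity F P) (q : Fˣ) :
    ∃ π : HX b φ k q →ₐ[F] Module.End F (AddMonoidAlgebra F E),
      (∀ (μ : P.corootSpan ℤ) (y : E), π (hxX b φ k q μ) (mono F y) = mono F (y + (μ : E))) ∧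
      ∀ i : b.support, π (hxT b φ k q i) = truncDL k i := by
  obtain ⟨ρ, hρX, hρT⟩ := exists_dahaRep (L := AlgebraicClosure F) b φ k hφ q
  have hj := extend_injective (F := F) (L := AlgebraicClosure F) (AddMonoidHom.id E)
    Function.injective_id
  have hX : ∀ μ m, ρ (dahaX b φ k q μ) (extend (AlgebraicClosure F) (AddMonoidHom.id E) m)
      = extend (AlgebraicClosure F) (AddMonoidHom.id E) (mono F (μ : E) * m) := by
    intro μ m
    rw [hρX, extend_mul, extend_mono]
    rfl
  have hT : ∀ i m, ρ (dahaT b φ k q (some i))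
      (extend (AlgebraicClosure F) (AddMonoidHom.id E) m)
      = extend (AlgebraicClosure F) (AddMonoidHom.id E) (truncDL k i m) := by
    intro i m
    rw [hρT, truncDL_eq_tdl, extend_tdl (ne_zero_of_apply_eq_two (root'_coroot_two (i : ι)))]
  obtain ⟨π, hπ⟩ := exists_restrict ρ (extend (AlgebraicClosure F) (AddMonoidHom.id E)) hj
    (Set.range (dahaX b φ k q) ∪ Set.range fun i : b.support => dahaT b φ k q (some i)) (by
      rintro _ (⟨μ, rfl⟩ | ⟨i, rfl⟩)
      · exact ⟨LinearMap.mulLeft F (mono F (μ : E)), hX μ⟩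
      · exact ⟨truncDL k i, hT i⟩)
  refine ⟨π, fun μ y => hj ?_, fun i => LinearMap.ext fun m => hj ?_⟩
  · exact (hπ (hxX b φ k q μ) (mono F y)).symm.trans ((hX μ _).trans (by rw [mono_mul, add_comm]))
  · exact (hπ (hxT b φ k q i) m).symm.trans (hT i m)

theorem rep_unique {F ι V E : Type*} [Field F] [AddCommGroup V]
    [Module ℝ V] [AddCommGroup E] [Module ℝ E] {P : RootPairing ι ℝ V E}
    [P.IsCrystallographic] {b : P.Base} {φ : ι}
    {k : Multiplicity F P} {q : Fˣ} {A : Type*} [Semiring A] [Algebra F A]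
    {π π' : HX b φ k q →ₐ[F] A}
    (hX : ∀ μ, π (hxX b φ k q μ) = π' (hxX b φ k q μ))
    (hT : ∀ i, π (hxT b φ k q i) = π' (hxT b φ k q i)) : π = π' := by
  refine AlgHom.adjoin_ext fun x hx => ?_
  rcases hx with ⟨μ, rfl⟩ | ⟨i, rfl⟩
  · exact hX μ
  · exact hT i

/-! ### The decomposition into orbits -/

section Orbits

theorem mono_mem_quasiSpan {F E : Type*} [Field F] {Z : Set E} {y : E} (h : y ∈ Z) : mono F y ∈ quasiSpan F Z :=
  Submodule.subset_span ⟨y, h, rfl⟩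

theorem quasiSpan_mono {F E : Type*} [Field F] {Z Z' : Set E} (h : Z ⊆ Z') : quasiSpan F Z ≤ quasiSpan F Z' :=
  Submodule.span_mono (Set.image_mono h)

theorem coeff_eq_zero_of_mem_quasiSpan {F E : Type*} [Field F] {Z : Set E} {m : AddMonoidAlgebra F E}
    (h : m ∈ quasiSpan F Z) {y : E} (hy : y ∉ Z) : m.coeff y = 0 := by
  induction h using Submodule.span_induction with
  | mem x hx =>
    obtain ⟨z, hz, rfl⟩ := hx
    have : z ≠ y := fun h => hy (h ▸ hz)
    simp [mono, this]
  | zero => simp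
  | add a b _ _ ha hb => simp [ha, hb]
  | smul c a _ ha => simp [ha]

variable {F E : Type*} [Field F] [AddCommGroup E]

theorem disjoint_quasiSpan {F E : Type*} [Field F] {Z Z' : Set E} (h : Disjoint Z Z') :
    Disjoint (quasiSpan F Z) (quasiSpan F Z') := by
  rw [Submodule.disjoint_def]
  intro m hm hm'
  refine AddMonoidAlgebra.coeff_injective (Finsupp.ext fun y => ?_)
  by_cases hy : y ∈ Z
  · exact coeff_eq_zero_of_mem_quasiSpan hm' (Set.disjoint_left.mp h hy)
  · exact coeff_eq_zero_of_mem_quasiSpan hm hy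

open Classical in
theorem isInternal_quasiSpan_orbit (G : Type*) [Group G] [MulAction G E] :
    DirectSum.IsInternal fun O : MulAction.orbitRel.Quotient G E => quasiSpan F O.orbit := by
  apply DirectSum.isInternal_submodule_of_iSupIndep_of_iSup_eq_top
  · intro O
    have h : ⨆ (O') (_ : O' ≠ O), quasiSpan F (MulAction.orbitRel.Quotient.orbit O')
        ≤ quasiSpan F O.orbitᶜ := by
      refine iSup₂_le fun O' hO' => quasiSpan_mono fun y hy hy' => hO' ?_
      rw [MulAction.orbitRel.Quotient.mem_orbit] at hy hy'
      rw [← hy, hy']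
    exact (disjoint_quasiSpan disjoint_compl_right).mono_right h
  · rw [eq_top_iff]
    intro m _
    induction m using mono_induction with
    | h y =>
      exact Submodule.mem_iSup_of_mem (Quotient.mk _ y)
        (mono_mem_quasiSpan (MulAction.orbitRel.Quotient.mem_orbit.mpr rfl))
    | hadd a b ha hb => exact add_mem (ha trivial) (hb trivial)
    | hsmul c a ha => exact Submodule.smul_mem _ _ (ha trivial)

theorem extend_mul_mono_mem {Z : Set E} {v y : E} (h : ∀ n : ℤ, y + n • v ∈ Z)
    (d : AddMonoidAlgebra F ℤ) : extend F (zmultiplesHom E v) d * mono F y ∈ quasiSpan F Z := by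
  induction d using mono_induction with
  | h n =>
    rw [extend_mono, mono_mul, add_comm]
    exact mono_mem_quasiSpan (h n)
  | hadd a b ha hb => rw [map_add, add_mul]; exact add_mem ha hb
  | hsmul c a ha => rw [map_smul, smul_mul_assoc]; exact Submodule.smul_mem _ _ ha

variable [Module ℝ E]

/-- The division can be performed in F[ℤ]; as quotients are unique in the domain F[E], the exact
quotient is a Laurent polynomial in x^v and moves exponents only by integral multiples of v. -/
theorem evenQuot_eq_extend {v : E} (hv : v ≠ 0) {n : ℤ} (hn : Even n) :
    ∃ d : AddMonoidAlgebra F ℤ, exactQuot (1 - mono F (n • v)) (1 - mono F ((2 : ℤ) • v))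
      = extend F (zmultiplesHom E v) d := by
  obtain ⟨m, rfl⟩ := hn
  obtain ⟨d, hd⟩ := one_sub_mono_dvd (F := F) (2 : ℤ) m
  refine ⟨d, exactQuot_eq (den_ne_zero hv) ?_⟩
  have h := congrArg (extend F (zmultiplesHom E v)) hd
  rw [extend_mul, map_sub, map_sub, extend_one, extend_mono, extend_mono] at h
  rw [mul_comm, ← mul_two, mul_comm m 2]
  simpa [mul_comm] using h.symm

theorem oddQuot_eq_extend {v : E} (hv : v ≠ 0) {n : ℤ} (hn : Odd n) :
    ∃ d : AddMonoidAlgebra F ℤ, exactQuot (mono F v - mono F (n • v)) (1 - mono F ((2 : ℤ) • v))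
      = extend F (zmultiplesHom E v) d := by
  obtain ⟨m, rfl⟩ := hn
  obtain ⟨d, hd⟩ := evenQuot_eq_extend (F := F) hv (even_two_mul m)
  refine ⟨mono F 1 * d, exactQuot_eq (den_ne_zero hv) ?_⟩
  have h := evenQuot_mul (F := F) v (2 * m) (even_two_mul m)
  rw [hd, den] at h
  rw [extend_mul, mul_assoc, h, extend_mono, mul_sub, mul_one, mono_mul, add_smul, one_smul,
    zmultiplesHom_apply, one_smul, add_comm]

theorem tdl_mono_mem_quasiSpan {α : E →ₗ[ℝ] ℝ} {v : E} (hv : v ≠ 0) (k u : Fˣ) {Z : Set E} {y : E}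
    (hs : y - α y • v ∈ Z) (h : ∀ n : ℤ, y + n • v ∈ Z) :
    tdl α v k u (mono F y) ∈ quasiSpan F Z := by
  obtain ⟨d, hd⟩ := evenQuot_eq_extend (F := F) hv (even_neg_floorE (α y))
  obtain ⟨d', hd'⟩ := oddQuot_eq_extend (F := F) hv (odd_neg_floorO (α y))
  rw [tdl, linExt_mono, hd, hd']
  exact add_mem (add_mem (Submodule.smul_mem _ _ (mono_mem_quasiSpan hs))
    (Submodule.smul_mem _ _ (extend_mul_mono_mem h d)))
    (Submodule.smul_mem _ _ (extend_mul_mono_mem h d'))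

variable {ι V : Type*} [AddCommGroup V] [Module ℝ V] {P : RootPairing ι ℝ V E}

theorem affRefl_mem_orbit (a : ι × ℤ) (y : E) :
    affRefl P a y ∈ MulAction.orbit (affWeyl P) y :=
  ⟨⟨affRefl P a, Subgroup.subset_closure ⟨a, rfl⟩⟩, rfl⟩

/-- Reflections in the parallel hyperplanes α = 0 and α = 1 compose to translation by the co-root,
so W contains all translations by the co-root lattice. -/
theorem add_mem_orbit {μ : E} (hμ : μ ∈ P.corootSpan ℤ) (y : E) :
    y + μ ∈ MulAction.orbit (affWeyl P) y := by
  rw [RootPairing.corootSpan, ← Submodule.mem_toAddSubgroup,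
    Submodule.span_int_eq_addSubgroupClosure] at hμ
  induction hμ using AddSubgroup.closure_induction generalizing y with
  | mem x hx =>
    obtain ⟨i, rfl⟩ := hx
    have h := affRefl_mem_orbit (P := P) (i, -1) (affRefl P (i, 0) y)
    rw [MulAction.orbit_eq_iff.mpr (affRefl_mem_orbit (P := P) (i, 0) y)] at h
    convert h using 1
    rw [affRefl_apply, affRefl_apply, map_sub, map_smul, root'_coroot_two]
    simp only [smul_eq_mul]
    push_cast
    module
  | zero => rw [add_zero]; exact MulAction.mem_orbit_self y
  | add a b _ _ ha hb =>
    rw [← add_assoc, ← MulAction.orbit_eq_iff.mpr (ha y)]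
    exact hb _
  | neg a _ ha =>
    have := ha (y + -a)
    rw [neg_add_cancel_right] at this
    exact (MulAction.mem_orbit_symm).mp this

theorem truncDL_mono_mem_orbit [P.IsCrystallographic] (k : Multiplicity F P) (i : ι) (y : E) :
    truncDL k i (mono F y) ∈ quasiSpan F (MulAction.orbit (affWeyl P) y) := by
  rw [truncDL_eq_tdl]
  refine tdl_mono_mem_quasiSpan (ne_zero_of_apply_eq_two (root'_coroot_two i)) _ _ ?_ fun n => ?_
  · simpa [affRefl_apply] using affRefl_mem_orbit (P := P) (i, 0) y
  · exact add_mem_orbit (Submodule.smul_mem _ n (Submodule.subset_span ⟨i, rfl⟩)) y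

theorem rep_mem_quasiSpan [P.IsCrystallographic] {b : P.Base} {φ : ι} {k : Multiplicity F P}
    {q : Fˣ} {π : HX b φ k q →ₐ[F] Module.End F (AddMonoidAlgebra F E)}
    (hX : ∀ (μ : P.corootSpan ℤ) (y : E), π (hxX b φ k q μ) (mono F y) = mono F (y + (μ : E)))
    (hT : ∀ i : b.support, π (hxT b φ k q i) = truncDL k i)
    (O : MulAction.orbitRel.Quotient (affWeyl P) E) (h : HX b φ k q) (p : AddMonoidAlgebra F E)
    (hp : p ∈ quasiSpan F O.orbit) : π h p ∈ quasiSpan F O.orbit := by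
  have hO : ∀ y ∈ O.orbit, MulAction.orbit (affWeyl P) y = O.orbit := by
    intro y hy
    rw [MulAction.orbitRel.Quotient.mem_orbit] at hy
    rw [← hy]; rfl
  have hgen : ∀ f : Module.End F (AddMonoidAlgebra F E),
      (∀ y ∈ O.orbit, f (mono F y) ∈ quasiSpan F O.orbit) →
      ∀ p ∈ quasiSpan F O.orbit, f p ∈ quasiSpan F O.orbit := by
    intro f hf p hp
    have : quasiSpan F O.orbit ≤ (quasiSpan F O.orbit).comap f := by
      refine Submodule.span_le.mpr ?_
      rintro _ ⟨y, hy, rfl⟩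
      exact hf y hy
    exact this hp
  obtain ⟨a, ha⟩ := h
  induction ha using Algebra.adjoin_induction generalizing p with
  | mem x hx =>
    rcases hx with ⟨μ, rfl⟩ | ⟨i, rfl⟩
    · refine hgen (π (hxX b φ k q μ)) (fun y hy => ?_) p hp
      rw [hX]
      exact mono_mem_quasiSpan (hO y hy ▸ add_mem_orbit μ.2 y)
    · refine hgen (π (hxT b φ k q i)) (fun y hy => ?_) p hp
      rw [hT, ← hO y hy]
      exact truncDL_mono_mem_orbit k i y
  | algebraMap c =>
    change π (algebraMap F _ c) p ∈ _
    rw [AlgHom.commutes, Module.algebraMap_end_apply]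
    exact Submodule.smul_mem _ _ hp
  | add x y hx hy hx' hy' =>
    change π (⟨x, hx⟩ + ⟨y, hy⟩) p ∈ _
    rw [map_add]
    exact add_mem (hx' p hp) (hy' p hp)
  | mul x y hx hy hx' hy' =>
    change π (⟨x, hx⟩ * ⟨y, hy⟩) p ∈ _
    rw [map_mul]
    exact hx' _ (hy' p hp)

end Orbits

/-! ### Reduced words and inversions -/

section Words

variable {ι V E : Type*} [AddCommGroup V] [Module ℝ V] [AddCommGroup E] [Module ℝ E]
  {P : RootPairing ι ℝ V E} {b : P.Base}

/-- The permutation of the roots given by composition with the element represented by a word. -/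
def rootPerm : List b.support → Equiv.Perm ι
  | [] => 1
  | i :: l => rootPerm l * P.reflectionPerm i

theorem root_reflectionPerm_self (i : ι) : P.root (P.reflectionPerm i i) = -P.root i := by
  rw [P.root_reflectionPerm, P.reflection_apply_self]

theorem root'_reflectionPerm (i j : ι) (y : E) :
    P.root' (P.reflectionPerm i j) y = P.root' j (affRefl P (i, 0) y) := by
  have h : P.root' j (P.coroot i) = P.pairing j i := rfl
  rw [affRefl_apply, map_sub, map_smul, h, RootPairing.root', P.root_reflectionPerm,
    P.reflection_apply_root]
  simp [RootPairing.root', mul_comm]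

theorem wordProd_cons (i : b.support) (l : List b.support) :
    wordProd b (i :: l) = affRefl P (i, 0) * wordProd b l := by
  simp [wordProd]

theorem root'_rootPerm (l : List b.support) (j : ι) (y : E) :
    P.root' (rootPerm l j) y = P.root' j (wordProd b l y) := by
  induction l generalizing j with
  | nil => rfl
  | cons i l ih =>
    rw [wordProd_cons, rootPerm, Equiv.Perm.mul_apply, Equiv.Perm.mul_apply, ih,
      root'_reflectionPerm]

theorem affRefl_reflectionPerm (i j : ι) :
    affRefl P (P.reflectionPerm i j, 0) = affRefl P (i, 0) * affRefl P (j, 0) * affRefl P (i, 0) := by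
  ext y
  rw [Equiv.Perm.mul_apply, Equiv.Perm.mul_apply, affRefl_apply (_, _), root'_reflectionPerm]
  have h : P.coroot (P.reflectionPerm i j)
      = P.coroot j - P.root' i (P.coroot j) • P.coroot i := by
    rw [P.coroot_reflectionPerm, P.coreflection_apply]
  generalize hz : affRefl P (i, 0) y = z
  have hy : y = affRefl P (i, 0) z := by rw [← hz]; exact (affRefl_involutive P (i, 0) y).symm
  rw [hy, h, affRefl_apply (i, 0), affRefl_apply (i, 0), affRefl_apply (j, 0)]
  simp only [map_sub, map_smul, Int.cast_zero, add_zero, smul_eq_mul]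
  module

theorem affRefl_mul_self (a : ι × ℤ) : affRefl P a * affRefl P a = 1 :=
  Equiv.ext (affRefl_involutive P a)

theorem root'_injective {i j : ι} (h : ∀ y, P.root' i y = P.root' j y) : i = j := by
  exact P.root.injective ((LinearMap.IsPerfPair.bijective_left P.toLinearMap).injective (LinearMap.ext h))

theorem isPos_reflectionPerm_self (i : ι) : b.IsPos (P.reflectionPerm i i) ↔ ¬ b.IsPos i :=
  RootPairing.Base.IsPos.neg_iff_not b i

theorem not_isPos_reflectionPerm [Finite ι] [P.IsCrystallographic] [P.IsReduced] {i : b.support} {j : ι} (hj : ¬ b.IsPos j)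
    (hij : P.reflectionPerm j j ≠ i) : ¬ b.IsPos (P.reflectionPerm i j) := by
  rw [← isPos_reflectionPerm_self] at hj ⊢
  convert hj.reflectionPerm i.2 hij using 1
  apply P.root.injective
  rw [root_reflectionPerm_self, P.root_reflectionPerm, P.root_reflectionPerm,
    root_reflectionPerm_self, map_neg]

/-- The exchange property. -/
theorem exists_wordProd_eq_mul [Finite ι] [P.IsCrystallographic] [P.IsReduced] (l : List b.support) {j : ι} (hj : b.IsPos j)
    (h : ¬ b.IsPos (rootPerm l j)) :
    ∃ l' : List b.support, l'.length + 1 = l.length ∧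
      affRefl P (j, 0) * wordProd b l = wordProd b l' := by
  induction l generalizing j with
  | nil => exact absurd hj h
  | cons i l ih =>
    by_cases hij : j = i
    · refine ⟨l, rfl, ?_⟩
      rw [hij, wordProd_cons, ← mul_assoc, affRefl_mul_self, one_mul]
    · obtain ⟨l', hl', h'⟩ := ih (hj.reflectionPerm i.2 hij) h
      refine ⟨i :: l', by simp [hl'], ?_⟩
      rw [wordProd_cons, wordProd_cons, ← h', affRefl_reflectionPerm]
      simp only [← mul_assoc]
      rw [affRefl_mul_self, one_mul]

theorem IsReducedExpr.tail {i : b.support} {l : List b.support} {w : Equiv.Perm E}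
    (h : IsReducedExpr b w (i :: l)) : IsReducedExpr b (wordProd b l) l := by
  refine ⟨rfl, fun l' hl' => ?_⟩
  have := h.2 (i :: l') (by rw [wordProd_cons, hl', ← wordProd_cons, h.1])
  simpa using this

/-- Were αᵢ composed with the tail negative, the exchange property would absorb the first letter and
shorten the word by two letters. -/
theorem IsReducedExpr.isPos [Finite ι] [P.IsCrystallographic] [P.IsReduced] {i : b.support} {l : List b.support} {w : Equiv.Perm E}
    (h : IsReducedExpr b w (i :: l)) : b.IsPos (rootPerm l i) := by
  by_contra hn
  obtain ⟨l', hl', h'⟩ := exists_wordProd_eq_mul l (RootPairing.Base.isPos_of_mem_support i.2) hn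
  have := h.2 l' (by rw [← h', ← wordProd_cons, h.1])
  rw [List.length_cons] at this
  omega

theorem mem_inversions_wordProd {l : List b.support} {j : ι} :
    j ∈ inversions b (wordProd b l) ↔ b.IsPos j ∧ ∃ i, ¬ b.IsPos i ∧ rootPerm l i = j := by
  refine and_congr Iff.rfl (exists_congr fun i => and_congr Iff.rfl ⟨fun h => ?_, ?_⟩)
  · exact root'_injective fun y => (root'_rootPerm l i y).trans (h y)
  · rintro rfl y
    exact (root'_rootPerm l i y).symm

theorem rootPerm_reflectionPerm_self (l : List b.support) (j : ι) :
    rootPerm l (P.reflectionPerm j j) = P.reflectionPerm (rootPerm l j) (rootPerm l j) := by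
  refine root'_injective (P := P) fun y => ?_
  have h : ∀ (j : ι) (y : E), P.root' (P.reflectionPerm j j) y = -P.root' j y := by
    intro j y
    rw [RootPairing.root', P.root_reflectionPerm]; simp [RootPairing.root']
  rw [root'_rootPerm, h, h, root'_rootPerm]

/-- The simple reflection sᵢ permutes the negative roots other than -αᵢ, so prefixing it to w adds
just one inversion, w⁻¹αᵢ. -/
theorem inversions_wordProd_cons [Finite ι] [P.IsCrystallographic] [P.IsReduced] {i : b.support} {l : List b.support}
    (h : b.IsPos (rootPerm l i)) :
    inversions b (wordProd b (i :: l)) = insert (rootPerm l i) (inversions b (wordProd b l)) := by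
  ext j
  rw [Set.mem_insert_iff, mem_inversions_wordProd, mem_inversions_wordProd]
  constructor
  · rintro ⟨hj, m, hm, hmj⟩
    by_cases him : P.reflectionPerm m m = i
    · left
      rw [← hmj, rootPerm, Equiv.Perm.mul_apply]
      congr 1
      apply P.root.injective
      rw [P.root_reflectionPerm, P.reflection_apply, ← him]
      have : P.coroot' (P.reflectionPerm m m) (P.root m) = -2 := by
        simp
      rw [this, root_reflectionPerm_self]
      module
    · exact Or.inr ⟨hj, _, not_isPos_reflectionPerm hm him, hmj⟩
  · rintro (rfl | ⟨hj, m, hm, hmj⟩)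
    · refine ⟨h, P.reflectionPerm i i, ?_, ?_⟩
      · rw [isPos_reflectionPerm_self, not_not]
        exact RootPairing.Base.isPos_of_mem_support i.2
      · rw [rootPerm, Equiv.Perm.mul_apply, P.reflectionPerm_self]
    · refine ⟨hj, P.reflectionPerm i m, not_isPos_reflectionPerm hm fun him => ?_, ?_⟩
      · rw [← him, rootPerm_reflectionPerm_self, hmj, isPos_reflectionPerm_self] at h
        exact h hj
      · rw [rootPerm, Equiv.Perm.mul_apply, P.reflectionPerm_self, hmj]

theorem rootPerm_notMem_inversions (i : b.support) (l : List b.support) :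
    rootPerm l i ∉ inversions b (wordProd b l) := by
  rw [mem_inversions_wordProd]
  rintro ⟨-, m, hm, hmj⟩
  rw [(rootPerm l).injective hmj] at hm
  exact hm (RootPairing.Base.isPos_of_mem_support i.2)

variable {F : Type*} [Field F]

theorem multiplicity_rootPerm [P.IsCrystallographic] (k : Multiplicity F P) (l : List b.support) (j : ι) :
    k.k (rootPerm l j, 0) = k.k (j, 0) ∧ k.u (rootPerm l j, 0) = k.u (j, 0) := by
  induction l generalizing j with
  | nil => exact ⟨rfl, rfl⟩
  | cons i l ih =>
    have h : affAct P ((i : ι), 0) (j, 0) = (P.reflectionPerm i j, 0) := by simp [affAct]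
    rw [rootPerm, Equiv.Perm.mul_apply, (ih _).1, (ih _).2, ← h, k.k_invariant, k.u_invariant]
    exact ⟨rfl, rfl⟩

/-- The new inversion w⁻¹αᵢ lies in the W₀-orbit of αᵢ, so it carries the same parameters, and its
value at c is αᵢ(wc): the new factor is the one produced by Tᵢ at wc. -/
theorem kappa_wordProd_cons [Fintype ι] [P.IsCrystallographic] [P.IsReduced]
    (k : Multiplicity F P) (c : E) {i : b.support}
    {l : List b.support} (h : b.IsPos (rootPerm l i)) :
    kappa b k c (wordProd b (i :: l)) = wallFactor (k.k (i, 0)) (k.u (i, 0))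
      (P.root' i (wordProd b l c)) * kappa b k c (wordProd b l) := by
  classical
  have hs : Finset.univ.filter (· ∈ inversions b (wordProd b (i :: l)))
      = insert (rootPerm l i) (Finset.univ.filter (· ∈ inversions b (wordProd b l))) := by
    ext j
    simp [inversions_wordProd_cons h]
  rw [kappa, kappa]
  convert (congrArg (fun s => ∏ i ∈ s, k.k (i, 0) ^ chiE (P.root' i c)
    * k.u (i, 0) ^ (-chiO (P.root' i c))) hs).trans
    (Finset.prod_insert (by simpa using rootPerm_notMem_inversions i l)) using 2
  rw [wallFactor, (multiplicity_rootPerm k l i).1, (multiplicity_rootPerm k l i).2, root'_rootPerm]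

theorem kappa_one [Fintype ι] [P.IsCrystallographic] (k : Multiplicity F P) (c : E) : kappa b k c 1 = 1 := by
  have h : ∀ i, i ∉ inversions b (1 : Equiv.Perm E) := by
    rintro i ⟨hi, j, hj, h⟩
    exact hj (root'_injective (P := P) h ▸ hi)
  simp [kappa, h]

/-- At each letter αᵢ(wc) is the value at c of a positive root, hence in [0,1] by the choice of c,
so no truncated quotient creates a further monomial. -/
theorem prod_truncDL_mono [Fintype ι] [P.IsCrystallographic] [P.IsReduced]
    (k : Multiplicity F P) {c : E} (hc : c ∈ closedAlcove b)
    {w : Equiv.Perm E} {l : List b.support} (h : IsReducedExpr b w l) :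
    (l.map fun i : b.support => truncDL k (i : ι)).prod (mono F c)
      = (kappa b k c w : F) • mono F (w c) := by
  induction l generalizing w with
  | nil =>
    obtain rfl : 1 = w := h.1
    rw [kappa_one]
    simp
  | cons i l ih =>
    have hpos := h.isPos
    obtain ⟨h0, h1⟩ := hc _ hpos
    rw [root'_rootPerm] at h0 h1
    rw [← h.1, kappa_wordProd_cons k c hpos, List.map_cons, List.prod_cons, Module.End.mul_apply,
      ih h.tail, map_smul, truncDL_eq_tdl, tdl_mono_of_mem_Icc _ _ (root'_coroot_two _) h0 h1,
      smul_smul, mul_comm, Units.val_mul, wordProd_cons, Equiv.Perm.mul_apply, affRefl_apply]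
    simp

end Words

/-! ### Type C -/

section TypeC

theorem chiZ_eq (s : ℝ) : chiZ s = chiE s + chiO s := by
  by_cases h : ∃ n : ℤ, (n : ℝ) = s
  · obtain ⟨n, rfl⟩ := h
    rw [chiZ, if_pos ⟨n, rfl⟩, chiE, chiO]
    rcases Int.even_or_odd n with hn | hn
    · rw [if_pos ⟨n, hn, rfl⟩, if_neg, add_zero]
      rintro ⟨m, hm, h⟩
      rw [Int.cast_injective h] at hm
      exact (Int.not_even_iff_odd.mpr hm) hn
    · rw [if_neg, if_pos ⟨n, hn, rfl⟩, zero_add]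
      rintro ⟨m, hm, h⟩
      rw [Int.cast_injective h] at hm
      exact (Int.not_even_iff_odd.mpr hn) hm
  · rw [chiZ, if_neg h, chiE, chiO, if_neg fun ⟨n, _, hn⟩ => h ⟨n, hn⟩,
      if_neg fun ⟨n, _, hn⟩ => h ⟨n, hn⟩, add_zero]

theorem floor_cases (s : ℝ) : (floorE s = ⌊s⌋ ∧ floorO s = ⌊s⌋ - 1) ∨
    (floorO s = ⌊s⌋ ∧ floorE s = ⌊s⌋ - 1) := by
  have h0 := Int.floor_le s
  have h1 := Int.lt_floor_add_one s
  rcases Int.even_or_odd' ⌊s⌋ with ⟨m, hm | hm⟩ <;> rw [hm] at h0 h1 ⊢ <;> push_cast at h0 h1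
  · exact Or.inl ⟨floorE_eq h0 (by linarith), floorO_eq (by linarith) h1⟩
  · refine Or.inr ⟨?_, ?_⟩
    · rw [floorO_eq (n := m + 1) (by push_cast; linarith) (by push_cast; linarith)]; ring
    · rw [floorE_eq (n := m) (by linarith) (by linarith)]; ring

variable {F : Type*} [Field F] {n : ℕ}

/-- With equal parameters the truncated operator only involves the integral floor. -/
theorem tdl_self_mono {E : Type*} [AddCommGroup E] [Module ℝ E] (α : E →ₗ[ℝ] ℝ) {v : E}
    (hv : v ≠ 0) (k : Fˣ) (y : E) :
    tdl α v k k (mono F y) = ((k ^ chiZ (α y) : Fˣ) : F) • mono F (y - α y • v)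
      + ((k : F) - (k⁻¹ : Fˣ)) • (exactQuot (1 - mono F (-⌊α y⌋ • v)) (1 - mono F v)
        * mono F y) := by
  apply mul_left_cancel₀ (den_ne_zero (F := F) hv)
  have h1 : exactQuot (1 - mono F (-⌊α y⌋ • v)) (1 - mono F v) * (1 - mono F v)
      = 1 - mono F (-⌊α y⌋ • v) := exactQuot_mul (one_sub_mono_dvd v _)
  have h2 : den F v = (1 - mono F v) * (1 + mono F v) := by
    rw [den, two_smul, ← mono_mul]; ring
  have h3 : mono F (-(⌊α y⌋ - 1) • v) = mono F v * mono F (-⌊α y⌋ • v) := by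
    rw [mono_mul]; congr 1; module
  rw [den_mul_tdl_mono, chiZ_eq, zpow_add, num]
  -- The even and odd floors are ⌊α(y)⌋ and ⌊α(y)⌋ - 1 in some order. With equal parameters only
  -- their sum matters, and the factor 1 + x^v cancels against the denominator.
  have h4 : mono F (-floorE (α y) • v) + mono F (-floorO (α y) • v)
      = (1 + mono F v) * mono F (-⌊α y⌋ • v) := by
    rcases floor_cases (α y) with ⟨h, h'⟩ | ⟨h, h'⟩ <;> rw [h, h', h3] <;> ring
  rw [mul_add, mul_smul_comm, mul_smul_comm]
  congr 1
  have h5 : den F v * (exactQuot (1 - mono F (-⌊α y⌋ • v)) (1 - mono F v) * mono F y)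
      = (1 + mono F v - (mono F (-floorE (α y) • v) + mono F (-floorO (α y) • v))) * mono F y := by
    rw [h2, h4]
    linear_combination (1 + mono F v) * mono F y * h1
  rw [h5]
  simp only [Algebra.smul_def]
  ring

/-- The root `y_i - y_{i+1}`. -/
noncomputable def cRoot (i : Fin n) : (Fin (n + 1) → ℝ) →ₗ[ℝ] ℝ :=
  (LinearMap.proj i.castSucc : (Fin (n + 1) → ℝ) →ₗ[ℝ] ℝ) - LinearMap.proj i.succ

/-- The co-root `ε_i - ε_{i+1}`. -/
def cCoroot (i : Fin n) : Fin (n + 1) → ℝ := eps i.castSucc - eps i.succ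

/-- The root `2 y_r`. -/
noncomputable def cRootLast (n : ℕ) : (Fin (n + 1) → ℝ) →ₗ[ℝ] ℝ :=
  (2 : ℝ) • LinearMap.proj (Fin.last n)

theorem eps_apply (i j : Fin (n + 1)) : eps i j = if j = i then 1 else 0 := by
  rw [eps, Pi.single_apply]

theorem cRoot_apply (i : Fin n) (y : Fin (n + 1) → ℝ) : cRoot i y = y i.castSucc - y i.succ := rfl

theorem cRootLast_apply (y : Fin (n + 1) → ℝ) : cRootLast n y = 2 * y (Fin.last n) := rfl

theorem cRoot_cCoroot (i j : Fin n) : cRoot i (cCoroot j) =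
    (if (i : ℕ) = j then 2 else 0) - (if (i : ℕ) + 1 = j then 1 else 0)
      - (if (j : ℕ) + 1 = i then 1 else 0) := by
  simp only [cRoot_apply, cCoroot, Pi.sub_apply, eps_apply, Fin.ext_iff, Fin.val_castSucc,
    Fin.val_succ]
  split_ifs <;> first | omega | norm_num

theorem cRoot_eps_last (i : Fin n) :
    cRoot i (eps (Fin.last n)) = if (i : ℕ) + 1 = n then -1 else 0 := by
  have := i.2
  simp only [cRoot_apply, eps_apply, Fin.ext_iff, Fin.val_castSucc, Fin.val_succ, Fin.val_last]
  split_ifs <;> first | omega | norm_num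

theorem cRootLast_cCoroot (i : Fin n) :
    cRootLast n (cCoroot i) = if (i : ℕ) + 1 = n then -2 else 0 := by
  have := i.2
  simp only [cRootLast_apply, cCoroot, Pi.sub_apply, eps_apply, Fin.ext_iff, Fin.val_castSucc,
    Fin.val_succ, Fin.val_last]
  split_ifs <;> first | omega | norm_num

theorem cRootLast_eps_last : cRootLast n (eps (Fin.last n)) = 2 := by
  simp [cRootLast_apply, eps_apply]

theorem cRoot_cCoroot_self (i : Fin n) : cRoot i (cCoroot i) = 2 := by
  simp [cRoot_cCoroot]

theorem cT_eq_tdl (k : Fˣ) (i : Fin n) : cT k i = tdl (cRoot i) (cCoroot i) k k := by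
  refine linearMap_ext_mono fun y => ?_
  rw [tdl_self_mono _ (ne_zero_of_apply_eq_two (cRoot_cCoroot_self i)), cT, linExt_mono, cNabla,
    linExt_mono, cRoot_apply]
  congr 3
  · funext j
    simp only [cCoroot, Pi.sub_apply, Pi.smul_apply, eps_apply, smul_eq_mul]
    have hne : i.castSucc ≠ i.succ := by simp [Fin.ext_iff]
    rcases eq_or_ne j i.castSucc with rfl | h1
    · rw [Equiv.swap_apply_left, if_pos rfl, if_neg hne]; ring
    · rcases eq_or_ne j i.succ with rfl | h2
      · rw [Equiv.swap_apply_right, if_neg h1, if_pos rfl]; ring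
      · rw [Equiv.swap_apply_of_ne_of_ne h1 h2, if_neg h1, if_neg h2]; ring
  · congr 3
    rw [cCoroot]
    module

theorem cTlast_eq_tdl (kr ur : Fˣ) :
    cTlast n kr ur = tdl (cRootLast n) (eps (Fin.last n)) kr ur := by
  refine linearMap_ext_mono fun y => ?_
  rw [cTlast, tdl, linExt_mono, linExt_mono, cNablaE, cNablaO, linExt_mono, linExt_mono,
    cRootLast_apply]
  congr 4
  funext j
  simp only [Pi.sub_apply, Pi.smul_apply, eps_apply, smul_eq_mul]
  rcases eq_or_ne j (Fin.last n) with rfl | h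
  · rw [Function.update_self, if_pos rfl]; ring
  · rw [Function.update_of_ne h, if_neg h]; ring

/-- The relations of the finite Hecke algebra of type C. -/
theorem typeC_relations (κ κr υr : Fˣ) :
    (∀ i j : Fin n, (i : ℕ) + 1 = j → cT κ i * cT κ j * cT κ i = cT κ j * cT κ i * cT κ j) ∧
    (∀ i j : Fin n, (i : ℕ) + 1 < j → cT κ i * cT κ j = cT κ j * cT κ i) ∧
    (∀ i : Fin n, (i : ℕ) + 1 = n →
      cT κ i * cTlast n κr υr * cT κ i * cTlast n κr υr
        = cTlast n κr υr * cT κ i * cTlast n κr υr * cT κ i) ∧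
    (∀ i : Fin n, (i : ℕ) + 1 < n → cT κ i * cTlast n κr υr = cTlast n κr υr * cT κ i) ∧
    (∀ i : Fin n, (cT κ i - (κ : F) • 1) * (cT κ i + ((κ⁻¹ : Fˣ) : F) • 1) = 0) ∧
    (cTlast n κr υr - (κr : F) • 1) * (cTlast n κr υr + ((κr⁻¹ : Fˣ) : F) • 1) = 0 := by
  simp only [cT_eq_tdl, cTlast_eq_tdl]
  refine ⟨fun i j h => ?_, fun i j h => ?_, fun i h => ?_, fun i h => ?_, fun i => ?_, ?_⟩
  · exact RankTwo.braid_A2 ⟨cRoot i, cRoot j, cCoroot i, cCoroot j, cRoot_cCoroot_self i,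
      cRoot_cCoroot_self j, by rw [cRoot_cCoroot, if_neg, if_pos, if_neg] <;> first | omega | norm_num,
      by rw [cRoot_cCoroot, if_neg, if_neg, if_pos] <;> first | omega | norm_num⟩ κ
  · exact RankTwo.braid_A1A1 ⟨cRoot i, cRoot j, cCoroot i, cCoroot j, cRoot_cCoroot_self i,
      cRoot_cCoroot_self j, by rw [cRoot_cCoroot, if_neg, if_neg, if_neg] <;> first | omega | norm_num,
      by rw [cRoot_cCoroot, if_neg, if_neg, if_neg] <;> first | omega | norm_num⟩ κ κ κ κ
  -- The long root 2y_r takes even values on both co-roots, so its two parameters are independent;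
  -- the short root takes the value -1 on ε_r and has a single one.
  · exact RankTwo.braid_B2 ⟨cRoot i, cRootLast n, cCoroot i, eps (Fin.last n), cRoot_cCoroot_self i,
      cRootLast_eps_last, by rw [cRoot_eps_last, if_pos h]; norm_num,
      by rw [cRootLast_cCoroot, if_pos h]; norm_num⟩ κ κr υr
  · exact RankTwo.braid_A1A1 ⟨cRoot i, cRootLast n, cCoroot i, eps (Fin.last n),
      cRoot_cCoroot_self i, cRootLast_eps_last, by rw [cRoot_eps_last, if_neg h.ne]; norm_num,
      by rw [cRootLast_cCoroot, if_neg h.ne]; norm_num⟩ κ κ κr υr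
  · exact tdl_quadratic κ κ (cRoot_cCoroot_self i)
  · exact tdl_quadratic κr υr cRootLast_eps_last

end TypeC

end QuasiPoly

/-! ### The theorem. -/

open QuasiPoly in
open Classical in
theorem theorem3p3 {F ι V E : Type*} [Field F] [CharZero F] [Fintype ι]
    [AddCommGroup V] [Module ℝ V] [AddCommGroup E] [Module ℝ E]
    (P : RootPairing ι ℝ V E) [P.IsRootSystem] [P.IsCrystallographic] [P.IsReduced]
    [P.IsIrreducible] (b : P.Base) (φ : ι) (hφ : IsHighestRoot b φ)
    (k : Multiplicity F P) (q : Fˣ) :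
    (∃ π : HX b φ k q →ₐ[F] Module.End F (AddMonoidAlgebra F E),
      (∀ (μ : P.corootSpan ℤ) (y : E), π (hxX b φ k q μ) (mono F y) = mono F (y + (μ : E))) ∧
      (∀ i : b.support, π (hxT b φ k q i) = truncDL k i) ∧
      (∀ π' : HX b φ k q →ₐ[F] Module.End F (AddMonoidAlgebra F E),
        (∀ (μ : P.corootSpan ℤ) (y : E),
          π' (hxX b φ k q μ) (mono F y) = mono F (y + (μ : E))) →
        (∀ i : b.support, π' (hxT b φ k q i) = truncDL k i) → π' = π) ∧
      DirectSum.IsInternal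
        (fun O : MulAction.orbitRel.Quotient (affWeyl P) E => quasiSpan F O.orbit) ∧
      (∀ (O : MulAction.orbitRel.Quotient (affWeyl P) E) (h : HX b φ k q),
        ∀ p ∈ quasiSpan F O.orbit, π h p ∈ quasiSpan F O.orbit) ∧
      (∀ (O : MulAction.orbitRel.Quotient (affWeyl P) E), ∀ c ∈ O.orbit, c ∈ closedAlcove b →
        ∀ (μ : P.corootSpan ℤ), ∀ w ∈ finWeyl P, ∀ l : List b.support, IsReducedExpr b w l →
          π (hxX b φ k q μ * (l.map (hxT b φ k q)).prod) (mono F c)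
            = (kappa b k c w : F) • mono F ((μ : E) + w c))) ∧
    (∀ (n : ℕ) (κ κr υr : Fˣ),
      (∀ i j : Fin n, (i : ℕ) + 1 = j →
        cT κ i * cT κ j * cT κ i = cT κ j * cT κ i * cT κ j) ∧
      (∀ i j : Fin n, (i : ℕ) + 1 < j → cT κ i * cT κ j = cT κ j * cT κ i) ∧
      (∀ i : Fin n, (i : ℕ) + 1 = n →
        cT κ i * cTlast n κr υr * cT κ i * cTlast n κr υr
          = cTlast n κr υr * cT κ i * cTlast n κr υr * cT κ i) ∧
      (∀ i : Fin n, (i : ℕ) + 1 < n →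
        cT κ i * cTlast n κr υr = cTlast n κr υr * cT κ i) ∧
      (∀ i : Fin n, (cT κ i - (κ : F) • 1) * (cT κ i + ((κ⁻¹ : Fˣ) : F) • 1) = 0) ∧
      (cTlast n κr υr - (κr : F) • 1) * (cTlast n κr υr + ((κr⁻¹ : Fˣ) : F) • 1) = 0) := by
  obtain ⟨π, hX, hT⟩ := exists_rep b φ hφ k q
  refine ⟨⟨π, hX, hT, fun π' hX' hT' => rep_unique (fun μ => ?_) (fun i => ?_),
    isInternal_quasiSpan_orbit _, fun O h p hp => rep_mem_quasiSpan hX hT O h p hp,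
    fun O c _ hc μ w _ l hl => ?_⟩, fun n κ κr υr => typeC_relations κ κr υr⟩
  · exact linearMap_ext_mono fun y => (hX' μ y).trans (hX μ y).symm
  · rw [hT', hT]
  · have hl' : π (l.map (hxT b φ k q)).prod
        = (l.map fun i : b.support => truncDL k (i : ι)).prod := by
      rw [map_list_prod, List.map_map]
      congr 1
      exact List.map_congr_left fun i _ => hT i
    rw [map_mul, Module.End.mul_apply, hl', prod_truncDL_mono k hc hl, map_smul, hX, add_comm]
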